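/- A planar straight line graph (PSLG) $\Gamma$ is a compact subset of the plane together with a finite set $V(\Gamma)\subset\Gamma$ of vertices such that $\Gamma\setminus V(\Gamma)$ is a finite union of pairwise disjoint bounded open line segments, called edges, whose endpoints all belong to $V(\Gamma)$ (isolated vertices are allowed). The faces of $\Gamma$ are the bounded connected components of $\mathbb{R}^2\setminus\Gamma$, and the polynomial hull $\mathrm{PH}(\Gamma)$ is the union of $\Gamma$ and all its faces. A refinement of $\Gamma$ is a PSLG $\Gamma'$ with $V(\Gamma)\subset V(\Gamma')$ and $\Gamma\subset\Gamma'$. An angle of a face $\Omega$ at a vertex $v$ is a sector with apex $v$, of measure in $(0,2\pi]$, such that near $v$ its two bounding rays lie in $\Gamma$ and its interior lies in $\Omega$. There is a universal constant $C$ such that the following holds. Let $\Gamma$ be a non-empty PSLG with $n$ vertices such that $\mathrm{PH}(\Gamma)$ is connected. Then there is a refinement $\Gamma'$ of $\Gamma$ such that $\Gamma'$ is connected; the number of vertices of $\Gamma'$ that are not vertices of $\Gamma$ plus the number of edges of $\Gamma'$ that are not edges of $\Gamma$ is at most $Cn$; every face of $\Gamma'$ is the interior of a simple polygon; and every angle of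 a face of $\Gamma'$ of measure less than $60^\circ$ is already an angle (the same sector at the same vertex) of a face of $\Gamma$. -/

import Mathlib

/-- The open segment between the two endpoints of an unordered pair of points of the plane. -/
def openEdge (e : Sym2 ℂ) : Set ℂ :=
  Sym2.lift ⟨fun a b : ℂ => openSegment ℝ a b, fun a b => openSegment_symm ℝ a b⟩ e

/-- A planar straight line graph: finitely many vertices in the plane `ℂ = ℝ²`, and finitely many
pairwise disjoint bounded open segments (the edges), which contain no vertex and whose endpoints
are vertices. Isolated vertices are allowed. -/
structure PSLG where
  /-- The vertices. -/
  verts : Finset ℂ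
  /-- The edges, each given by its pair of endpoints. -/
  edges : Finset (Sym2 ℂ)
  endpoint_mem : ∀ e ∈ edges, ∀ v ∈ e, v ∈ verts
  not_isDiag : ∀ e ∈ edges, ¬ e.IsDiag
  vertex_notMem : ∀ e ∈ edges, ∀ v ∈ verts, v ∉ openEdge e
  disjoint_edges : ∀ e ∈ edges, ∀ f ∈ edges, e ≠ f → Disjoint (openEdge e) (openEdge f)

/-- `Ω` is a bounded connected component of the complement of `K`. -/
def IsBoundedComplComponent (K Ω : Set ℂ) : Prop :=
  Bornology.IsBounded Ω ∧ ∃ z ∈ Kᶜ, Ω = connectedComponentIn Kᶜ z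

namespace PSLG

/-- The compact planar set formed by the vertices and edges. -/
def carrier (Γ : PSLG) : Set ℂ :=
  (Γ.verts : Set ℂ) ∪ ⋃ e ∈ Γ.edges, openEdge e

/-- The faces are the bounded components of the complement. -/
def IsFace (Γ : PSLG) (Ω : Set ℂ) : Prop :=
  IsBoundedComplComponent Γ.carrier Ω

/-- The polynomial hull: the union of the graph and all its (bounded) faces. -/
def polynomialHull (Γ : PSLG) : Set ℂ :=
  Γ.carrier ∪ ⋃₀ {Ω | Γ.IsFace Ω}

/-- `Γ'` is a refinement of `Γ`. -/
def IsRefinement (Γ' Γ : PSLG) : Prop :=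
  Γ.verts ⊆ Γ'.verts ∧ Γ.carrier ⊆ Γ'.carrier

/-- The face `Ω` of `Γ` has at the vertex `v` the angle bounded by the rays from `v` in the
directions `exp (iα)` and `exp (iβ)`, `α < β ≤ α + 2π`: near `v` both rays run in the graph, and
the open sector swept out counterclockwise from the first to the second ray lies in `Ω`.
The measure of this angle is `β - α`. -/
def IsAngleOf (Γ : PSLG) (Ω : Set ℂ) (v : ℂ) (α β : ℝ) : Prop :=
  Γ.IsFace Ω ∧ v ∈ Γ.verts ∧ α < β ∧ β ≤ α + 2 * Real.pi ∧
    ∃ r : ℝ, 0 < r ∧ ∀ s : ℝ, 0 < s → s < r →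
      v + s * Complex.exp (α * Complex.I) ∈ Γ.carrier ∧
      v + s * Complex.exp (β * Complex.I) ∈ Γ.carrier ∧
      ∀ θ : ℝ, α < θ → θ < β → v + s * Complex.exp (θ * Complex.I) ∈ Ω

end PSLG

/-- The closed polygon is simple: it has at least three vertices, the vertices are distinct, the
open edges are pairwise disjoint, and no vertex lies on an open edge. -/
def Polygon.IsSimpleClosed {k : ℕ} (P : Polygon ℂ k) : Prop :=
  3 ≤ k ∧ Function.Injective P.vertices ∧
    (∀ i j : Fin k, i ≠ j → Disjoint
      (openSegment ℝ (P i) (P (finRotate k i))) (openSegment ℝ (P j) (P (finRotate k j)))) ∧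
    ∀ i j : Fin k, P i ∉ openSegment ℝ (P j) (P (finRotate k j))

/-- `Ω` is the interior of a simple polygon, that is, the bounded component of the complement of
its boundary curve. -/
def IsSimplePolygonalDomain (Ω : Set ℂ) : Prop :=
  ∃ (k : ℕ) (P : Polygon ℂ k), P.IsSimpleClosed ∧ IsBoundedComplComponent (P.boundary ℝ) Ω

open Filter Topology

/-! New small angles can arise only where an added segment meets something, so every added segment
is made to meet the rest at 60° or more, and only linearly many segments are added. There are two
stages, glued by the transitive notion `PSLG.IsGoodRefinement`.

Connecting (`PSLG.exists_connected`). While the graph is disconnected, a shortest segment between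
two different components is added. Minimality keeps its interior off the graph and forces angles of
at least 90° at its ends. It stays in the hull: otherwise it runs through the unbounded
complementary component, whose frontier is connected because the plane is unicoherent and the hull
is connected, and then both ends lie in one component of the graph. At most n joins occur.

Fattening (`PSLG.exists_simple_faces`). In a connected graph each vertex is surrounded by a tiny
regular hexagon, each side of each edge is lined by a thin strip from hexagon to hexagon, and a
vertex whose edges all lie in an open half-plane gets a spoke pointing away from them. A ray from
the center of a regular hexagon leaves through a side whose normal is within 30° of the ray. Hence
edges, spokes and strip tops meet hexagon sides at 60° or more, and the corners of a hexagon measure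
120°. Faces inside hexagons and strips are convex; the spokes guarantee that no sector at a vertex
exceeds 180°. Every other face avoids the closed hexagons and strips, and the complement of these is
locally connected at each node, so the face passes each boundary vertex only once. Only the part of
the construction inside the hull is kept, so that an old small angle belongs to a bounded face of
the original graph.

A face of a connected graph which is locally connected at the vertices and is not slit there has
exactly two boundary edges at each boundary vertex. Its boundary graph is thus a disjoint union of
cycles, and connectedness of the frontier leaves one cycle, a simple polygon
(`PSLG.isSimplePolygonalDomain`). The linear count rests on the bound of three edges per vertex,
`card_le_three_mul_of_noncrossing`, proved by a charging argument. -/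

/-! ### Unicoherence of the plane and complementary components -/

/-- Given a separation of `X ∩ Y` into `A` and `B`, take `φ` equal to 0 on `A` and 1 on `B`. The
circle-valued map `exp (2πiφ)` on `X`, extended by 1, is continuous on the plane, so it lifts to a
real function. The lift is constant on `Y` but increases by `2π` from `A` to `B` along `X`. -/
theorem IsPreconnected.inter_of_union_eq_univ {X Y : Set ℂ} (hX : IsClosed X) (hY : IsClosed Y)
    (hXc : IsPreconnected X) (hYc : IsPreconnected Y) (hXY : X ∪ Y = Set.univ) :
    IsPreconnected (X ∩ Y) := by
  classical
  rw [isPreconnected_iff_subset_of_fully_disjoint_closed (hX.inter hY)]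
  intro A B hA hB hAB hdis
  by_contra! hcon
  obtain ⟨h1, h2⟩ := hcon
  obtain ⟨p, hp, hpA⟩ := Set.not_subset.1 h1
  obtain ⟨q, hq, hqB⟩ := Set.not_subset.1 h2
  have hpB : p ∈ B := (hAB hp).resolve_left hpA
  have hqA : q ∈ A := (hAB hq).resolve_right hqB
  obtain ⟨φ, hφA, hφB, -⟩ := exists_continuous_zero_one_of_isClosed hA hB hdis
  let f : ℂ → Circle := fun z => if z ∈ X then Circle.exp (2 * Real.pi * φ z) else 1
  have hone : ∀ z ∈ Y, f z = 1 := by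
    intro z hz
    by_cases hzX : z ∈ X
    · rcases hAB ⟨hzX, hz⟩ with h | h
      · simp [f, hφA h]
      · simp [f, hφB h]
    · simp [f, hzX]
  have hf : Continuous f := by
    -- The frontier of `X` lies in `X ∩ Y`, where `φ` is 0 or 1 and both branches equal 1.
    refine Continuous.if ?_ (by fun_prop) continuous_const
    intro z hz
    have hzX : z ∈ X := hX.frontier_subset hz
    have hzY : z ∈ Y := by
      have : z ∈ closure Xᶜ := by
        rw [← frontier_compl] at hz
        exact frontier_subset_closure hz
      refine closure_minimal ?_ hY this
      intro w hw
      exact (hXY.ge (Set.mem_univ w)).resolve_left hw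
    have := hone z hzY
    simpa [f, hzX] using this
  obtain ⟨g, ⟨-, hg⟩, -⟩ := Circle.isCoveringMap_exp.existsUnique_continuousMap_lifts
    (⟨f, hf⟩ : C(ℂ, Circle)) q 0 (by simp [hone q hq.2])
  have hg' : ∀ z, Circle.exp (g z) = f z := fun z => congrFun hg z
  have e1 : Set.EqOn g (fun _ => g q) Y := by
    refine Circle.isCoveringMap_exp.eqOn_of_comp_eqOn hYc (by fun_prop) (by fun_prop) ?_ hq.2 rfl
    intro z hz
    simp [hg', hone z hz, hone q hq.2]
  have e2 : Set.EqOn g (fun z => g q + 2 * Real.pi * φ z) X := by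
    refine Circle.isCoveringMap_exp.eqOn_of_comp_eqOn hXc (by fun_prop) (by fun_prop) ?_ hq.1 ?_
    · intro z hz
      simp [hg', Circle.exp_add, hone q hq.2, f, hz]
    · simp [hφA hqA]
  have h3 := e1 hp.2
  have h4 := e2 hp.1
  simp only [hφB hpB, Pi.one_apply, mul_one] at h3 h4
  have := Real.pi_pos
  linarith

/-- The frontier of `U` is the intersection of `closure U` and `Uᶜ`, two closed connected sets that
cover the plane. -/
theorem IsOpen.isPreconnected_frontier_of_compl {U : Set ℂ} (hU : IsOpen U)
    (hUc : IsPreconnected U) (hc : IsPreconnected Uᶜ) : IsPreconnected (frontier U) := by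
  have := IsPreconnected.inter_of_union_eq_univ isClosed_closure hU.isClosed_compl hUc.closure hc
    (by
      ext z
      simp only [Set.mem_union, Set.mem_compl_iff, Set.mem_univ, iff_true]
      by_cases hz : z ∈ U
      · exact Or.inl (subset_closure hz)
      · exact Or.inr hz)
  rwa [← Set.sdiff_eq, ← hU.frontier_eq] at this

theorem IsClosed.isOpen_component {K : Set ℂ} (hK : IsClosed K) (z : ℂ) :
    IsOpen (connectedComponentIn Kᶜ z) :=
  hK.isOpen_compl.connectedComponentIn

theorem IsClosed.frontier_component_subset {K : Set ℂ} (hK : IsClosed K) (z : ℂ) :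
    frontier (connectedComponentIn Kᶜ z) ⊆ K := by
  intro w hw
  by_contra hwK
  have hwn : w ∉ connectedComponentIn Kᶜ z := by
    rw [(hK.isOpen_component z).frontier_eq] at hw
    exact hw.2
  have hw' : w ∈ closure (connectedComponentIn Kᶜ z) := frontier_subset_closure hw
  obtain ⟨y, hy1, hy2⟩ := mem_closure_iff.1 hw' _ (hK.isOpen_component w)
    (mem_connectedComponentIn hwK)
  have := connectedComponentIn_eq hy1
  have h2 := connectedComponentIn_eq hy2
  exact hwn (h2 ▸ this ▸ mem_connectedComponentIn hwK)

/-- An open preconnected set avoiding `K` whose frontier lies in `K` contains every preconnected set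
avoiding `K` which it meets. -/
theorem IsPreconnected.subset_of_frontier_subset {K U S : Set ℂ} (hU : IsOpen U)
    (hUK : frontier U ⊆ K) (hS : IsPreconnected S) (hSK : Disjoint S K) (h : (S ∩ U).Nonempty) :
    S ⊆ U := by
  refine hS.subset_left_of_subset_union hU (isClosed_closure (s := U)).isOpen_compl ?_ ?_ h
  · exact Set.disjoint_left.2 fun x hx hx' => hx' (subset_closure hx)
  · intro x hx
    by_contra hcon
    simp only [Set.mem_union, Set.mem_compl_iff, not_or, not_not] at hcon
    refine Set.disjoint_left.1 hSK hx (hUK ?_)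
    rw [hU.frontier_eq]
    exact ⟨hcon.2, hcon.1⟩

/-- Applied with `P` the hull of `Γ`: cutting a connected set `X ⊇ Γ` down to the hull keeps it
connected. `Γ` lies in one part of a separation of `X ∩ P`; adding everything outside `P` to that
part would separate `X`. -/
theorem isPreconnected_frontier_inter {Γ X P : Set ℂ} (hΓ : IsClosed Γ) (hX : IsClosed X)
    (hΓc : IsPreconnected Γ) (hXc : IsPreconnected X) (hΓX : Γ ⊆ X)
    (hP : IsClosed P) (hPo : IsOpen (P \ Γ)) (hΓP : Γ ⊆ P) : IsPreconnected (X ∩ P) := by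
  rw [isPreconnected_iff_subset_of_fully_disjoint_closed (hX.inter hP)]
  have key : ∀ A B : Set ℂ, IsClosed A → IsClosed B → X ∩ P ⊆ A ∪ B → Disjoint A B → Γ ⊆ A →
      (X ∩ P ⊆ A) ∨ X ∩ P ⊆ B := by
    intro A B hA hB hAB hdis hΓA
    by_cases hne : ((X ∩ P) ∩ B).Nonempty
    · obtain ⟨b, ⟨hbX, hbP⟩, hbB⟩ := hne
      have hne' := isPreconnected_closed_iff.1 hXc ((A ∩ P) ∪ (P \ Γ)ᶜ) (B ∩ P)
        ((hA.inter hP).union hPo.isClosed_compl) (hB.inter hP)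
      by_cases hcase : (X ∩ ((A ∩ P) ∪ (P \ Γ)ᶜ)).Nonempty
      · obtain ⟨x, hxX, hx1, hx2⟩ := hne' (by
          intro x hx
          by_cases hxP : x ∈ P
          · rcases hAB ⟨hx, hxP⟩ with h | h
            · exact Or.inl (Or.inl ⟨h, hxP⟩)
            · exact Or.inr ⟨h, hxP⟩
          · exact Or.inl (Or.inr fun h => hxP h.1)) hcase ⟨b, hbX, hbB, hbP⟩
        exfalso
        rcases hx1 with h | h
        · exact Set.disjoint_left.1 hdis h.1 hx2.1
        · have : x ∈ Γ := by
            by_contra hxΓ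
            exact h ⟨hx2.2, hxΓ⟩
          exact Set.disjoint_left.1 hdis (hΓA this) hx2.1
      · right
        intro x hx
        rcases hAB hx with h | h
        · exact absurd ⟨x, hx.1, Or.inl ⟨h, hx.2⟩⟩ hcase
        · exact h
    · left
      intro x hx
      exact (hAB hx).resolve_right fun h => hne ⟨x, hx, h⟩
  intro A B hA hB hAB hdis
  have hΓ' : Γ ⊆ A ∨ Γ ⊆ B :=
    (isPreconnected_iff_subset_of_fully_disjoint_closed hΓ).1 hΓc A B hA hB
      (fun x hx => hAB ⟨hΓX hx, hΓP hx⟩) hdis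
  rcases hΓ' with h | h
  · exact key A B hA hB hAB hdis h
  · exact (key B A hB hA (by rwa [Set.union_comm]) hdis.symm h).symm

theorem isPreconnected_setOf_lt_norm {R : ℝ} (hR : 0 < R) :
    IsPreconnected {z : ℂ | R < ‖z‖} := by
  have : {z : ℂ | R < ‖z‖} = Complex.exp '' {z | Real.log R < z.re} := by
    ext z
    simp only [Set.mem_ofPred_eq, Set.mem_image]
    constructor
    · intro hz
      have h0 : z ≠ 0 := norm_pos_iff.1 (hR.trans hz)
      exact ⟨Complex.log z, by rw [Complex.log_re]; exact Real.log_lt_log hR hz,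
        Complex.exp_log h0⟩
    · rintro ⟨w, hw, rfl⟩
      rw [Complex.norm_exp]
      exact (Real.log_lt_iff_lt_exp hR).1 hw
  rw [this]
  exact ((convex_halfSpace_re_gt _).isPreconnected).image _ Complex.continuous_exp.continuousOn

theorem frontier_nonempty_of_isBounded {U : Set ℂ} (hne : U.Nonempty)
    (hb : Bornology.IsBounded U) : (frontier U).Nonempty := by
  by_contra h
  rw [Set.not_nonempty_iff_eq_empty, frontier_eq_empty_iff] at h
  rcases h with h | h
  · exact hne.ne_empty h
  · rw [h] at hb
    exact NormedSpace.unbounded_univ ℝ ℂ hb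

theorem IsCompact.exists_norm_lt {K : Set ℂ} (hK : IsCompact K) : ∃ R : ℝ, 0 < R ∧ ∀ z ∈ K, ‖z‖ < R := by
  obtain ⟨R, hR⟩ := hK.isBounded.exists_norm_le
  exact ⟨max R 0 + 1, by positivity, fun z hz =>
    (hR z hz).trans_lt (by linarith [le_max_left R 0])⟩

theorem frontier_component_nonempty {K : Set ℂ} (hKn : K.Nonempty) {z : ℂ}
    (hz : z ∈ Kᶜ) : (frontier (connectedComponentIn Kᶜ z)).Nonempty := by
  by_contra h
  rw [Set.not_nonempty_iff_eq_empty, frontier_eq_empty_iff] at h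
  rcases h with h | h
  · have := mem_connectedComponentIn hz
    simp [h] at this
  · obtain ⟨k, hk⟩ := hKn
    have : k ∈ connectedComponentIn Kᶜ z := h ▸ Set.mem_univ k
    exact connectedComponentIn_subset _ _ this hk

/-- Each other complementary component has a frontier point in `K`, hence is attached to the
connected set `K`. -/
theorem isPreconnected_compl_component {K : Set ℂ} (hK : IsClosed K) (hKc : IsPreconnected K)
    (hKn : K.Nonempty) (z : ℂ) : IsPreconnected (connectedComponentIn Kᶜ z)ᶜ := by
  obtain ⟨k, hk⟩ := hKn
  refine isPreconnected_of_forall k ?_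
  intro y hy
  have hKsub : K ⊆ (connectedComponentIn Kᶜ z)ᶜ := fun x hx hx' =>
    connectedComponentIn_subset _ _ hx' hx
  by_cases hyK : y ∈ K
  · exact ⟨K, hKsub, hk, hyK, hKc⟩
  · obtain ⟨w, hw⟩ := frontier_component_nonempty ⟨k, hk⟩ hyK
    have hwK := hK.frontier_component_subset y hw
    have hpre : IsPreconnected (connectedComponentIn Kᶜ y ∪ {w}) :=
      isPreconnected_connectedComponentIn.subset_closure Set.subset_union_left
        (Set.union_subset subset_closure (by simpa using frontier_subset_closure hw))
    refine ⟨K ∪ (connectedComponentIn Kᶜ y ∪ {w}), ?_, Or.inl hk,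
      Or.inr (Or.inl (mem_connectedComponentIn hyK)),
      hKc.union w hwK (Or.inr rfl) hpre⟩
    refine Set.union_subset hKsub (Set.union_subset ?_ (by simpa using hKsub hwK))
    intro x hx hx'
    have h1 := connectedComponentIn_eq hx
    have h2 := connectedComponentIn_eq hx'
    exact hy (h2 ▸ h1 ▸ mem_connectedComponentIn hyK)

/-! ### The polynomial hull -/

/-- `K` together with the bounded components of its complement. -/
def polyHull (K : Set ℂ) : Set ℂ :=
  {z | z ∈ K ∨ Bornology.IsBounded (connectedComponentIn Kᶜ z)}

theorem subset_polyHull (K : Set ℂ) : K ⊆ polyHull K := fun _ hz => Or.inl hz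

theorem PSLG.polynomialHull_eq (Γ : PSLG) : Γ.polynomialHull = polyHull Γ.carrier := by
  ext z
  simp only [PSLG.polynomialHull, polyHull, Set.mem_union, Set.mem_sUnion, Set.mem_ofPred_eq,
    PSLG.IsFace, IsBoundedComplComponent]
  by_cases hz : z ∈ Γ.carrier
  · simp [hz]
  · simp only [hz, false_or]
    constructor
    · rintro ⟨t, ⟨hb, w, hw, rfl⟩, hzt⟩
      rwa [← connectedComponentIn_eq hzt]
    · intro hb
      exact ⟨_, ⟨hb, z, hz, rfl⟩, mem_connectedComponentIn hz⟩

theorem polyHull_component {K : Set ℂ} {z w : ℂ} (hz : z ∈ Kᶜ)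
    (hw : w ∈ connectedComponentIn Kᶜ z) : w ∈ polyHull K ↔ z ∈ polyHull K := by
  have h1 := connectedComponentIn_eq hw
  have h2 := connectedComponentIn_subset _ _ hw
  simp only [polyHull, Set.mem_ofPred_eq]
  rw [h1]
  simp [show z ∉ K from hz, show w ∉ K from h2]

theorem isOpen_polyHull_diff {K : Set ℂ} (hK : IsClosed K) : IsOpen (polyHull K \ K) := by
  rw [isOpen_iff_mem_nhds]
  rintro z ⟨hz, hzK⟩
  filter_upwards [(hK.isOpen_component z).mem_nhds (mem_connectedComponentIn hzK)] with w hw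
  exact ⟨(polyHull_component hzK hw).2 hz, connectedComponentIn_subset _ _ hw⟩

theorem isClosed_polyHull {K : Set ℂ} (hK : IsClosed K) : IsClosed (polyHull K) := by
  rw [← isOpen_compl_iff, isOpen_iff_mem_nhds]
  intro z hz
  have hzK : z ∉ K := fun h => hz (Or.inl h)
  filter_upwards [(hK.isOpen_component z).mem_nhds (mem_connectedComponentIn hzK)] with w hw
  exact fun h => hz ((polyHull_component hzK hw).1 h)

/-- Adding points of the hull only subdivides bounded complementary components; the unbounded one is
left untouched. -/
theorem polyHull_eq_of_subset {K K' : Set ℂ} (h1 : K ⊆ K') (h2 : K' ⊆ polyHull K) :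
    polyHull K' = polyHull K := by
  ext z
  by_cases hz : z ∈ K'
  · simp only [h2 hz, iff_true]
    exact Or.inl hz
  have hzK : z ∉ K := fun h => hz (h1 h)
  simp only [polyHull, Set.mem_ofPred_eq, hz, hzK, false_or]
  constructor
  · intro hb
    by_contra hcon
    have : connectedComponentIn Kᶜ z ⊆ connectedComponentIn K'ᶜ z := by
      refine isPreconnected_connectedComponentIn.subset_connectedComponentIn
        (mem_connectedComponentIn hzK) ?_
      intro w hw hw'
      rcases (polyHull_component hzK hw).1 (h2 hw') with h | h
      · exact hzK h
      · exact hcon h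
    exact hcon (hb.subset this)
  · intro hb
    refine hb.subset ?_
    exact connectedComponentIn_mono _ (Set.compl_subset_compl.2 h1)

/-- All unbounded components reach outside a disc containing `K`; the outside of the disc is
connected, so there is just one such component. -/
theorem isPreconnected_compl_polyHull {K : Set ℂ} (hK : IsCompact K) :
    IsPreconnected (polyHull K)ᶜ := by
  obtain ⟨R, hR, hKR⟩ := hK.exists_norm_lt
  have hsub : {z : ℂ | R < ‖z‖} ⊆ Kᶜ := fun z hz hz' => by
    have := hKR z hz'
    simp only [Set.mem_ofPred_eq] at hz
    linarith
  set z₀ : ℂ := ((R + 1 : ℝ) : ℂ) with hz₀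
  have hz₀R : R < ‖z₀‖ := by
    rw [hz₀, Complex.norm_of_nonneg (by linarith)]
    linarith
  have hz₀K : z₀ ∈ Kᶜ := hsub hz₀R
  have hcomp : (polyHull K)ᶜ = connectedComponentIn Kᶜ z₀ := by
    have hS : {z : ℂ | R < ‖z‖} ⊆ connectedComponentIn Kᶜ z₀ :=
      (isPreconnected_setOf_lt_norm hR).subset_connectedComponentIn hz₀R hsub
    ext z
    constructor
    · intro hz
      have hzK : z ∈ Kᶜ := fun h => hz (Or.inl h)
      have hun : ¬ Bornology.IsBounded (connectedComponentIn Kᶜ z) := fun h => hz (Or.inr h)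
      have : ∃ w ∈ connectedComponentIn Kᶜ z, R < ‖w‖ := by
        by_contra! hcon
        exact hun (isBounded_iff_forall_norm_le.2 ⟨R, hcon⟩)
      obtain ⟨w, hw, hwR⟩ := this
      rw [connectedComponentIn_eq (hS hwR), ← connectedComponentIn_eq hw]
      exact mem_connectedComponentIn hzK
    · intro hz
      have : z₀ ∉ polyHull K := by
        rintro (h | h)
        · exact hz₀K h
        · obtain ⟨B, hB⟩ := (h.subset hS).exists_norm_le
          have h1 := hB ((max R B + 1 : ℝ) : ℂ) (by
            simp only [Set.mem_ofPred_eq]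
            rw [Complex.norm_of_nonneg (by linarith [le_max_left R B])]
            linarith [le_max_left R B])
          rw [Complex.norm_of_nonneg (by linarith [le_max_left R B])] at h1
          linarith [le_max_right R B]
      exact fun h => this ((polyHull_component hz₀K hz).1 h)
  rw [hcomp]
  exact isPreconnected_connectedComponentIn

theorem frontier_polyHull_compl_subset {K : Set ℂ} (hK : IsClosed K) :
    frontier (polyHull K)ᶜ ⊆ K := by
  intro z hz
  by_contra hzK
  rw [frontier_compl, (isClosed_polyHull hK).frontier_eq] at hz
  refine hz.2 (mem_interior_iff_mem_nhds.2 ?_)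
  exact Filter.mem_of_superset ((isOpen_polyHull_diff hK).mem_nhds ⟨hz.1, hzK⟩) Set.sdiff_subset

/-! ### Germs of planar sets: rays and finite cones -/

theorem mem_segment_complex {a b z : ℂ} :
    z ∈ segment ℝ a b ↔ ∃ t : ℝ, 0 ≤ t ∧ t ≤ 1 ∧ z = a + t * (b - a) := by
  rw [segment_eq_image']
  simp only [Set.mem_image, Set.mem_Icc, Complex.real_smul, and_assoc, eq_comm]

theorem mem_openSegment_complex {a b z : ℂ} :
    z ∈ openSegment ℝ a b ↔ ∃ t : ℝ, 0 < t ∧ t < 1 ∧ z = a + t * (b - a) := by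
  rw [openSegment_eq_image']
  simp only [Set.mem_image, Set.mem_Ioo, Complex.real_smul, and_assoc, eq_comm]

theorem isCompact_segment_complex (a b : ℂ) : IsCompact (segment ℝ a b) := by
  rw [segment_eq_image']
  exact isCompact_Icc.image (by fun_prop)

/-- The set `K` runs along the ray from `x` in direction `d` near `x`. -/
def IsRay (K : Set ℂ) (x d : ℂ) : Prop :=
  ∀ᶠ s : ℝ in 𝓝[>] 0, x + s * d ∈ K

theorem eventually_nhdsGT_zero_iff {p : ℝ → Prop} :
    (∀ᶠ s : ℝ in 𝓝[>] 0, p s) ↔ ∃ r : ℝ, 0 < r ∧ ∀ s, 0 < s → s < r → p s := by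
  rw [eventually_nhdsWithin_iff, Metric.eventually_nhds_iff]
  constructor
  · rintro ⟨r, hr, h⟩
    exact ⟨r, hr, fun s h1 h2 => h (by simpa [abs_of_pos h1] using h2) h1⟩
  · rintro ⟨r, hr, h⟩
    refine ⟨r, hr, fun y hy hy0 => h y hy0 ?_⟩
    rw [Real.dist_eq, sub_zero] at hy
    exact (le_abs_self y).trans_lt hy

theorem IsRay.exists_pos {K : Set ℂ} {x d : ℂ} (h : IsRay K x d) :
    ∃ r : ℝ, 0 < r ∧ ∀ s : ℝ, 0 < s → s < r → x + s * d ∈ K :=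
  eventually_nhdsGT_zero_iff.1 h

theorem IsRay.mono {K K' : Set ℂ} {x d : ℂ} (h : IsRay K x d) (hK : K ⊆ K') : IsRay K' x d :=
  Eventually.mono h fun _ hs => hK hs

theorem IsRay.mem {K : Set ℂ} {x d : ℂ} (h : IsRay K x d) (hK : IsClosed K) : x ∈ K := by
  have : Tendsto (fun s : ℝ => x + s * d) (𝓝[>] 0) (𝓝 x) := by
    have h1 : Continuous fun s : ℝ => x + s * d := by fun_prop
    have := h1.tendsto 0
    simp only [Complex.ofReal_zero, zero_mul, add_zero] at this
    exact this.mono_left nhdsWithin_le_nhds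
  exact hK.mem_of_tendsto this h

/-- Near `x` the set `K` is a cone with finitely many rays. -/
def HasCone (K : Set ℂ) (x : ℂ) : Prop :=
  ∃ r : ℝ, 0 < r ∧ ∃ D : Finset ℂ, (∀ d ∈ D, ‖d‖ = 1) ∧
    ∀ s : ℝ, 0 < s → s < r → ∀ u : ℂ, ‖u‖ = 1 → (x + s * u ∈ K ↔ u ∈ D)

theorem HasCone.union {K K' : Set ℂ} {x : ℂ} (h : HasCone K x) (h' : HasCone K' x) :
    HasCone (K ∪ K') x := by
  classical
  obtain ⟨r, hr, D, hD, hK⟩ := h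
  obtain ⟨r', hr', D', hD', hK'⟩ := h'
  refine ⟨min r r', lt_min hr hr', D ∪ D', ?_, ?_⟩
  · intro d hd
    rcases Finset.mem_union.1 hd with h | h
    exacts [hD d h, hD' d h]
  · intro s hs hsr u hu
    rw [Set.mem_union, hK s hs (hsr.trans_le (min_le_left _ _)) u hu,
      hK' s hs (hsr.trans_le (min_le_right _ _)) u hu, Finset.mem_union]

theorem HasCone.of_notMem {K : Set ℂ} {x : ℂ} (hK : IsClosed K) (hx : x ∉ K) : HasCone K x := by
  obtain ⟨r, hr, hball⟩ := Metric.isOpen_iff.1 hK.isOpen_compl x hx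
  refine ⟨r, hr, ∅, by simp, fun s hs hsr u hu => ?_⟩
  have : x + s * u ∈ Kᶜ := hball (by simp [hu, abs_of_pos hs, hsr])
  simpa using this

theorem HasCone.biUnion {ι : Type*} {I : Finset ι} {f : ι → Set ℂ} {x : ℂ}
    (h : ∀ i ∈ I, HasCone (f i) x) : HasCone (⋃ i ∈ I, f i) x := by
  classical
  induction I using Finset.induction_on with
  | empty => simpa using HasCone.of_notMem isClosed_empty (Set.notMem_empty x)
  | insert i I hi ih =>
    rw [Finset.set_biUnion_insert]
    exact (h i (Finset.mem_insert_self _ _)).union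
      (ih fun j hj => h j (Finset.mem_insert_of_mem hj))

theorem hasCone_segment_left (x a : ℂ) : HasCone (segment ℝ x a) x := by
  by_cases hax : a = x
  · subst hax
    refine ⟨1, one_pos, ∅, by simp, fun s hs _ u hu => ?_⟩
    have hu0 : u ≠ 0 := norm_ne_zero_iff.1 (by rw [hu]; exact one_ne_zero)
    simp [hs.ne', hu0]
  · have hne : a - x ≠ 0 := sub_ne_zero.2 hax
    have hpos : 0 < ‖a - x‖ := norm_pos_iff.2 hne
    have hposC : (‖a - x‖ : ℂ) ≠ 0 := by exact_mod_cast hpos.ne'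
    refine ⟨‖a - x‖, hpos, {(a - x) / ‖a - x‖}, by simp [hpos.ne'], fun s hs hsr u hu => ?_⟩
    rw [mem_segment_complex, Finset.mem_singleton]
    constructor
    · rintro ⟨t, ht0, -, ht⟩
      have h1 : (s : ℂ) * u = t * (a - x) := by linear_combination ht
      have h2 : s = t * ‖a - x‖ := by
        have := congrArg norm h1
        simpa [hu, abs_of_pos hs, abs_of_nonneg ht0] using this
      have hsC : (s : ℂ) ≠ 0 := by exact_mod_cast hs.ne'
      have h3 : (s : ℂ) = t * ‖a - x‖ := by exact_mod_cast h2
      field_simp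
      apply mul_left_cancel₀ hsC
      linear_combination (‖a - x‖ : ℂ) * h1 - (a - x) * h3
    · rintro rfl
      refine ⟨s / ‖a - x‖, by positivity, by rw [div_le_one hpos]; exact hsr.le, ?_⟩
      push_cast
      ring

theorem segment_split {a b x : ℂ} (hx : x ∈ segment ℝ a b) :
    segment ℝ a b = segment ℝ x a ∪ segment ℝ x b := by
  apply Set.Subset.antisymm
  · intro y hy
    obtain ⟨t, ht0, ht1, rfl⟩ := mem_segment_complex.1 hx
    obtain ⟨s, hs0, hs1, rfl⟩ := mem_segment_complex.1 hy
    rcases le_total s t with hst | hst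
    · left
      rcases ht0.eq_or_lt with h | h
      · have : s = t := by linarith
        subst this
        exact left_mem_segment _ _ _
      · refine mem_segment_complex.2 ⟨1 - s / t, ?_, ?_, ?_⟩
        · rw [sub_nonneg, div_le_one h]
          exact hst
        · linarith [div_nonneg hs0 h.le]
        · have : (t : ℂ) ≠ 0 := by exact_mod_cast h.ne'
          push_cast
          field_simp
          ring
    · right
      rcases ht1.eq_or_lt with h | h
      · have : s = t := by linarith
        subst this
        exact left_mem_segment _ _ _
      · have h' : 0 < 1 - t := by linarith
        refine mem_segment_complex.2 ⟨(s - t) / (1 - t), ?_, ?_, ?_⟩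
        · exact div_nonneg (by linarith) h'.le
        · rw [div_le_one h']
          linarith
        · have : (1 - t : ℂ) ≠ 0 := by exact_mod_cast h'.ne'
          push_cast
          field_simp
          ring
  · exact Set.union_subset ((convex_segment a b).segment_subset hx (left_mem_segment _ _ _))
      ((convex_segment a b).segment_subset hx (right_mem_segment _ _ _))

theorem hasCone_segment (a b x : ℂ) : HasCone (segment ℝ a b) x := by
  by_cases hx : x ∈ segment ℝ a b
  · rw [segment_split hx]
    exact (hasCone_segment_left x a).union (hasCone_segment_left x b)
  · exact HasCone.of_notMem (isCompact_segment_complex a b).isClosed hx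

/-- This dichotomy is the use of cones: a direction is either a ray of `K` or misses `K` near `x`,
so that a ray of a finite union is a ray of one of its members. -/
theorem HasCone.isRay_or {K : Set ℂ} {x d : ℂ} (h : HasCone K x) (hd : ‖d‖ = 1) :
    IsRay K x d ∨ ∀ᶠ s : ℝ in 𝓝[>] 0, x + s * d ∉ K := by
  obtain ⟨r, hr, D, hD, hK⟩ := h
  by_cases hdD : d ∈ D
  · exact Or.inl (eventually_nhdsGT_zero_iff.2 ⟨r, hr, fun s h1 h2 => (hK s h1 h2 d hd).2 hdD⟩)
  · exact Or.inr (eventually_nhdsGT_zero_iff.2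
      ⟨r, hr, fun s h1 h2 h3 => hdD ((hK s h1 h2 d hd).1 h3)⟩)

theorem IsRay.or_of_union {K K' : Set ℂ} {x d : ℂ} (h : IsRay (K ∪ K') x d) (hd : ‖d‖ = 1)
    (hK : HasCone K x) : IsRay K x d ∨ IsRay K' x d := by
  rcases hK.isRay_or hd with h1 | h1
  · exact Or.inl h1
  · exact Or.inr ((h.and h1).mono fun s hs => hs.1.resolve_left hs.2)

theorem IsRay.exists_of_biUnion {ι : Type*} {I : Finset ι} {f : ι → Set ℂ} {x d : ℂ}
    (h : IsRay (⋃ i ∈ I, f i) x d) (hd : ‖d‖ = 1) (hf : ∀ i ∈ I, HasCone (f i) x) :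
    ∃ i ∈ I, IsRay (f i) x d := by
  classical
  induction I using Finset.induction_on with
  | empty =>
    obtain ⟨r, hr, h⟩ := h.exists_pos
    simpa using h (r / 2) (by positivity) (by linarith)
  | insert i I hi ih =>
    rw [Finset.set_biUnion_insert] at h
    rcases h.or_of_union hd (hf i (Finset.mem_insert_self _ _)) with h | h
    · exact ⟨i, Finset.mem_insert_self _ _, h⟩
    · obtain ⟨j, hj, hj'⟩ := ih h fun j hj => hf j (Finset.mem_insert_of_mem hj)
      exact ⟨j, Finset.mem_insert_of_mem hj, hj'⟩

/-! ### Closed edges and the carrier of a graph -/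

/-- The closed segment between the two endpoints of an unordered pair. -/
def closedEdge (e : Sym2 ℂ) : Set ℂ :=
  Sym2.lift ⟨fun a b : ℂ => segment ℝ a b, fun a b => segment_symm ℝ a b⟩ e

@[simp] theorem openEdge_mk (a b : ℂ) : openEdge s(a, b) = openSegment ℝ a b := rfl

@[simp] theorem closedEdge_mk (a b : ℂ) : closedEdge s(a, b) = segment ℝ a b := rfl

theorem openEdge_subset_closedEdge (e : Sym2 ℂ) : openEdge e ⊆ closedEdge e := by
  induction e with | _ a b => exact openSegment_subset_segment ℝ a b

theorem mem_closedEdge {e : Sym2 ℂ} {z : ℂ} : z ∈ closedEdge e ↔ z ∈ e ∨ z ∈ openEdge e := by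
  induction e with | _ a b =>
  rw [closedEdge_mk, ← insert_endpoints_openSegment]
  simp [or_assoc]

theorem isCompact_closedEdge (e : Sym2 ℂ) : IsCompact (closedEdge e) := by
  induction e with | _ a b => exact isCompact_segment_complex a b

namespace PSLG

variable (Γ : PSLG)

theorem mem_carrier {z : ℂ} : z ∈ Γ.carrier ↔ z ∈ Γ.verts ∨ ∃ e ∈ Γ.edges, z ∈ openEdge e := by
  simp [carrier]

theorem closedEdge_subset_carrier {e : Sym2 ℂ} (he : e ∈ Γ.edges) : closedEdge e ⊆ Γ.carrier := by
  intro z hz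
  rw [mem_carrier]
  rcases mem_closedEdge.1 hz with h | h
  · exact Or.inl (Γ.endpoint_mem e he z h)
  · exact Or.inr ⟨e, he, h⟩

theorem carrier_eq : Γ.carrier = (⋃ v ∈ Γ.verts, {v}) ∪ ⋃ e ∈ Γ.edges, closedEdge e := by
  ext z
  rw [mem_carrier]
  simp only [Set.mem_union, Set.mem_iUnion, Set.mem_singleton_iff, exists_prop, exists_eq_right']
  constructor
  · rintro (h | ⟨e, he, h⟩)
    · exact Or.inl h
    · exact Or.inr ⟨e, he, openEdge_subset_closedEdge e h⟩
  · rintro (h | ⟨e, he, h⟩)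
    · exact Or.inl h
    · exact Γ.mem_carrier.1 (Γ.closedEdge_subset_carrier he h)

theorem isCompact_carrier : IsCompact Γ.carrier := by
  rw [carrier_eq]
  exact (Γ.verts.isCompact_biUnion fun _ _ => isCompact_singleton).union
    (Γ.edges.isCompact_biUnion fun e _ => isCompact_closedEdge e)

theorem isClosed_carrier : IsClosed Γ.carrier := Γ.isCompact_carrier.isClosed

theorem hasCone_carrier (x : ℂ) : HasCone Γ.carrier x := by
  rw [carrier_eq]
  refine HasCone.union (HasCone.biUnion fun v _ => ?_) (HasCone.biUnion fun e _ => ?_)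
  · simpa using hasCone_segment v v x
  · induction e with | _ a b => exact hasCone_segment a b x

theorem eq_of_mem_openEdge {e f : Sym2 ℂ} (he : e ∈ Γ.edges) (hf : f ∈ Γ.edges) {z : ℂ}
    (h1 : z ∈ openEdge e) (h2 : z ∈ openEdge f) : e = f := by
  by_contra hne
  exact Set.disjoint_left.1 (Γ.disjoint_edges e he f hf hne) h1 h2

end PSLG

/-! ### Graphs from compact sets that are locally straight lines -/

/-- Near `x` the set `K` is a straight line in direction `u`. -/
def IsLineNear (K : Set ℂ) (x u : ℂ) : Prop :=
  ∃ r : ℝ, 0 < r ∧ ∀ z, dist z x < r → (z ∈ K ↔ ∃ t : ℝ, z = x + t * u)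

theorem isLineNear_union_openSegment {F : Set ℂ} {a b x : ℂ} (hF : IsClosed F) (hxF : x ∉ F)
    (hab : a ≠ b) (hx : x ∈ openSegment ℝ a b) :
    ∃ u : ℂ, ‖u‖ = 1 ∧ IsLineNear (F ∪ openSegment ℝ a b) x u := by
  obtain ⟨τ, h0, h1, rfl⟩ := mem_openSegment_complex.1 hx
  set x := a + τ * (b - a) with hxdef
  have hne : b - a ≠ 0 := sub_ne_zero.2 hab.symm
  have hpos : 0 < ‖b - a‖ := norm_pos_iff.2 hne
  have hposC : (‖b - a‖ : ℂ) ≠ 0 := by exact_mod_cast hpos.ne'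
  obtain ⟨r, hr, hball⟩ := Metric.isOpen_iff.1 hF.isOpen_compl x hxF
  refine ⟨(b - a) / ‖b - a‖, by simp [hpos.ne'],
    -- The radius keeps the ball off `F` and short of both endpoints.
    min r (min (τ * ‖b - a‖) ((1 - τ) * ‖b - a‖)), ?_, ?_⟩
  · have : 0 < 1 - τ := by linarith
    positivity
  · intro z hz
    have hzF : z ∉ F := hball (hz.trans_le (min_le_left _ _))
    have hz1 : dist z x < τ * ‖b - a‖ :=
      hz.trans_le ((min_le_right _ _).trans (min_le_left _ _))
    have hz2 : dist z x < (1 - τ) * ‖b - a‖ :=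
      hz.trans_le ((min_le_right _ _).trans (min_le_right _ _))
    simp only [Set.mem_union, hzF, false_or]
    rw [mem_openSegment_complex]
    constructor
    · rintro ⟨s, -, -, rfl⟩
      refine ⟨(s - τ) * ‖b - a‖, ?_⟩
      rw [hxdef]
      push_cast
      field_simp
      ring
    · rintro ⟨t, rfl⟩
      have hd : dist (x + t * ((b - a) / ‖b - a‖)) x = |t| := by
        rw [dist_eq_norm, add_sub_cancel_left, norm_mul, norm_div, Complex.norm_real,
          Complex.norm_real]
        simp [hpos.ne']
      rw [hd] at hz1 hz2
      refine ⟨τ + t / ‖b - a‖, ?_, ?_, ?_⟩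
      · have : -τ < t / ‖b - a‖ := by
          rw [lt_div_iff₀ hpos]
          linarith [neg_abs_le t]
        linarith
      · have : t / ‖b - a‖ < 1 - τ := by
          rw [div_lt_iff₀ hpos]
          linarith [le_abs_self t]
        linarith
      · rw [hxdef]
        push_cast
        field_simp
        ring

theorem IsLineNear.isRay {K : Set ℂ} {x u : ℂ} (h : IsLineNear K x u) (hu : ‖u‖ = 1) :
    IsRay K x u ∧ IsRay K x (-u) := by
  obtain ⟨r, hr, h⟩ := h
  constructor
  · refine eventually_nhdsGT_zero_iff.2 ⟨r, hr, fun s hs hsr => (h _ ?_).2 ⟨s, rfl⟩⟩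
    simpa [hu, abs_of_pos hs] using hsr
  · refine eventually_nhdsGT_zero_iff.2 ⟨r, hr, fun s hs hsr => (h _ ?_).2 ⟨-s, by simp⟩⟩
    simpa [hu, abs_of_pos hs] using hsr

theorem eq_or_eq_neg_of_norm_eq_one {u d : ℂ} (hu : ‖u‖ = 1) (hd : ‖d‖ = 1) {t : ℝ}
    (h : d = t * u) : d = u ∨ d = -u := by
  have := congrArg norm h
  simp only [norm_mul, hu, hd, Complex.norm_real, mul_one, Real.norm_eq_abs] at this
  rcases (abs_eq zero_le_one).1 this.symm with h' | h' <;> simp [h, h']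

theorem IsLineNear.eq_or_eq_neg {K : Set ℂ} {x u d : ℂ} (h : IsLineNear K x u) (hu : ‖u‖ = 1)
    (hd : ‖d‖ = 1) (hray : IsRay K x d) : d = u ∨ d = -u := by
  obtain ⟨r, hr, h⟩ := h
  obtain ⟨r', hr', h'⟩ := hray.exists_pos
  set s := min r r' / 2 with hs
  have hs0 : 0 < s := by positivity
  have h1 : s < r := by have := min_le_left r r'; have := lt_min hr hr'; linarith
  have h2 : s < r' := by have := min_le_right r r'; have := lt_min hr hr'; linarith
  obtain ⟨t, ht⟩ := (h _ (by simpa [hd, abs_of_pos hs0] using h1)).1 (h' s hs0 h2)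
  have hsC : (s : ℂ) ≠ 0 := by exact_mod_cast hs0.ne'
  refine eq_or_eq_neg_of_norm_eq_one hu hd (t := t / s) ?_
  push_cast
  field_simp
  linear_combination ht

theorem PSLG.exists_isLineNear (Γ : PSLG) {x : ℂ} (hx : x ∈ Γ.carrier) (hxV : x ∉ Γ.verts)
    {F : Set ℂ} (hF : IsClosed F) (hxF : x ∉ F) :
    ∃ u : ℂ, ‖u‖ = 1 ∧ IsLineNear (F ∪ Γ.carrier) x u := by
  classical
  obtain ⟨e, he, hxe⟩ := (Γ.mem_carrier.1 hx).resolve_left hxV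
  have hF' : IsClosed (F ∪ (Γ.verts ∪ ⋃ f ∈ Γ.edges.erase e, closedEdge f)) :=
    hF.union (Γ.verts.finite_toSet.isClosed.union
      ((Γ.edges.erase e).isCompact_biUnion fun e _ => isCompact_closedEdge e).isClosed)
  have heq : F ∪ Γ.carrier = (F ∪ (Γ.verts ∪ ⋃ f ∈ Γ.edges.erase e, closedEdge f)) ∪ openEdge e := by
    ext z
    simp only [Set.mem_union, Γ.mem_carrier, Finset.mem_coe, Set.mem_iUnion, Finset.mem_erase,
      exists_prop]
    constructor
    · rintro (h | h | ⟨f, hf, h⟩)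
      · exact Or.inl (Or.inl h)
      · exact Or.inl (Or.inr (Or.inl h))
      · by_cases hfe : f = e
        · exact Or.inr (hfe ▸ h)
        · exact Or.inl (Or.inr (Or.inr ⟨f, ⟨hfe, hf⟩, openEdge_subset_closedEdge f h⟩))
    · rintro ((h | h | ⟨f, hf, h⟩) | h)
      · exact Or.inl h
      · exact Or.inr (Or.inl h)
      · exact Or.inr (Γ.mem_carrier.1 (Γ.closedEdge_subset_carrier hf.2 h))
      · exact Or.inr (Or.inr ⟨e, he, h⟩)
  have hxF' : x ∉ F ∪ (Γ.verts ∪ ⋃ f ∈ Γ.edges.erase e, closedEdge f) := by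
    simp only [Set.mem_union, Finset.mem_coe, Set.mem_iUnion, Finset.mem_erase,
      exists_prop, not_or]
    refine ⟨hxF, hxV, ?_⟩
    rintro ⟨f, hf, h⟩
    rcases mem_closedEdge.1 h with h | h
    · exact hxV (Γ.endpoint_mem f hf.2 x h)
    · exact hf.1 (Γ.eq_of_mem_openEdge hf.2 he h hxe)
  have hnd := Γ.not_isDiag e he
  rw [heq]
  induction e with | _ a b =>
  exact isLineNear_union_openSegment hF' hxF' (by simpa using hnd) hxe

/-- Writing all segments of `K` through `x` in terms of the same direction `u` makes two of them
comparable end by end. -/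
theorem IsLineNear.sym2_eq {K : Set ℂ} {x u a b : ℂ} (h : IsLineNear K x u)
    (hab : openSegment ℝ a b ⊆ K) (hne : a ≠ b) (hx : x ∈ openSegment ℝ a b) :
    ∃ p q : ℝ, 0 < p ∧ 0 < q ∧ s(a, b) = s(x - p * u, x + q * u) := by
  obtain ⟨r, hr, h⟩ := h
  obtain ⟨τ, h0, h1, hxd⟩ := mem_openSegment_complex.1 hx
  have hba : 0 < ‖b - a‖ := norm_pos_iff.2 (sub_ne_zero.2 hne.symm)
  have h1' : 0 < 1 - τ := by linarith
  set ε := min (r / ‖b - a‖) (1 - τ) / 2 with hε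
  have hm : 0 < min (r / ‖b - a‖) (1 - τ) := lt_min (by positivity) h1'
  have hε0 : 0 < ε := by positivity
  have hε1 : ε < r / ‖b - a‖ := by linarith [min_le_left (r / ‖b - a‖) (1 - τ)]
  have hε2 : ε < 1 - τ := by linarith [min_le_right (r / ‖b - a‖) (1 - τ)]
  have hmem : x + ε * (b - a) ∈ K := hab (mem_openSegment_complex.2
    ⟨τ + ε, by linarith, by linarith, by rw [hxd]; push_cast; ring⟩)
  obtain ⟨t, ht⟩ := (h _ (by
    rw [dist_eq_norm, add_sub_cancel_left, norm_mul, Complex.norm_real, Real.norm_eq_abs,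
      abs_of_pos hε0]
    exact (lt_div_iff₀ hba).1 hε1)).1 hmem
  have hεC : (ε : ℂ) ≠ 0 := by exact_mod_cast hε0.ne'
  have hk : b - a = (t / ε : ℝ) * u := by
    push_cast
    field_simp
    linear_combination ht
  set k := t / ε
  have ha : a = x - (τ * k : ℝ) * u := by
    push_cast
    linear_combination -hxd - τ * hk
  have hb : b = x + ((1 - τ) * k : ℝ) * u := by
    push_cast
    linear_combination -hxd + (1 - τ) * hk
  rcases lt_trichotomy k 0 with hk0 | hk0 | hk0
  · refine ⟨(1 - τ) * -k, τ * -k, mul_pos h1' (by linarith), mul_pos h0 (by linarith), ?_⟩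
    rw [Sym2.eq_swap]
    congr 2
    · rw [hb]; push_cast; ring
    · rw [ha]; push_cast; ring
  · rw [hk0] at hk
    exact absurd (by simpa using hk) (sub_ne_zero.2 hne.symm)
  · exact ⟨τ * k, (1 - τ) * k, by positivity, by positivity, by rw [← ha, ← hb]⟩

theorem openSegment_line {x u : ℂ} {p q t : ℝ} (hp : -p < t) (hq : t < q) :
    x + t * u ∈ openSegment ℝ (x - p * u) (x + q * u) := by
  have hpq : 0 < p + q := by linarith
  have : (p + q : ℂ) ≠ 0 := by exact_mod_cast hpq.ne'
  refine mem_openSegment_complex.2 ⟨(t + p) / (p + q), div_pos (by linarith) hpq, ?_, ?_⟩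
  · rw [div_lt_one hpq]; linarith
  · push_cast
    field_simp
    ring

theorem Finset.isOpen_compl_coe (W : Finset ℂ) : IsOpen ((W : Set ℂ)ᶜ) :=
  W.finite_toSet.isClosed.isOpen_compl

/-- Travel from `x` in direction `u`: off `W` the set continues straight, so the run can end only at
a point of `W`, and it does end because `K` is bounded. -/
theorem exists_maximal_run {K : Set ℂ} {W : Finset ℂ} (hK : IsCompact K)
    (hline : ∀ x ∈ K, x ∉ W → ∃ u : ℂ, ‖u‖ = 1 ∧ IsLineNear K x u) {x u : ℂ} (hx : x ∈ K)
    (hxW : x ∉ W) (hu : ‖u‖ = 1) (hxu : IsLineNear K x u) :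
    ∃ q : ℝ, 0 < q ∧ x + q * u ∈ W ∧
      ∀ t : ℝ, 0 ≤ t → t < q → x + t * u ∈ K ∧ x + t * u ∉ W := by
  let B : Set ℝ := {t | 0 ≤ t ∧ ∀ s : ℝ, 0 ≤ s → s ≤ t → x + s * u ∈ K ∧ x + s * u ∉ W}
  have h0 : (0 : ℝ) ∈ B := by
    refine ⟨le_rfl, fun s h1 h2 => ?_⟩
    have : s = 0 := le_antisymm h2 h1
    simp [this, hx, hxW]
  have hbdd : BddAbove B := by
    obtain ⟨R, hR, hKR⟩ := hK.exists_norm_lt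
    refine ⟨R + ‖x‖, fun t ht => ?_⟩
    have h1 := hKR _ (ht.2 t ht.1 le_rfl).1
    have h2 : ‖(t : ℂ) * u‖ = t := by simp [hu, abs_of_nonneg ht.1]
    have h3 : ‖(t : ℂ) * u‖ ≤ ‖x + t * u‖ + ‖x‖ := by
      have := norm_sub_le (x + t * u) x
      rwa [add_sub_cancel_left] at this
    linarith
  set q := sSup B with hq
  have hq0 : 0 ≤ q := le_csSup hbdd h0
  have hlt : ∀ t : ℝ, 0 ≤ t → t < q → x + t * u ∈ K ∧ x + t * u ∉ W := by
    intro t ht htq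
    obtain ⟨s, hs, hts⟩ := exists_lt_of_lt_csSup ⟨0, h0⟩ htq
    exact hs.2 t ht hts.le
  have hyK : x + q * u ∈ K := by
    rcases hq0.eq_or_lt with h | h
    · simp [← h, hx]
    · have hc : Continuous fun t : ℝ => x + t * u := by fun_prop
      have hmem : q ∈ closure (Set.Ico 0 q) := by
        rw [closure_Ico h.ne]
        exact ⟨h.le, le_rfl⟩
      exact closure_minimal (s := Set.Ico 0 q) (fun t ht => (hlt t ht.1 ht.2).1)
        (hK.isClosed.preimage hc) hmem
  -- If the end of the run is not in `W`, then `K` is a line there, and the incoming ray forces its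
  -- direction to be `±u`.
  have hext : x + q * u ∉ W → ∃ r : ℝ, 0 < r ∧ ∀ s : ℝ, |s| < r → x + (q + s : ℝ) * u ∈ K := by
    intro hyW
    rcases hq0.eq_or_lt with h | h
    · obtain ⟨r, hr, hxu⟩ := hxu
      refine ⟨r, hr, fun s hs => (hxu _ ?_).2 ⟨s, by simp [← h]⟩⟩
      simpa [← h, hu] using hs
    · obtain ⟨u', hu', hy⟩ := hline _ hyK hyW
      have hray : IsRay K (x + q * u) (-u) := by
        refine eventually_nhdsGT_zero_iff.2 ⟨q, h, fun s hs hsq => ?_⟩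
        have := (hlt (q - s) (by linarith) (by linarith)).1
        convert this using 1
        push_cast
        ring
      have huu := hy.eq_or_eq_neg hu' (by rwa [norm_neg]) hray
      obtain ⟨r, hr, hy⟩ := hy
      refine ⟨r, hr, fun s hs => (hy _ ?_).2 ?_⟩
      · rw [dist_eq_norm]
        have : x + (q + s : ℝ) * u - (x + q * u) = s * u := by push_cast; ring
        rw [this]
        simpa [hu] using hs
      · rcases huu with h' | h'
        · exact ⟨-s, by rw [← h']; push_cast; ring⟩
        · exact ⟨s, by rw [neg_inj.1 h']; push_cast; ring⟩
  have hqW : x + q * u ∈ W := by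
    by_contra hyW
    obtain ⟨r, hr, hext⟩ := hext hyW
    have hc : Continuous fun t : ℝ => x + (q + t : ℝ) * u := by fun_prop
    obtain ⟨r', hr', hball⟩ := Metric.isOpen_iff.1 (W.isOpen_compl_coe.preimage hc) 0
      (by simpa using hyW)
    set ε := min r r' / 2 with hε
    have hm := lt_min hr hr'
    have hε0 : 0 < ε := by positivity
    have hε1 : ε < r := by linarith [min_le_left r r']
    have hε2 : ε < r' := by linarith [min_le_right r r']
    have : q + ε ∈ B := by
      refine ⟨by linarith, fun s hs hsq => ?_⟩
      rcases lt_or_ge s q with h | h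
      · exact hlt s hs h
      · have habs : |s - q| ≤ ε := by rw [abs_of_nonneg (by linarith)]; linarith
        have e1 := hext (s - q) (by linarith)
        have e2 : s - q ∈ Metric.ball (0 : ℝ) r' := by
          rw [Metric.mem_ball, Real.dist_eq, sub_zero]; linarith
        have e3 := hball e2
        simp only [add_sub_cancel] at e1
        refine ⟨e1, ?_⟩
        simpa using e3
    linarith [le_csSup hbdd this]
  refine ⟨q, hq0.lt_of_ne ?_, hqW, hlt⟩
  rintro h
  rw [← h] at hqW
  exact hxW (by simpa using hqW)

/-- The edges are all segments between points of `W` whose interiors lie in `K` and avoid `W`.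
Through a point off `W` there is exactly one, found by running both ways to the first points of `W`.
-/
theorem exists_pslg_of_isLineNear {K : Set ℂ} {W : Finset ℂ} (hK : IsCompact K)
    (hWK : (W : Set ℂ) ⊆ K)
    (hline : ∀ x ∈ K, x ∉ W → ∃ u : ℂ, ‖u‖ = 1 ∧ IsLineNear K x u) :
    ∃ Γ : PSLG, Γ.verts = W ∧ Γ.carrier = K := by
  classical
  let E : Finset (Sym2 ℂ) := W.sym2.filter
    (fun e => ¬ e.IsDiag ∧ openEdge e ⊆ K ∧ ∀ v ∈ W, v ∉ openEdge e)
  have hE : ∀ e, e ∈ E ↔ (∀ v ∈ e, v ∈ W) ∧ ¬ e.IsDiag ∧ openEdge e ⊆ K ∧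
      ∀ v ∈ W, v ∉ openEdge e := by
    intro e
    simp only [E, Finset.mem_filter, Finset.mem_sym2_iff]
  have key : ∀ x u, ∀ e ∈ E, x ∈ openEdge e → IsLineNear K x u → ∃ p q : ℝ, 0 < p ∧ 0 < q ∧
      e = s(x - p * u, x + q * u) := by
    intro x u e he hx hu
    obtain ⟨-, hd, hsub, -⟩ := (hE e).1 he
    induction e with | _ a b =>
    exact hu.sym2_eq hsub (by simpa using hd) hx
  refine ⟨⟨W, E, fun e he => ((hE e).1 he).1, fun e he => ((hE e).1 he).2.1,
    fun e he => ((hE e).1 he).2.2.2, ?_⟩, rfl, ?_⟩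
  · intro e he f hf hef
    rw [Set.disjoint_left]
    intro x hxe hxf
    have hxK := ((hE e).1 he).2.2.1 hxe
    have hxW : x ∉ W := fun h => ((hE e).1 he).2.2.2 x h hxe
    obtain ⟨u, hu, hxu⟩ := hline x hxK hxW
    obtain ⟨p, q, hp, hq, rfl⟩ := key x u e he hxe hxu
    obtain ⟨p', q', hp', hq', rfl⟩ := key x u f hf hxf hxu
    have heW := ((hE _).1 he).1
    have hfW := ((hE _).1 hf).1
    have hen := ((hE _).1 he).2.2.2
    have hfn := ((hE _).1 hf).2.2.2
    -- Of two different ends on the same side of `x`, the nearer would be a vertex inside the other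
    -- edge.
    have hpp : p = p' := by
      rcases lt_trichotomy p p' with h | h | h
      · refine absurd ?_ (hfn _ (heW (x - p * u) (Sym2.mem_mk_left _ _)))
        have := openSegment_line (x := x) (u := u) (p := p') (q := q') (t := -p)
          (by linarith) (by linarith)
        simpa [sub_eq_add_neg] using this
      · exact h
      · refine absurd ?_ (hen _ (hfW (x - p' * u) (Sym2.mem_mk_left _ _)))
        have := openSegment_line (x := x) (u := u) (p := p) (q := q) (t := -p')
          (by linarith) (by linarith)
        simpa [sub_eq_add_neg] using this
    have hqq : q = q' := by
      rcases lt_trichotomy q q' with h | h | h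
      · exact absurd (openSegment_line (by linarith) h)
          (hfn _ (heW (x + q * u) (Sym2.mem_mk_right _ _)))
      · exact h
      · exact absurd (openSegment_line (by linarith) h)
          (hen _ (hfW (x + q' * u) (Sym2.mem_mk_right _ _)))
    exact hef (by rw [hpp, hqq])
  · ext x
    rw [PSLG.mem_carrier]
    constructor
    · rintro (h | ⟨e, he, h⟩)
      · exact hWK h
      · exact ((hE e).1 he).2.2.1 h
    · intro hxK
      by_cases hxW : x ∈ W
      · exact Or.inl hxW
      · right
        obtain ⟨u, hu, hxu⟩ := hline x hxK hxW
        obtain ⟨q, hq, hqW, hqK⟩ := exists_maximal_run hK hline hxK hxW hu hxu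
        have hxu' : IsLineNear K x (-u) := by
          obtain ⟨r, hr, h⟩ := hxu
          refine ⟨r, hr, fun z hz => (h z hz).trans ⟨?_, ?_⟩⟩
          · rintro ⟨t, rfl⟩
            exact ⟨-t, by simp⟩
          · rintro ⟨t, rfl⟩
            exact ⟨-t, by simp⟩
        obtain ⟨p, hp, hpW, hpK⟩ := exists_maximal_run hK hline hxK hxW
          (by rwa [norm_neg]) hxu'
        have hrun : ∀ z ∈ openSegment ℝ (x - p * u) (x + q * u), z ∈ K ∧ z ∉ W := by
          intro z hz
          obtain ⟨t, h0, h1, rfl⟩ := mem_openSegment_complex.1 hz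
          set s := t * (p + q) - p with hs
          have hz' : x - p * u + t * (x + q * u - (x - p * u)) = x + s * u := by
            rw [hs]; push_cast; ring
          rw [hz']
          rcases le_or_gt 0 s with h | h
          · exact hqK s h (by rw [hs]; nlinarith)
          · have := hpK (-s) (by linarith) (by rw [hs]; nlinarith)
            simpa using this
        have hu0 : u ≠ 0 := norm_ne_zero_iff.1 (by rw [hu]; exact one_ne_zero)
        refine ⟨s(x - p * u, x + q * u), (hE _).2 ⟨?_, ?_, fun z hz => (hrun z hz).1,
          fun v hv hv' => (hrun v hv').2 hv⟩, ?_⟩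
        · intro v hv
          rcases Sym2.mem_iff.1 hv with rfl | rfl
          · simpa [sub_eq_add_neg] using hpW
          · exact hqW
        · rw [Sym2.mk_isDiag_iff]
          intro h
          have : ((p + q : ℝ) : ℂ) * u = 0 := by push_cast; linear_combination -h
          rcases mul_eq_zero.1 this with h' | h'
          · have : p + q = 0 := by exact_mod_cast h'
            linarith
          · exact hu0 h'
        · have := openSegment_line (x := x) (u := u) (p := p) (q := q) (t := 0)
            (by linarith) hq
          simpa using this

/-- Segments which meet each other and a planar straight line graph only in a finite set `W` can be
added to the graph. -/
theorem PSLG.exists_add (Γ : PSLG) {ι : Type*} (I : Finset ι) (a b : ι → ℂ) (W : Finset ℂ)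
    (hV : Γ.verts ⊆ W) (hab : ∀ i ∈ I, a i ∈ W ∧ b i ∈ W)
    (hW : (W : Set ℂ) ⊆ Γ.carrier ∪ ⋃ i ∈ I, segment ℝ (a i) (b i))
    (h1 : ∀ i ∈ I, Γ.carrier ∩ segment ℝ (a i) (b i) ⊆ W)
    (h2 : ∀ i ∈ I, ∀ j ∈ I, i ≠ j → segment ℝ (a i) (b i) ∩ segment ℝ (a j) (b j) ⊆ W) :
    ∃ Γ' : PSLG, Γ'.verts = W ∧ Γ'.carrier = Γ.carrier ∪ ⋃ i ∈ I, segment ℝ (a i) (b i) := by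
  classical
  have hcl : ∀ J : Finset ι, IsClosed (⋃ i ∈ J, segment ℝ (a i) (b i)) := fun J =>
    (J.isCompact_biUnion fun i _ => isCompact_segment_complex (a i) (b i)).isClosed
  refine exists_pslg_of_isLineNear (Γ.isCompact_carrier.union
    (I.isCompact_biUnion fun i _ => isCompact_segment_complex (a i) (b i))) hW ?_
  intro x hx hxW
  by_cases hxΓ : x ∈ Γ.carrier
  · have hxI : x ∉ ⋃ i ∈ I, segment ℝ (a i) (b i) := by
      simp only [Set.mem_iUnion, not_exists]
      exact fun i hi h => hxW (h1 i hi ⟨hxΓ, h⟩)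
    rw [Set.union_comm]
    exact Γ.exists_isLineNear hxΓ (fun h => hxW (hV h)) (hcl I) hxI
  · obtain ⟨i, hi, hxi⟩ : ∃ i ∈ I, x ∈ segment ℝ (a i) (b i) := by
      simpa using hx.resolve_left hxΓ
    have hF : IsClosed (Γ.carrier ∪ ({a i, b i} ∪ ⋃ j ∈ I.erase i, segment ℝ (a j) (b j))) :=
      Γ.isClosed_carrier.union ((Set.toFinite _).isClosed.union (hcl _))
    have hai : x ≠ a i := fun h => hxW (h ▸ (hab i hi).1)
    have hbi : x ≠ b i := fun h => hxW (h ▸ (hab i hi).2)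
    have hxF : x ∉ Γ.carrier ∪ ({a i, b i} ∪ ⋃ j ∈ I.erase i, segment ℝ (a j) (b j)) := by
      simp only [Set.mem_union, Set.mem_iUnion, Set.mem_insert_iff, Set.mem_singleton_iff, not_or,
        not_exists, hai, hbi, hxΓ, not_false_eq_true, true_and, Finset.mem_erase]
      exact fun j hj h => hxW (h2 i hi j hj.2 (Ne.symm hj.1) ⟨hxi, h⟩)
    have hxo : x ∈ openSegment ℝ (a i) (b i) := by
      rw [← insert_endpoints_openSegment] at hxi
      exact (hxi.resolve_left hai).resolve_left hbi
    have hne : a i ≠ b i := by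
      intro h
      rw [h, segment_same] at hxi
      exact hbi hxi
    have heq : Γ.carrier ∪ ⋃ i ∈ I, segment ℝ (a i) (b i) =
        (Γ.carrier ∪ ({a i, b i} ∪ ⋃ j ∈ I.erase i, segment ℝ (a j) (b j))) ∪
          openSegment ℝ (a i) (b i) := by
      conv_lhs => rw [← Finset.insert_erase hi, Finset.set_biUnion_insert,
        ← insert_endpoints_openSegment]
      ext z
      simp only [Set.mem_union, Set.mem_insert_iff, Set.mem_singleton_iff]
      tauto
    rw [heq]
    exact isLineNear_union_openSegment hF hxF hne hxo

/-- One germ of a line contained in another equals it. -/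
theorem IsLineNear.eventually_mem_iff {K K' : Set ℂ} {x u u' : ℂ} (hu : ‖u‖ = 1) (hu' : ‖u'‖ = 1)
    (h : IsLineNear K x u) (h' : IsLineNear K' x u') (hK : K ⊆ K') :
    ∀ᶠ z in 𝓝 x, z ∈ K ↔ z ∈ K' := by
  have huu := h'.eq_or_eq_neg hu' hu ((h.isRay hu).1.mono hK)
  obtain ⟨r, hr, h⟩ := h
  obtain ⟨r', hr', h'⟩ := h'
  filter_upwards [Metric.ball_mem_nhds x hr, Metric.ball_mem_nhds x hr'] with z hz hz'
  rw [h z hz, h' z hz']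
  rcases huu with rfl | rfl
  · rfl
  · constructor
    · rintro ⟨t, rfl⟩
      exact ⟨-t, by simp⟩
    · rintro ⟨t, rfl⟩
      exact ⟨-t, by simp⟩

/-! ### Restriction of a refinement to the hull -/

/-- The hull points on an open edge form a relatively closed set; it is also relatively open. This
is clear off `Γ`, and where the edge meets `Γ`, necessarily away from vertices, both carriers are
the same line, so the edge runs inside `Γ`. -/
theorem PSLG.openEdge_subset_polyHull (Γ Γ₁ : PSLG) (hV : Γ.verts ⊆ Γ₁.verts)
    (hK : Γ.carrier ⊆ Γ₁.carrier) {e : Sym2 ℂ} (he : e ∈ Γ₁.edges) {x : ℂ} (hx : x ∈ openEdge e)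
    (hxP : x ∈ polyHull Γ.carrier) : openEdge e ⊆ polyHull Γ.carrier := by
  have hconn : IsPreconnected (openEdge e) := by
    induction e with | _ a b => exact (convex_openSegment a b).isPreconnected
  have hloc : ∀ y ∈ openEdge e, y ∈ polyHull Γ.carrier →
      y ∈ interior (polyHull Γ.carrier ∪ (openEdge e)ᶜ) := by
    intro y hy hyP
    rw [mem_interior_iff_mem_nhds]
    by_cases hyΓ : y ∈ Γ.carrier
    · have hyV₁ : y ∉ Γ₁.verts := fun h => Γ₁.vertex_notMem e he y h hy
      obtain ⟨u, hu, h⟩ := Γ.exists_isLineNear hyΓ (fun h => hyV₁ (hV h)) isClosed_empty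
        (Set.notMem_empty y)
      obtain ⟨u', hu', h'⟩ := Γ₁.exists_isLineNear (hK hyΓ) hyV₁ isClosed_empty
        (Set.notMem_empty y)
      rw [Set.empty_union] at h h'
      filter_upwards [h.eventually_mem_iff hu hu' h' hK] with z hz
      by_cases hze : z ∈ openEdge e
      · exact Or.inl (subset_polyHull _ (hz.2 (Γ₁.mem_carrier.2 (Or.inr ⟨e, he, hze⟩))))
      · exact Or.inr hze
    · filter_upwards [(isOpen_polyHull_diff Γ.isClosed_carrier).mem_nhds ⟨hyP, hyΓ⟩] with z hz
      exact Or.inl hz.1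
  rcases isPreconnected_iff_subset_of_disjoint.1 hconn
    (interior (polyHull Γ.carrier ∪ (openEdge e)ᶜ)) (polyHull Γ.carrier)ᶜ isOpen_interior
    (isClosed_polyHull Γ.isClosed_carrier).isOpen_compl
    (fun z hz => by
      by_cases hzP : z ∈ polyHull Γ.carrier
      exacts [Or.inl (hloc z hz hzP), Or.inr hzP])
    (by
      rw [Set.eq_empty_iff_forall_notMem]
      rintro z ⟨hze, hz1, hz2⟩
      rcases interior_subset hz1 with h | h
      exacts [hz2 h, h hze]) with h | h
  · intro z hz
    exact (interior_subset (h hz)).resolve_right fun h => h hz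
  · exact absurd hxP (h hx)

/-- By the previous lemma intersecting with the hull cuts no edge, so no new vertices are needed. -/
theorem PSLG.exists_restrict_polyHull (Γ Γ₁ : PSLG) (hV : Γ.verts ⊆ Γ₁.verts)
    (hK : Γ.carrier ⊆ Γ₁.carrier) :
    ∃ Γ' : PSLG, Γ.verts ⊆ Γ'.verts ∧ Γ'.verts ⊆ Γ₁.verts ∧
      Γ'.carrier = Γ₁.carrier ∩ polyHull Γ.carrier := by
  classical
  have hclosure : ∀ e : Sym2 ℂ, openEdge e ⊆ polyHull Γ.carrier →
      closedEdge e ⊆ polyHull Γ.carrier := by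
    intro e he
    induction e with | _ a b =>
    rw [closedEdge_mk, ← closure_openSegment]
    exact closure_minimal he (isClosed_polyHull Γ.isClosed_carrier)
  refine ⟨⟨Γ₁.verts.filter (· ∈ polyHull Γ.carrier),
    Γ₁.edges.filter (openEdge · ⊆ polyHull Γ.carrier), ?_, ?_, ?_, ?_⟩, ?_, ?_, ?_⟩
  · intro e he v hv
    obtain ⟨he, hP⟩ := Finset.mem_filter.1 he
    exact Finset.mem_filter.2 ⟨Γ₁.endpoint_mem e he v hv,
      hclosure e hP (mem_closedEdge.2 (Or.inl hv))⟩
  · exact fun e he => Γ₁.not_isDiag e (Finset.mem_filter.1 he).1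
  · exact fun e he v hv => Γ₁.vertex_notMem e (Finset.mem_filter.1 he).1 v
      (Finset.mem_filter.1 hv).1
  · exact fun e he f hf => Γ₁.disjoint_edges e (Finset.mem_filter.1 he).1 f
      (Finset.mem_filter.1 hf).1
  · exact fun v hv => Finset.mem_filter.2
      ⟨hV hv, subset_polyHull _ (Γ.mem_carrier.2 (Or.inl hv))⟩
  · exact Finset.filter_subset _ _
  · ext z
    rw [PSLG.mem_carrier, Set.mem_inter_iff, PSLG.mem_carrier]
    simp only [Finset.mem_filter]
    constructor
    · rintro (h | ⟨e, ⟨he, hP⟩, hz⟩)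
      · exact ⟨Or.inl h.1, h.2⟩
      · exact ⟨Or.inr ⟨e, he, hz⟩, hP hz⟩
    · rintro ⟨h | ⟨e, he, hz⟩, hP⟩
      · exact Or.inl ⟨h, hP⟩
      · exact Or.inr ⟨e, ⟨he, Γ.openEdge_subset_polyHull Γ₁ hV hK he hz hP⟩, hz⟩

/-! ### A linear bound for the number of edges -/

theorem exists_affine_eq {p s p' s' x₁ x₂ : ℝ} (hx : x₁ < x₂) (h₁ : p + s * x₁ < p' + s' * x₁)
    (h₂ : p' + s' * x₂ < p + s * x₂) : ∃ x, x₁ < x ∧ x < x₂ ∧ p + s * x = p' + s' * x := by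
  have hs : 0 < s - s' := by
    by_contra! h
    nlinarith
  refine ⟨(p' - p) / (s - s'), ?_, ?_, ?_⟩
  · rw [lt_div_iff₀ hs]; linarith
  · rw [div_lt_iff₀ hs]; linarith
  · field_simp
    ring

/-- A finite system of noncrossing segments `y = p e + s e * x` between vertices with distinct
abscissas has at most three times as many segments as vertices. -/
theorem card_le_three_mul_of_noncrossing {α β : Type*} [DecidableEq α] [DecidableEq β]
    (V : Finset α) (E : Finset β)
    (X Y : α → ℝ) (l r : β → α) (p s : β → ℝ)
    (hl : ∀ e ∈ E, l e ∈ V) (hr : ∀ e ∈ E, r e ∈ V) (hlr : ∀ e ∈ E, X (l e) < X (r e))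
    (hYl : ∀ e ∈ E, p e + s e * X (l e) = Y (l e)) (hYr : ∀ e ∈ E, p e + s e * X (r e) = Y (r e))
    (hX : ∀ v ∈ V, ∀ w ∈ V, X v = X w → v = w)
    (hmeet : ∀ e ∈ E, ∀ f ∈ E, ∀ x, X (l e) < x → x < X (r e) → X (l f) < x → x < X (r f) →
      p e + s e * x = p f + s f * x → e = f)
    (hvert : ∀ e ∈ E, ∀ v ∈ V, X (l e) < X v → X v < X (r e) → Y v ≠ p e + s e * X v) :
    E.card ≤ 3 * V.card := by
  classical
  -- Two edges leaving the same vertex to the right with the same slope overlap.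
  have hleft : ∀ e ∈ E, ∀ f ∈ E, l e = l f → s e = s f → e = f := by
    intro e he f hf h1 h2
    have h3 := hYl e he
    have h4 := hYl f hf
    rw [h1, h2] at h3
    have hm := lt_min (hlr e he) (h1 ▸ hlr f hf : X (l e) < X (r f))
    have m1 := min_le_left (X (r e)) (X (r f))
    have m2 := min_le_right (X (r e)) (X (r f))
    refine hmeet e he f hf ((X (l e) + min (X (r e)) (X (r f))) / 2) (by linarith) (by linarith)
      (by rw [← h1]; linarith) (by linarith) ?_
    rw [h2]; linarith
  have hright : ∀ e ∈ E, ∀ f ∈ E, r e = r f → s e = s f → e = f := by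
    intro e he f hf h1 h2
    have h3 := hYr e he
    have h4 := hYr f hf
    rw [h1, h2] at h3
    have hm := max_lt (hlr e he) (h1 ▸ hlr f hf : X (l f) < X (r e))
    have m1 := le_max_left (X (l e)) (X (l f))
    have m2 := le_max_right (X (l e)) (X (l f))
    refine hmeet e he f hf ((X (r e) + max (X (l e)) (X (l f))) / 2) (by linarith) (by linarith)
      (by linarith) (by rw [← h1]; linarith) ?_
    rw [h2]; linarith
  -- An edge that is neither lowest at its left end nor steepest at its right end has a vertex from
  -- which it is the first edge seen upwards.
  have hbelow : ∀ e ∈ E, (∃ f ∈ E, l f = l e ∧ s f < s e) → (∃ g ∈ E, r g = r e ∧ s e < s g) →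
      ∃ w ∈ V, X (l e) < X w ∧ X w < X (r e) ∧ Y w < p e + s e * X w ∧
        ∀ g ∈ E, X (l g) ≤ X w → X w ≤ X (r g) → Y w < p g + s g * X w →
          p e + s e * X w ≤ p g + s g * X w := by
    intro e he hf hg
    -- `f` is the edge next below `e` among those leaving the same left end; `R` below collects the
    -- vertices in the wedge between `e` and `f`, and `w` is the leftmost of them.
    obtain ⟨f, hf, hfmax⟩ := (E.filter fun f => l f = l e ∧ s f < s e).exists_max_image s (by
      obtain ⟨f, hf, h⟩ := hf
      exact ⟨f, Finset.mem_filter.2 ⟨hf, h⟩⟩)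
    obtain ⟨hfE, hfl, hfs⟩ := Finset.mem_filter.1 hf
    have hefx : ∀ x, p e + s e * x - (p f + s f * x) = (s e - s f) * (x - X (l e)) := by
      intro x
      have h1 := hYl e he
      have h2 := hYl f hfE
      rw [hfl] at h2
      linear_combination h1 - h2
    let R := V.filter fun w => X (l e) < X w ∧ X w ≤ X (r e) ∧ X w ≤ X (r f) ∧
      p f + s f * X w ≤ Y w ∧ Y w ≤ p e + s e * X w
    have hlef := hlr e he
    have hlff := hlr f hfE
    rw [hfl] at hlff
    obtain ⟨w, hw, hwmin⟩ := R.exists_min_image X (by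
      rcases le_total (X (r e)) (X (r f)) with h | h
      · refine ⟨r e, Finset.mem_filter.2 ⟨hr e he, hlef, le_rfl, h, ?_, (hYr e he).ge⟩⟩
        have := hefx (X (r e))
        rw [← hYr e he]
        nlinarith
      · refine ⟨r f, Finset.mem_filter.2 ⟨hr f hfE, hlff, h, le_rfl, (hYr f hfE).le, ?_⟩⟩
        have := hefx (X (r f))
        rw [← hYr f hfE]
        nlinarith)
    obtain ⟨hwV, hw1, hw2, hw3, hw4, hw5⟩ := Finset.mem_filter.1 hw
    -- No edge lies strictly inside the wedge up to `w`. Followed to the left it cannot cross `e` or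
    -- `f`, so it passes through `l e`, or starts there with a slope that contradicts the choice of
    -- `f`, or starts at a wedge vertex to the left of `w`.
    have hwedge : ∀ g ∈ E, ∀ x, X (l e) < x → x ≤ X w → X (l g) < x → x ≤ X (r g) →
        p f + s f * x < p g + s g * x → p g + s g * x < p e + s e * x → False := by
      intro g hg x hx1 hx2 hx3 hx4 hx5 hx6
      have hnf : ∀ y, X (l e) ≤ y → X (l g) ≤ y → y < x →
          p f + s f * y ≤ p g + s g * y := by
        intro y hy1 hy2 hy3
        by_contra! hcon
        obtain ⟨z, hz1, hz2, hz3⟩ := exists_affine_eq hy3 hcon hx5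
        have := hmeet g hg f hfE z (by linarith) (by linarith) (by rw [hfl]; linarith)
          (by linarith) hz3
        rw [this] at hx5
        linarith
      have hne : ∀ y, X (l e) ≤ y → X (l g) ≤ y → y < x →
          p g + s g * y ≤ p e + s e * y := by
        intro y hy1 hy2 hy3
        by_contra! hcon
        obtain ⟨z, hz1, hz2, hz3⟩ := exists_affine_eq hy3 hcon hx6
        have := hmeet e he g hg z (by linarith) (by linarith) (by linarith)
          (by linarith) hz3
        rw [this] at hx6
        linarith
      rcases lt_trichotomy (X (l g)) (X (l e)) with h | h | h
      · have e1 := hnf _ le_rfl h.le hx1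
        have e2 := hne _ le_rfl h.le hx1
        have e3 := hefx (X (l e))
        have e4 := hYl e he
        exact hvert g hg (l e) (hl e he) h (by linarith) (by linarith)
      · have hle := hX _ (hl g hg) _ (hl e he) h
        have e1 := hYl g hg
        have e2 := hYl e he
        have e3 := hYl f hfE
        rw [hle] at e1
        rw [hfl] at e3
        have s1 : s f < s g := by nlinarith
        have s2 : s g < s e := by nlinarith
        have := hfmax g (Finset.mem_filter.2 ⟨hg, hle, s2⟩)
        linarith
      · have e1 := hnf _ h.le le_rfl hx3
        have e2 := hne _ h.le le_rfl hx3
        rw [hYl g hg] at e1 e2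
        have := hwmin (l g) (Finset.mem_filter.2
          ⟨hl g hg, h, by linarith, by linarith, e1, e2⟩)
        linarith
    -- If `w` were `r e`, the steeper edge `g` ending there would lie in the wedge just to the left
    -- of `r e`. The offset `η` is small enough for `g` to be still above `f`, `D` being the gap
    -- between `e` and `f` over `r e`.
    have hwlt : X w < X (r e) := by
      refine hw2.lt_of_ne fun heq => ?_
      obtain ⟨g, hg, hgr, hgs⟩ := hg
      have hwr := hX _ hwV _ (hr e he) heq
      have e1 := hefx (X (r e))
      have e2 := hYr e he
      have e3 := hYr g hg
      have e4 := hlr g hg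
      rw [hgr] at e3 e4
      have hgap : 0 < (s e - s f) * (X (r e) - X (l e)) :=
        mul_pos (by linarith) (by linarith)
      set D := (s e - s f) * (X (r e) - X (l e)) with hD
      have hsg : 0 < s g - s f := by linarith
      set η := min (D / (s g - s f)) (min (X (r e) - X (l e)) (X (r e) - X (l g))) / 2 with hη
      have hm : 0 < min (D / (s g - s f)) (min (X (r e) - X (l e)) (X (r e) - X (l g))) :=
        lt_min (by positivity) (lt_min (by linarith) (by linarith))
      have h0 : 0 < η := by positivity
      have h1 : η < D / (s g - s f) := by
        linarith [min_le_left (D / (s g - s f)) (min (X (r e) - X (l e)) (X (r e) - X (l g)))]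
      have h23 : η < min (X (r e) - X (l e)) (X (r e) - X (l g)) := by
        linarith [min_le_right (D / (s g - s f)) (min (X (r e) - X (l e)) (X (r e) - X (l g)))]
      have h2 := h23.trans_le (min_le_left _ _)
      have h3 := h23.trans_le (min_le_right _ _)
      rw [lt_div_iff₀ hsg] at h1
      refine hwedge g hg (X (r e) - η) (by linarith) (by linarith) (by linarith)
        (by rw [hgr]; linarith) (by nlinarith) (by nlinarith)
    refine ⟨w, hwV, hw1, hwlt, hw5.lt_of_ne (hvert e he w hwV hw1 hwlt), ?_⟩
    intro g hg hg1 hg2 hg3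
    by_contra! hcon
    have hlt : X (l g) < X w := by
      refine hg1.lt_of_ne fun h => ?_
      have := hYl g hg
      rw [hX _ (hl g hg) _ hwV h] at this
      linarith
    exact hwedge g hg (X w) hw1 le_rfl hlt hg2 (by linarith) hcon
  -- Each edge is charged to a vertex with one of three tags: 0 if lowest at its left end, 1 if
  -- steepest at its right end, 2 if it is the first edge above an inner vertex. The charge
  -- determines the edge.
  have hmap : ∀ e ∈ E, ∃ q : α × Fin 3, q.1 ∈ V ∧
      ((q.2 = 0 ∧ q.1 = l e ∧ ∀ f ∈ E, l f = l e → s e ≤ s f) ∨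
       (q.2 = 1 ∧ q.1 = r e ∧ ∀ f ∈ E, r f = r e → s f ≤ s e) ∨
       (q.2 = 2 ∧ X (l e) < X q.1 ∧ X q.1 < X (r e) ∧ Y q.1 < p e + s e * X q.1 ∧
        ∀ g ∈ E, X (l g) ≤ X q.1 → X q.1 ≤ X (r g) → Y q.1 < p g + s g * X q.1 →
          p e + s e * X q.1 ≤ p g + s g * X q.1)) := by
    intro e he
    by_cases h1 : ∃ f ∈ E, l f = l e ∧ s f < s e
    · by_cases h2 : ∃ g ∈ E, r g = r e ∧ s e < s g
      · obtain ⟨w, hw, h⟩ := hbelow e he h1 h2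
        exact ⟨(w, 2), hw, Or.inr (Or.inr ⟨rfl, h⟩)⟩
      · push Not at h2
        exact ⟨(r e, 1), hr e he, Or.inr (Or.inl ⟨rfl, rfl, h2⟩)⟩
    · push Not at h1
      exact ⟨(l e, 0), hl e he, Or.inl ⟨rfl, rfl, h1⟩⟩
  rcases E.eq_empty_or_nonempty with rfl | ⟨e₀, -⟩
  · simp
  have : Nonempty α := ⟨l e₀⟩
  choose! φ hφV hφ using hmap
  have hcard : E.card ≤ (V ×ˢ (Finset.univ : Finset (Fin 3))).card := by
    refine Finset.card_le_card_of_injOn φ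
      (fun e he => Finset.mem_product.2 ⟨hφV e he, Finset.mem_univ _⟩) ?_
    intro e he f hf hef
    have he' : e ∈ E := he
    have hf' : f ∈ E := hf
    have h1 := hφ e he'
    have h2 := hφ f hf'
    rw [← hef] at h2
    rcases h1 with ⟨a1, a2, a3⟩ | ⟨a1, a2, a3⟩ | ⟨a1, a2, a3, a4, a5⟩ <;>
      rcases h2 with ⟨b1, b2, b3⟩ | ⟨b1, b2, b3⟩ | ⟨b1, b2, b3, b4, b5⟩ <;>
      try (rw [a1] at b1; exact absurd b1 (by decide))
    · have := a2.symm.trans b2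
      exact hleft e he' f hf' this (le_antisymm (a3 f hf' this.symm) (b3 e he' this))
    · have := a2.symm.trans b2
      exact hright e he' f hf' this (le_antisymm (b3 e he' this) (a3 f hf' this.symm))
    · exact hmeet e he' f hf' _ a2 a3 b2 b3
        (le_antisymm (a5 f hf' b2.le b3.le b4) (b5 e he' a2.le a3.le a4))
  rw [Finset.card_product, Finset.card_univ, Fintype.card_fin] at hcard
  linarith

/-- Each pair of distinct points is identified by at most one shear parameter, so all but finitely
many parameters work. -/
theorem exists_injective_shear (V : Finset ℂ) :
    ∃ t : ℝ, ∀ v ∈ V, ∀ w ∈ V, v.re + t * v.im = w.re + t * w.im → v = w := by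
  classical
  obtain ⟨t, ht⟩ := Infinite.exists_notMem_finset
    ((V ×ˢ V).image fun q : ℂ × ℂ => -(q.1.re - q.2.re) / (q.1.im - q.2.im))
  refine ⟨t, fun v hv w hw h => ?_⟩
  by_contra hne
  have him : v.im - w.im ≠ 0 := by
    intro h0
    refine hne (Complex.ext ?_ (by linarith))
    have : v.im = w.im := by linarith
    rw [this] at h
    linarith
  refine ht (Finset.mem_image.2 ⟨(v, w), Finset.mem_product.2 ⟨hv, hw⟩, ?_⟩)
  simp only
  rw [div_eq_iff him]
  linarith

/-- After a shear no two vertices have the same abscissa; every edge then is the graph of an affine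
function and the combinatorial bound applies. -/
theorem PSLG.card_edges_le (Γ : PSLG) : Γ.edges.card ≤ 3 * Γ.verts.card := by
  classical
  obtain ⟨t, ht⟩ := exists_injective_shear Γ.verts
  let X : ℂ → ℝ := fun z => z.re + t * z.im
  have horient : ∀ e ∈ Γ.edges, ∃ q : ℂ × ℂ, e = s(q.1, q.2) ∧ X q.1 < X q.2 := by
    intro e he
    have hd := Γ.not_isDiag e he
    have hm := Γ.endpoint_mem e he
    induction e with | _ a b =>
    have hab : a ≠ b := by simpa using hd
    rcases lt_trichotomy (X a) (X b) with h | h | h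
    · exact ⟨(a, b), rfl, h⟩
    · exact absurd (ht a (hm a (by simp)) b (hm b (by simp)) h) hab
    · exact ⟨(b, a), Sym2.eq_swap, h⟩
  choose! q hq hqX using horient
  let s : Sym2 ℂ → ℝ := fun e => ((q e).2.im - (q e).1.im) / (X (q e).2 - X (q e).1)
  have hX : ∀ z w : ℂ, X z = X w → z.im = w.im → z = w := by
    intro z w h1 h2
    refine Complex.ext ?_ h2
    simp only [X, h2] at h1
    linarith
  have hpt : ∀ e ∈ Γ.edges, ∀ x, X (q e).1 < x → x < X (q e).2 → ∃ z ∈ openEdge e, X z = x ∧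
      z.im = ((q e).1.im - s e * X (q e).1) + s e * x := by
    intro e he x h1 h2
    have hpos : 0 < X (q e).2 - X (q e).1 := by linarith [hqX e he]
    refine ⟨(q e).1 + ((x - X (q e).1) / (X (q e).2 - X (q e).1) : ℝ) * ((q e).2 - (q e).1),
      ?_, ?_, ?_⟩
    · have : openEdge e = openSegment ℝ (q e).1 (q e).2 := by
        conv_lhs => rw [hq e he]
        rfl
      rw [this]
      refine mem_openSegment_complex.2 ⟨_, div_pos (by linarith) hpos, ?_, rfl⟩
      rw [div_lt_one hpos]
      linarith
    · have : (x - X (q e).1) / (X (q e).2 - X (q e).1) * (X (q e).2 - X (q e).1) =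
          x - X (q e).1 := by field_simp
      simp only [X, Complex.add_re, Complex.add_im, Complex.re_ofReal_mul, Complex.im_ofReal_mul,
        Complex.sub_re, Complex.sub_im] at this ⊢
      linear_combination this
    · simp only [s, Complex.add_im, Complex.im_ofReal_mul, Complex.sub_im]
      field_simp
      ring
  refine card_le_three_mul_of_noncrossing Γ.verts Γ.edges X Complex.im (fun e => (q e).1)
    (fun e => (q e).2) (fun e => (q e).1.im - s e * X (q e).1) s ?_ ?_ hqX ?_ ?_ ht ?_ ?_
  · intro e he
    refine Γ.endpoint_mem e he _ ?_
    have := Sym2.mem_mk_left (q e).1 (q e).2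
    rwa [← hq e he] at this
  · intro e he
    refine Γ.endpoint_mem e he _ ?_
    have := Sym2.mem_mk_right (q e).1 (q e).2
    rwa [← hq e he] at this
  · intro e _
    ring
  · intro e he
    have : X (q e).2 - X (q e).1 ≠ 0 := by linarith [hqX e he]
    simp only [s]
    field_simp
    ring
  · intro e he f hf x h1 h2 h3 h4 h5
    obtain ⟨z, hz, hz1, hz2⟩ := hpt e he x h1 h2
    obtain ⟨w, hw, hw1, hw2⟩ := hpt f hf x h3 h4
    have : z = w := hX z w (hz1.trans hw1.symm) (by rw [hz2, hw2]; exact h5)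
    exact Γ.eq_of_mem_openEdge he hf hz (this ▸ hw)
  · intro e he v hv h1 h2 h3
    obtain ⟨z, hz, hz1, hz2⟩ := hpt e he _ h1 h2
    have : z = v := hX z v hz1 (by rw [hz2]; exact h3.symm)
    exact Γ.vertex_notMem e he v hv (this ▸ hz)

/-! ### Inner product and elementary properties of faces -/

/-- The real inner product of the plane. -/
def dot (z w : ℂ) : ℝ := z.re * w.re + z.im * w.im

theorem dot_comm (z w : ℂ) : dot z w = dot w z := by simp only [dot]; ring

theorem dot_add_left (z z' w : ℂ) : dot (z + z') w = dot z w + dot z' w := by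
  simp only [dot, Complex.add_re, Complex.add_im]; ring

theorem dot_sub_left (z z' w : ℂ) : dot (z - z') w = dot z w - dot z' w := by
  simp only [dot, Complex.sub_re, Complex.sub_im]; ring

theorem dot_neg_left (z w : ℂ) : dot (-z) w = -dot z w := by
  simp only [dot, Complex.neg_re, Complex.neg_im]; ring

theorem dot_smul_left (t : ℝ) (z w : ℂ) : dot (t * z) w = t * dot z w := by
  simp only [dot, Complex.re_ofReal_mul, Complex.im_ofReal_mul]; ring

theorem dot_add_right (z w w' : ℂ) : dot z (w + w') = dot z w + dot z w' := by
  simp only [dot, Complex.add_re, Complex.add_im]; ring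

theorem dot_sub_right (z w w' : ℂ) : dot z (w - w') = dot z w - dot z w' := by
  simp only [dot, Complex.sub_re, Complex.sub_im]; ring

theorem dot_neg_right (z w : ℂ) : dot z (-w) = -dot z w := by
  simp only [dot, Complex.neg_re, Complex.neg_im]; ring

theorem dot_smul_right (t : ℝ) (z w : ℂ) : dot z (t * w) = t * dot z w := by
  simp only [dot, Complex.re_ofReal_mul, Complex.im_ofReal_mul]; ring

theorem dot_self (z : ℂ) : dot z z = ‖z‖ ^ 2 := by
  rw [Complex.sq_norm, Complex.normSq_apply, dot]

theorem dot_zero_left (w : ℂ) : dot 0 w = 0 := by simp [dot]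

@[fun_prop]
theorem continuous_dot_left (w : ℂ) : Continuous fun z => dot z w := by
  unfold dot; fun_prop

theorem dot_exp_exp (α β : ℝ) :
    dot (Complex.exp (α * Complex.I)) (Complex.exp (β * Complex.I)) = Real.cos (β - α) := by
  rw [dot, Complex.exp_ofReal_mul_I_re, Complex.exp_ofReal_mul_I_re, Complex.exp_ofReal_mul_I_im,
    Complex.exp_ofReal_mul_I_im, Real.cos_sub]
  ring

theorem IsFace.eq_component {K Ω : Set ℂ} (h : IsBoundedComplComponent K Ω) {z : ℂ} (hz : z ∈ Ω) :
    Ω = connectedComponentIn Kᶜ z := by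
  obtain ⟨-, w, -, rfl⟩ := h
  exact connectedComponentIn_eq hz

theorem IsFace.subset_compl {K Ω : Set ℂ} (h : IsBoundedComplComponent K Ω) : Ω ⊆ Kᶜ := by
  obtain ⟨-, w, -, rfl⟩ := h
  exact connectedComponentIn_subset _ _

theorem IsFace.isPreconnected {K Ω : Set ℂ} (h : IsBoundedComplComponent K Ω) :
    IsPreconnected Ω := by
  obtain ⟨-, w, -, rfl⟩ := h
  exact isPreconnected_connectedComponentIn

theorem IsFace.nonempty {K Ω : Set ℂ} (h : IsBoundedComplComponent K Ω) : Ω.Nonempty := by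
  obtain ⟨-, w, hw, rfl⟩ := h
  exact ⟨w, mem_connectedComponentIn hw⟩

theorem IsFace.isOpen {K Ω : Set ℂ} (hK : IsClosed K) (h : IsBoundedComplComponent K Ω) :
    IsOpen Ω := by
  obtain ⟨-, w, -, rfl⟩ := h
  exact hK.isOpen_component w

theorem IsFace.frontier_subset {K Ω : Set ℂ} (hK : IsClosed K) (h : IsBoundedComplComponent K Ω) :
    frontier Ω ⊆ K := by
  obtain ⟨-, w, -, rfl⟩ := h
  exact hK.frontier_component_subset w

theorem IsFace.subset_of_meets {K Ω S : Set ℂ} (h : IsBoundedComplComponent K Ω)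
    (hS : IsPreconnected S) (hSK : S ⊆ Kᶜ) {z : ℂ} (hzS : z ∈ S) (hz : z ∈ Ω) : S ⊆ Ω := by
  rw [IsFace.eq_component h hz]
  exact hS.subset_connectedComponentIn hzS hSK

/-- A face of a set between `K` and its hull is contained in the hull. -/
theorem IsFace.subset_polyHull {K K' Ω : Set ℂ} (h1 : K ⊆ K') (h2 : K' ⊆ polyHull K)
    (h : IsBoundedComplComponent K' Ω) : Ω ⊆ polyHull K := by
  intro z hz
  rw [← polyHull_eq_of_subset h1 h2]
  exact Or.inr (by rw [← IsFace.eq_component h hz]; exact h.1)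

/-! ### Good refinements -/

/-- A refinement inside the polynomial hull all of whose new angles are at least `60°`. -/
structure PSLG.IsGoodRefinement (Γ' Γ : PSLG) : Prop where
  verts_subset : Γ.verts ⊆ Γ'.verts
  carrier_subset : Γ.carrier ⊆ Γ'.carrier
  subset_hull : Γ'.carrier ⊆ polyHull Γ.carrier
  ray : ∀ x d₁ d₂ : ℂ, ‖d₁‖ = 1 → ‖d₂‖ = 1 → d₁ ≠ d₂ → IsRay Γ'.carrier x d₁ →
    IsRay Γ'.carrier x d₂ → (IsRay Γ.carrier x d₁ ∧ IsRay Γ.carrier x d₂) ∨ dot d₁ d₂ ≤ 1 / 2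

namespace PSLG

theorem IsGoodRefinement.refl (Γ : PSLG) : Γ.IsGoodRefinement Γ :=
  ⟨subset_rfl, subset_rfl, subset_polyHull _, fun _ _ _ _ _ _ h1 h2 => Or.inl ⟨h1, h2⟩⟩

theorem IsGoodRefinement.trans {Γ₁ Γ₂ Γ₃ : PSLG} (h : Γ₁.IsGoodRefinement Γ₂)
    (h' : Γ₂.IsGoodRefinement Γ₃) : Γ₁.IsGoodRefinement Γ₃ where
  verts_subset := h'.verts_subset.trans h.verts_subset
  carrier_subset := h'.carrier_subset.trans h.carrier_subset
  subset_hull := by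
    rw [← polyHull_eq_of_subset h'.carrier_subset h'.subset_hull]
    exact h.subset_hull
  ray x d₁ d₂ h1 h2 hne hr1 hr2 := by
    rcases h.ray x d₁ d₂ h1 h2 hne hr1 hr2 with ⟨a, b⟩ | h
    · exact h'.ray x d₁ d₂ h1 h2 hne a b
    · exact Or.inr h

/-- A measure below 60° means that the inner product of the two directions exceeds 1/2, so both rays
already belong to `Γ`. The old face is the component containing the new one. -/
theorem IsGoodRefinement.exists_isAngleOf {Γ' Γ : PSLG} (h : Γ'.IsGoodRefinement Γ) {Ω' : Set ℂ}
    {v : ℂ} {α β : ℝ} (hA : Γ'.IsAngleOf Ω' v α β) (hlt : β - α < Real.pi / 3) :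
    ∃ Ω : Set ℂ, Γ.IsAngleOf Ω v α β := by
  obtain ⟨hface, hv, hαβ, h2π, r, hr, hsec⟩ := hA
  have hcos : 1 / 2 < Real.cos (β - α) := by
    rw [← Real.cos_pi_div_three]
    exact Real.cos_lt_cos_of_nonneg_of_le_pi (by linarith) (by linarith [Real.pi_pos]) hlt
  have hdot := dot_exp_exp α β
  have hα : ‖Complex.exp (α * Complex.I)‖ = 1 := Complex.norm_exp_ofReal_mul_I α
  have hβ : ‖Complex.exp (β * Complex.I)‖ = 1 := Complex.norm_exp_ofReal_mul_I β
  have hne : Complex.exp (α * Complex.I) ≠ Complex.exp (β * Complex.I) := by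
    intro heq
    rw [heq, dot_self, hβ] at hdot
    have := Real.cos_lt_cos_of_nonneg_of_le_pi (x := 0) (y := β - α) le_rfl
      (by linarith [Real.pi_pos]) (by linarith)
    rw [Real.cos_zero] at this
    linarith
  have hrα : IsRay Γ'.carrier v (Complex.exp (α * Complex.I)) :=
    eventually_nhdsGT_zero_iff.2 ⟨r, hr, fun s h1 h2 => (hsec s h1 h2).1⟩
  have hrβ : IsRay Γ'.carrier v (Complex.exp (β * Complex.I)) :=
    eventually_nhdsGT_zero_iff.2 ⟨r, hr, fun s h1 h2 => (hsec s h1 h2).2.1⟩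
  obtain ⟨gα, gβ⟩ := (h.ray v _ _ hα hβ hne hrα hrβ).resolve_right (by rw [hdot]; linarith)
  obtain ⟨rα, hrα0, hgα⟩ := gα.exists_pos
  obtain ⟨rβ, hrβ0, hgβ⟩ := gβ.exists_pos
  set γ := (α + β) / 2 with hγ
  set z₀ := v + (r / 2 : ℝ) * Complex.exp (γ * Complex.I) with hz₀
  have hz₀Ω : z₀ ∈ Ω' := (hsec (r / 2) (by positivity) (by linarith)).2.2 γ
    (by rw [hγ]; linarith) (by rw [hγ]; linarith)
  have hz₀Γ' : z₀ ∉ Γ'.carrier := IsFace.subset_compl hface hz₀Ω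
  have hz₀Γ : z₀ ∉ Γ.carrier := fun hh => hz₀Γ' (h.carrier_subset hh)
  have hsub : Ω' ⊆ connectedComponentIn Γ.carrierᶜ z₀ :=
    (IsFace.isPreconnected hface).subset_connectedComponentIn hz₀Ω
      ((IsFace.subset_compl hface).trans (Set.compl_subset_compl.2 h.carrier_subset))
  -- This is where `subset_hull` is needed: the new face lies in the hull of `Γ`, so the larger
  -- component is bounded too.
  have hbdd : Bornology.IsBounded (connectedComponentIn Γ.carrierᶜ z₀) :=
    (IsFace.subset_polyHull h.carrier_subset h.subset_hull hface hz₀Ω).resolve_left hz₀Γ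
  refine ⟨connectedComponentIn Γ.carrierᶜ z₀, ⟨hbdd, z₀, hz₀Γ, rfl⟩, ?_, hαβ, h2π,
    min r (min rα rβ), lt_min hr (lt_min hrα0 hrβ0), fun s hs hsr => ⟨?_, ?_, ?_⟩⟩
  -- Away from the vertices `Γ` is a line, whose two rays are opposite and form no angle below 60°.
  · by_contra hvV
    obtain ⟨u, hu, hline⟩ := Γ.exists_isLineNear (gα.mem Γ.isClosed_carrier) hvV isClosed_empty
      (Set.notMem_empty v)
    rw [Set.empty_union] at hline
    have hopp : ∀ a b : ℂ, ‖b‖ = 1 → a = -b → ¬ dot a b = Real.cos (β - α) := by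
      rintro a b hb rfl h
      rw [dot_neg_left, dot_self, hb] at h
      linarith
    rcases hline.eq_or_eq_neg hu hα gα with h1 | h1 <;>
      rcases hline.eq_or_eq_neg hu hβ gβ with h2 | h2
    · exact hne (h1.trans h2.symm)
    · exact hopp _ _ hβ (by rw [h1, h2, neg_neg]) hdot
    · exact hopp _ _ hβ (by rw [h1, h2]) hdot
    · exact hne (h1.trans h2.symm)
  · exact hgα s hs (hsr.trans_le ((min_le_right _ _).trans (min_le_left _ _)))
  · exact hgβ s hs (hsr.trans_le ((min_le_right _ _).trans (min_le_right _ _)))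
  · exact fun θ h1 h2 => hsub ((hsec s hs (hsr.trans_le (min_le_left _ _))).2.2 θ h1 h2)

end PSLG

/-! ### Joining the components of a graph -/

theorem IsRay.eq_of_segment {a b x d : ℂ} (hab : a ≠ b) (hd : ‖d‖ = 1)
    (h : IsRay (segment ℝ a b) x d) :
    (d = (b - a) / ‖b - a‖ ∧ x ≠ b) ∨ (d = -((b - a) / ‖b - a‖) ∧ x ≠ a) := by
  have hx := h.mem (isCompact_segment_complex a b).isClosed
  obtain ⟨r, hr, h⟩ := h.exists_pos
  obtain ⟨t, ht0, ht1, rfl⟩ := mem_segment_complex.1 hx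
  obtain ⟨t', ht0', ht1', ht'⟩ := mem_segment_complex.1 (h (r / 2) (by positivity) (by linarith))
  have hba : b - a ≠ 0 := sub_ne_zero.2 hab.symm
  have hpos : 0 < ‖b - a‖ := norm_pos_iff.2 hba
  have hposC : (‖b - a‖ : ℂ) ≠ 0 := by exact_mod_cast hpos.ne'
  have h1 : ((r / 2 : ℝ) : ℂ) * d = (t' - t : ℝ) * (b - a) := by
    push_cast at ht' ⊢
    linear_combination ht'
  have h2 : r / 2 = |t' - t| * ‖b - a‖ := by
    have := congrArg norm h1
    rwa [norm_mul, norm_mul, hd, Complex.norm_real, Complex.norm_real, Real.norm_eq_abs,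
      Real.norm_eq_abs, abs_of_pos (by positivity : 0 < r / 2), mul_one] at this
  have hrC : ((r / 2 : ℝ) : ℂ) ≠ 0 := by exact_mod_cast (by positivity : r / 2 ≠ 0)
  have hcancel : ∀ k : ℝ, ((k : ℂ) * (b - a) = b - a) → k = 1 := by
    intro k hk
    have : ((k : ℂ) - 1) * (b - a) = 0 := by linear_combination hk
    rcases mul_eq_zero.1 this with h | h
    · have h' : (k : ℂ) = 1 := by linear_combination h
      exact_mod_cast h'
    · exact absurd h hba
  rcases lt_trichotomy t t' with hlt | heq | hlt
  · left
    rw [abs_of_pos (by linarith)] at h2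
    refine ⟨?_, ?_⟩
    · have h2C : ((r / 2 : ℝ) : ℂ) = ((t' - t : ℝ) : ℂ) * (‖b - a‖ : ℝ) := by exact_mod_cast h2
      apply mul_left_cancel₀ hrC
      rw [h1, h2C]
      field_simp
    · intro hb
      have := hcancel t (by linear_combination hb)
      linarith
  · rw [heq, sub_self, abs_zero, zero_mul] at h2
    linarith
  · right
    rw [abs_of_neg (by linarith)] at h2
    refine ⟨?_, ?_⟩
    · have h2C : ((r / 2 : ℝ) : ℂ) = -((t' - t : ℝ) : ℂ) * (‖b - a‖ : ℝ) := by
        exact_mod_cast h2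
      apply mul_left_cancel₀ hrC
      rw [h1, h2C]
      field_simp
    · intro ha
      have : ((t + 1 : ℝ) : ℂ) * (b - a) = b - a := by push_cast; linear_combination ha
      have := hcancel _ this
      linarith

/-- A ray of a set at a point nearest to `b` makes an angle of at least `90°` with the direction
of `b`. -/
theorem IsRay.dot_nonpos_of_nearest {C : Set ℂ} {a b d : ℂ} (hd : ‖d‖ = 1) (h : IsRay C a d)
    (hmin : ∀ a' ∈ C, dist a b ≤ dist a' b) : dot d (b - a) ≤ 0 := by
  by_contra! hpos
  obtain ⟨r, hr, h⟩ := h.exists_pos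
  set s := min r (dot d (b - a)) / 2 with hs
  have hm : 0 < min r (dot d (b - a)) := lt_min hr hpos
  have hs0 : 0 < s := by positivity
  have hs1 : s < r := by linarith [min_le_left r (dot d (b - a))]
  have hs2 : s < dot d (b - a) := by linarith [min_le_right r (dot d (b - a))]
  have h1 := hmin _ (h s hs0 hs1)
  rw [dist_eq_norm, dist_eq_norm] at h1
  have h2 := pow_le_pow_left₀ (norm_nonneg _) h1 2
  have h3 := dot_self d
  rw [hd] at h3
  rw [← dot_self, ← dot_self] at h2
  simp only [dot, Complex.add_re, Complex.add_im, Complex.sub_re, Complex.sub_im,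
    Complex.re_ofReal_mul, Complex.im_ofReal_mul] at h2 h3 hs2
  have h4 := mul_pos hs0 (sub_pos.2 hs2)
  have h5 : s ^ 2 * (d.re * d.re + d.im * d.im) = s ^ 2 := by rw [h3]; ring
  nlinarith [mul_pos hs0 hs0]

theorem IsClosed.component {K : Set ℂ} (hK : IsClosed K) (z : ℂ) :
    IsClosed (connectedComponentIn K z) := by
  by_cases hz : z ∈ K
  · refine isClosed_of_closure_subset ?_
    exact isPreconnected_connectedComponentIn.closure.subset_connectedComponentIn
      (subset_closure (mem_connectedComponentIn hz))
      (closure_minimal (connectedComponentIn_subset _ _) hK)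
  · rw [connectedComponentIn_eq_empty hz]
    exact isClosed_empty

theorem component_eq_of_isPreconnected {K S : Set ℂ} (hS : IsPreconnected S) (hSK : S ⊆ K)
    {a b : ℂ} (ha : a ∈ S) (hb : b ∈ S) : connectedComponentIn K a = connectedComponentIn K b :=
  connectedComponentIn_eq (hS.subset_connectedComponentIn ha hSK hb)

/-- A compact set with finitely many components, at least two, contains a shortest pair of points
of different components. -/
theorem exists_shortest_pair {K : Set ℂ} (hK : IsCompact K) {S : Finset ℂ}
    (hS : K ⊆ ⋃ s ∈ S, connectedComponentIn K s) (hKc : ¬ IsPreconnected K) :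
    ∃ a ∈ K, ∃ b ∈ K, connectedComponentIn K a ≠ connectedComponentIn K b ∧
      ∀ a' ∈ K, ∀ b' ∈ K, connectedComponentIn K a' ≠ connectedComponentIn K b' →
        dist a b ≤ dist a' b' := by
  classical
  let T : Set (ℂ × ℂ) := {q | q.1 ∈ K ∧ q.2 ∈ K ∧
    connectedComponentIn K q.1 ≠ connectedComponentIn K q.2}
  -- As a finite union of products of closed components, the set of admissible pairs is compact;
  -- this is the use of the finite cover `S`.
  have hT : T = ⋃ q ∈ (S ×ˢ S).filter
      (fun q : ℂ × ℂ => connectedComponentIn K q.1 ≠ connectedComponentIn K q.2),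
      connectedComponentIn K q.1 ×ˢ connectedComponentIn K q.2 := by
    ext q
    simp only [T, Set.mem_ofPred_eq, Set.mem_iUnion, Finset.mem_filter, Finset.mem_product,
      exists_prop, Set.mem_prod]
    constructor
    · rintro ⟨h1, h2, h3⟩
      obtain ⟨s, hs, hs'⟩ : ∃ s ∈ S, q.1 ∈ connectedComponentIn K s := by simpa using hS h1
      obtain ⟨t, ht, ht'⟩ : ∃ s ∈ S, q.2 ∈ connectedComponentIn K s := by simpa using hS h2
      refine ⟨(s, t), ⟨⟨hs, ht⟩, ?_⟩, hs', ht'⟩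
      rwa [connectedComponentIn_eq hs', connectedComponentIn_eq ht']
    · rintro ⟨p, ⟨-, hne⟩, h1, h2⟩
      refine ⟨connectedComponentIn_subset _ _ h1, connectedComponentIn_subset _ _ h2, ?_⟩
      rwa [← connectedComponentIn_eq h1, ← connectedComponentIn_eq h2]
  have hTc : IsCompact T := by
    rw [hT]
    refine Finset.isCompact_biUnion _ fun q _ => ?_
    exact (hK.of_isClosed_subset (hK.isClosed.component _) (connectedComponentIn_subset _ _)).prod
      (hK.of_isClosed_subset (hK.isClosed.component _) (connectedComponentIn_subset _ _))
  have hTn : T.Nonempty := by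
    by_contra hcon
    refine hKc (isPreconnected_of_forall_pair fun x hx y hy => ?_)
    refine ⟨connectedComponentIn K x, connectedComponentIn_subset _ _,
      mem_connectedComponentIn hx, ?_, isPreconnected_connectedComponentIn⟩
    by_contra hne
    refine hcon ⟨(x, y), hx, hy, fun h => hne ?_⟩
    rw [h]
    exact mem_connectedComponentIn hy
  obtain ⟨q, ⟨h1, h2, h3⟩, hmin⟩ := hTc.exists_isMinOn hTn
    (continuous_fst.dist continuous_snd).continuousOn
  exact ⟨q.1, h1, q.2, h2, h3, fun a' ha b' hb hne => hmin (a := (a', b')) ⟨ha, hb, hne⟩⟩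

/-- A shortest segment between different components is added. The finite set `S`, which meets every
component, measures progress: one of its points becomes superfluous. -/
theorem PSLG.exists_join (Γ : PSLG) (hhull : IsPreconnected (polyHull Γ.carrier)) {S : Finset ℂ}
    (hS : Γ.carrier ⊆ ⋃ s ∈ S, connectedComponentIn Γ.carrier s)
    (hKc : ¬ IsPreconnected Γ.carrier) :
    ∃ Γ' : PSLG, Γ'.IsGoodRefinement Γ ∧ Γ'.verts.card ≤ Γ.verts.card + 2 ∧
      ∃ S' : Finset ℂ, S'.card < S.card ∧
        Γ'.carrier ⊆ ⋃ s ∈ S', connectedComponentIn Γ'.carrier s := by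
  classical
  obtain ⟨a, ha, b, hb, hne, hmin⟩ := exists_shortest_pair Γ.isCompact_carrier hS hKc
  set K := Γ.carrier with hK
  have hab : a ≠ b := fun h => hne (by rw [h])
  have hba0 : 0 < ‖b - a‖ := norm_pos_iff.2 (sub_ne_zero.2 hab.symm)
  -- An inner point on the graph would lie in a component different from that of `a` or of `b`, and
  -- closer to that end than the minimum.
  have hdisj : ∀ z ∈ openSegment ℝ a b, z ∉ K := by
    intro z hz hzK
    obtain ⟨t, h0, h1, rfl⟩ := mem_openSegment_complex.1 hz
    by_cases h : connectedComponentIn K (a + t * (b - a)) = connectedComponentIn K a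
    · have := hmin _ hzK b hb (h ▸ hne)
      rw [dist_eq_norm, dist_eq_norm] at this
      have e : a + t * (b - a) - b = ((1 - t : ℝ) : ℂ) * (a - b) := by push_cast; ring
      rw [e, norm_mul, Complex.norm_real, Real.norm_eq_abs, abs_of_pos (by linarith),
        norm_sub_rev a b] at this
      nlinarith
    · have := hmin a ha _ hzK (Ne.symm h)
      rw [dist_eq_norm, dist_eq_norm] at this
      have e : a - (a + t * (b - a)) = (t : ℂ) * (a - b) := by ring
      rw [e, norm_mul, Complex.norm_real, Real.norm_eq_abs, abs_of_pos h0,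
        norm_sub_rev a b] at this
      nlinarith
  -- A segment outside the hull has both ends on the frontier of the complement of the hull. This
  -- frontier is connected and contained in `K`, so the ends would share a component.
  have hhull' : openSegment ℝ a b ⊆ polyHull K := by
    by_contra hcon
    obtain ⟨m, hm, hmP⟩ := Set.not_subset.1 hcon
    have hout : openSegment ℝ a b ⊆ (polyHull K)ᶜ := by
      intro z hz hzP
      refine hmP ((polyHull_component (hdisj z hz) ?_).2 hzP)
      exact (convex_openSegment a b).isPreconnected.subset_connectedComponentIn hz
        (fun w hw => hdisj w hw) hm
    have hcl : segment ℝ a b ⊆ closure (polyHull K)ᶜ := by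
      rw [← closure_openSegment]
      exact closure_mono hout
    have hopen : IsOpen (polyHull K)ᶜ := (isClosed_polyHull Γ.isClosed_carrier).isOpen_compl
    have hfr : ∀ z ∈ K, z ∈ segment ℝ a b → z ∈ frontier (polyHull K)ᶜ := by
      intro z hzK hz
      rw [hopen.frontier_eq]
      exact ⟨hcl hz, fun h => h (subset_polyHull K hzK)⟩
    have hpre := hopen.isPreconnected_frontier_of_compl
      (isPreconnected_compl_polyHull Γ.isCompact_carrier) (by rwa [compl_compl])
    exact hne (component_eq_of_isPreconnected hpre
      (frontier_polyHull_compl_subset Γ.isClosed_carrier)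
      (hfr a ha (left_mem_segment _ _ _)) (hfr b hb (right_mem_segment _ _ _)))
  have hKseg : ∀ z ∈ K, z ∈ segment ℝ a b → z = a ∨ z = b := by
    intro z hzK hz
    rw [← insert_endpoints_openSegment] at hz
    rcases hz with h | h | h
    exacts [Or.inl h, Or.inr h, absurd hzK (hdisj z h)]
  obtain ⟨Γ', hV', hK'⟩ := Γ.exists_add (Finset.univ : Finset Unit) (fun _ => a) (fun _ => b)
    (Γ.verts ∪ {a, b}) Finset.subset_union_left (by simp) (by
      intro z hz
      simp only [Finset.coe_union, Finset.coe_insert, Finset.coe_singleton, Set.mem_union,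
        Finset.mem_coe, Set.mem_insert_iff, Set.mem_singleton_iff] at hz
      left
      rcases hz with h | rfl | rfl
      · exact Γ.mem_carrier.2 (Or.inl h)
      · exact ha
      · exact hb)
    (by
      rintro - - z ⟨hz1, hz2⟩
      have := hKseg z hz1 hz2
      simp only [Finset.coe_union, Finset.coe_insert, Finset.coe_singleton, Set.mem_union,
        Finset.mem_coe, Set.mem_insert_iff, Set.mem_singleton_iff]
      exact Or.inr this)
    (fun i _ j _ h => absurd (Subsingleton.elim i j) h)
  have hK'' : Γ'.carrier = K ∪ segment ℝ a b := by simpa [Set.iUnion_const] using hK'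
  have hKK' : K ⊆ Γ'.carrier := by rw [hK'']; exact Set.subset_union_left
  set w := (b - a) / ‖b - a‖ with hw
  have hw1 : ‖w‖ = 1 := by simp [hw, hba0.ne']
  have hbw : b - a = (‖b - a‖ : ℝ) * w := by
    have : (‖b - a‖ : ℂ) ≠ 0 := by exact_mod_cast hba0.ne'
    rw [hw]
    field_simp
  have hnear_a : ∀ d, ‖d‖ = 1 → IsRay K a d → dot d w ≤ 0 := by
    intro d hd hray
    -- The initial piece of the ray stays in the component of `a`, so its points compete with `a`
    -- for the distance to `b`.
    have hC : IsRay (connectedComponentIn K a) a d := by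
      obtain ⟨r, hr, h⟩ := hray.exists_pos
      refine eventually_nhdsGT_zero_iff.2 ⟨r, hr, fun s hs hsr => ?_⟩
      have hsub : segment ℝ a (a + s * d) ⊆ K := by
        intro z hz
        obtain ⟨t, h0, h1, rfl⟩ := mem_segment_complex.1 hz
        rcases h0.eq_or_lt with h' | h'
        · simpa [← h'] using ha
        · have := h (t * s) (by positivity) (by nlinarith)
          convert this using 1
          push_cast
          ring
      exact (convex_segment _ _).isPreconnected.subset_connectedComponentIn
        (left_mem_segment _ _ _) hsub (right_mem_segment _ _ _)
    have := hC.dot_nonpos_of_nearest hd (b := b) fun a' ha' => hmin a'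
      (connectedComponentIn_subset _ _ ha') b hb (by rwa [← connectedComponentIn_eq ha'])
    rw [hbw, dot_smul_right] at this
    by_contra! hcon
    nlinarith
  have hnear_b : ∀ d, ‖d‖ = 1 → IsRay K b d → dot d (-w) ≤ 0 := by
    intro d hd hray
    have hC : IsRay (connectedComponentIn K b) b d := by
      obtain ⟨r, hr, h⟩ := hray.exists_pos
      refine eventually_nhdsGT_zero_iff.2 ⟨r, hr, fun s hs hsr => ?_⟩
      have hsub : segment ℝ b (b + s * d) ⊆ K := by
        intro z hz
        obtain ⟨t, h0, h1, rfl⟩ := mem_segment_complex.1 hz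
        rcases h0.eq_or_lt with h' | h'
        · simpa [← h'] using hb
        · have := h (t * s) (by positivity) (by nlinarith)
          convert this using 1
          push_cast
          ring
      exact (convex_segment _ _).isPreconnected.subset_connectedComponentIn
        (left_mem_segment _ _ _) hsub (right_mem_segment _ _ _)
    have := hC.dot_nonpos_of_nearest hd (b := a) fun b' hb' => by
      rw [dist_comm b a, dist_comm b' a]
      exact hmin a ha b' (connectedComponentIn_subset _ _ hb')
        (by rwa [← connectedComponentIn_eq hb'])
    have e : a - b = (‖b - a‖ : ℝ) * -w := by linear_combination -hbw
    rw [e, dot_smul_right] at this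
    by_contra! hcon
    nlinarith
  have hmix : ∀ x d₁ d₂, ‖d₁‖ = 1 → ‖d₂‖ = 1 → IsRay K x d₁ → IsRay (segment ℝ a b) x d₂ →
      dot d₁ d₂ ≤ 1 / 2 := by
    intro x d₁ d₂ h1 h2 hr1 hr2
    have hx := hKseg x (hr1.mem Γ.isClosed_carrier)
      (hr2.mem (isCompact_segment_complex a b).isClosed)
    rcases hr2.eq_of_segment hab h2 with ⟨hd, hxb⟩ | ⟨hd, hxa⟩
    · obtain rfl := hx.resolve_right hxb
      have := hnear_a d₁ h1 hr1
      rw [hd]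
      linarith
    · obtain rfl := hx.resolve_left hxa
      have := hnear_b d₁ h1 hr1
      rw [hd]
      linarith
  obtain ⟨s, hs, has⟩ : ∃ s ∈ S, a ∈ connectedComponentIn K s := by simpa using hS ha
  obtain ⟨t, ht, hbt⟩ : ∃ s ∈ S, b ∈ connectedComponentIn K s := by simpa using hS hb
  have hst : s ≠ t := by
    rintro rfl
    exact hne ((connectedComponentIn_eq has).symm.trans (connectedComponentIn_eq hbt))
  refine ⟨Γ', ⟨?_, hKK', ?_, ?_⟩, ?_, S.erase t, Finset.card_erase_lt_of_mem ht, ?_⟩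
  · rw [hV']; exact Finset.subset_union_left
  · rw [hK'']
    refine Set.union_subset (subset_polyHull K) ?_
    rw [← insert_endpoints_openSegment]
    exact Set.insert_subset (subset_polyHull K ha) (Set.insert_subset (subset_polyHull K hb) hhull')
  · intro x d₁ d₂ h1 h2 hd hr1 hr2
    rw [hK''] at hr1 hr2
    rcases hr1.or_of_union h1 (Γ.hasCone_carrier x) with a1 | a1 <;>
      rcases hr2.or_of_union h2 (Γ.hasCone_carrier x) with a2 | a2
    · exact Or.inl ⟨a1, a2⟩
    · exact Or.inr (hmix x d₁ d₂ h1 h2 a1 a2)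
    · rw [dot_comm]
      exact Or.inr (hmix x d₂ d₁ h2 h1 a2 a1)
    · right
      rcases a1.eq_of_segment hab h1 with ⟨e1, -⟩ | ⟨e1, -⟩ <;>
        rcases a2.eq_of_segment hab h2 with ⟨e2, -⟩ | ⟨e2, -⟩
      · exact absurd (e1.trans e2.symm) hd
      · rw [e1, e2, dot_neg_right, dot_self, ← hw, hw1]; norm_num
      · rw [e1, e2, dot_neg_left, dot_self, ← hw, hw1]; norm_num
      · exact absurd (e1.trans e2.symm) hd
  · rw [hV']
    refine (Finset.card_union_le _ _).trans ?_
    have := Finset.card_le_two (a := a) (b := b)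
    omega
  -- The components of `s` and `t` merge through the new segment, so `s` also represents what `t`
  -- did.
  · let Q := connectedComponentIn K s ∪ segment ℝ a b ∪ connectedComponentIn K t
    have hQ : IsPreconnected Q :=
      (isPreconnected_connectedComponentIn.union a has (left_mem_segment _ _ _)
        (convex_segment _ _).isPreconnected).union b (Or.inr (right_mem_segment _ _ _)) hbt
        isPreconnected_connectedComponentIn
    have hQK : Q ⊆ Γ'.carrier := by
      rw [hK'']
      refine Set.union_subset (Set.union_subset ?_ Set.subset_union_right) ?_
      · exact (connectedComponentIn_subset _ _).trans Set.subset_union_left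
      · exact (connectedComponentIn_subset _ _).trans Set.subset_union_left
    have hsQ : s ∈ Q := Or.inl (Or.inl (mem_connectedComponentIn
      (connectedComponentIn_nonempty_iff.1 ⟨a, has⟩)))
    have hQs := hQ.subset_connectedComponentIn hsQ hQK
    intro z hz
    simp only [Set.mem_iUnion, Finset.mem_erase, exists_prop]
    rw [hK''] at hz
    rcases hz with hz | hz
    · obtain ⟨p, hp, hzp⟩ : ∃ s ∈ S, z ∈ connectedComponentIn K s := by simpa using hS hz
      by_cases hpt : p = t
      · subst hpt
        exact ⟨s, ⟨hst, hs⟩, hQs (Or.inr hzp)⟩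
      · exact ⟨p, ⟨hpt, hp⟩, connectedComponentIn_mono _ hKK' hzp⟩
    · exact ⟨s, ⟨hst, hs⟩, hQs (Or.inl (Or.inr hz))⟩

theorem PSLG.exists_connected_of_cover (n : ℕ) : ∀ (Γ : PSLG) (S : Finset ℂ), S.card ≤ n →
    IsPreconnected (polyHull Γ.carrier) →
    Γ.carrier ⊆ ⋃ s ∈ S, connectedComponentIn Γ.carrier s →
    ∃ Γ' : PSLG, Γ'.IsGoodRefinement Γ ∧ IsPreconnected Γ'.carrier ∧
      Γ'.verts.card ≤ Γ.verts.card + 2 * n := by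
  induction n with
  | zero =>
    intro Γ S hS _ hcov
    obtain rfl : S = ∅ := by simpa using hS
    have : Γ.carrier = ∅ := by simpa using hcov
    exact ⟨Γ, .refl Γ, by rw [this]; exact isPreconnected_empty, by omega⟩
  | succ n ih =>
    intro Γ S hS hhull hcov
    by_cases hKc : IsPreconnected Γ.carrier
    · exact ⟨Γ, .refl Γ, hKc, by omega⟩
    · obtain ⟨Γ₁, hgood, hcard, S', hS', hcov'⟩ := Γ.exists_join hhull hcov hKc
      obtain ⟨Γ', hgood', hconn, hcard'⟩ := ih Γ₁ S' (by omega)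
        (by rwa [polyHull_eq_of_subset hgood.carrier_subset hgood.subset_hull]) hcov'
      exact ⟨Γ', hgood'.trans hgood, hconn, by omega⟩

/-- A planar straight line graph with connected hull has a connected good refinement. -/
theorem PSLG.exists_connected (Γ : PSLG) (hhull : IsPreconnected (polyHull Γ.carrier)) :
    ∃ Γ' : PSLG, Γ'.IsGoodRefinement Γ ∧ IsPreconnected Γ'.carrier ∧
      Γ'.verts.card ≤ 3 * Γ.verts.card := by
  obtain ⟨Γ', h1, h2, h3⟩ := PSLG.exists_connected_of_cover Γ.verts.card Γ Γ.verts le_rfl hhull (by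
    intro z hz
    simp only [Set.mem_iUnion, exists_prop]
    rcases Γ.mem_carrier.1 hz with h | ⟨e, he, h⟩
    · exact ⟨z, h, mem_connectedComponentIn hz⟩
    · have hsub := Γ.closedEdge_subset_carrier he
      have hend := Γ.endpoint_mem e he
      induction e with | _ a b =>
      exact ⟨a, hend a (by simp), (convex_segment a b).isPreconnected.subset_connectedComponentIn
        (left_mem_segment _ _ _) hsub (openSegment_subset_segment _ _ _ h)⟩)
  exact ⟨Γ', h1, h2, by omega⟩

/-! ### Sectors and the shape of a face at a vertex -/

/-- The open sector of directions between the angles `α` and `β`, with apex `0`. -/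
def sector (α β : ℝ) : Set ℂ := Complex.exp '' {w | α < w.im ∧ w.im < β}

theorem isOpen_sector (α β : ℝ) : IsOpen (sector α β) := by
  refine Complex.isOpenMap_exp _ ?_
  exact (isOpen_lt continuous_const Complex.continuous_im).inter
    (isOpen_lt Complex.continuous_im continuous_const)

theorem exp_log_mul {s : ℝ} (hs : 0 < s) (θ : ℝ) :
    (s : ℂ) * Complex.exp (θ * Complex.I) = Complex.exp (⟨Real.log s, θ⟩ : ℂ) := by
  have : (⟨Real.log s, θ⟩ : ℂ) = (Real.log s : ℂ) + θ * Complex.I := by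
    apply Complex.ext <;> simp
  rw [this, Complex.exp_add, ← Complex.ofReal_exp, Real.exp_log hs]

theorem mem_sector {α β : ℝ} {z : ℂ} : z ∈ sector α β ↔
    ∃ s θ : ℝ, 0 < s ∧ α < θ ∧ θ < β ∧ z = s * Complex.exp (θ * Complex.I) := by
  constructor
  · rintro ⟨w, ⟨h1, h2⟩, rfl⟩
    refine ⟨Real.exp w.re, w.im, Real.exp_pos _, h1, h2, ?_⟩
    rw [exp_log_mul (Real.exp_pos _), Real.log_exp]
  · rintro ⟨s, θ, hs, h1, h2, rfl⟩
    exact ⟨⟨Real.log s, θ⟩, ⟨h1, h2⟩, (exp_log_mul hs θ).symm⟩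

theorem isPreconnected_sector_inter_ball (α β r : ℝ) :
    IsPreconnected {z | z ∈ sector α β ∧ ‖z‖ < r} := by
  rcases le_or_gt r 0 with hr | hr
  · convert isPreconnected_empty
    ext z
    simp only [Set.mem_ofPred_eq, Set.mem_empty_iff_false, iff_false, not_and, not_lt]
    exact fun _ => hr.trans (norm_nonneg z)
  · have : {z | z ∈ sector α β ∧ ‖z‖ < r} =
        Complex.exp '' {w | (α < w.im ∧ w.im < β) ∧ w.re < Real.log r} := by
      ext z
      constructor
      · rintro ⟨⟨w, hw, rfl⟩, hz⟩
        refine ⟨w, ⟨hw, ?_⟩, rfl⟩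
        rw [Complex.norm_exp] at hz
        exact (Real.lt_log_iff_exp_lt hr).2 hz
      · rintro ⟨w, ⟨hw, hwr⟩, rfl⟩
        refine ⟨⟨w, hw, rfl⟩, ?_⟩
        rw [Complex.norm_exp]
        exact (Real.lt_log_iff_exp_lt hr).1 hwr
    rw [this]
    refine (Convex.isPreconnected ?_).image _ Complex.continuous_exp.continuousOn
    exact ((convex_halfSpace_im_gt α).inter (convex_halfSpace_im_lt β)).inter
      (convex_halfSpace_re_lt _)

theorem exp_mul_I_inj {s t θ φ : ℝ} (hs : 0 < s) (ht : 0 < t) (h1 : θ - φ < 2 * Real.pi)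
    (h2 : φ - θ < 2 * Real.pi)
    (h : (s : ℂ) * Complex.exp (θ * Complex.I) = t * Complex.exp (φ * Complex.I)) : θ = φ := by
  rw [exp_log_mul hs, exp_log_mul ht, Complex.exp_eq_exp_iff_exists_int] at h
  obtain ⟨n, hn⟩ := h
  have him := congrArg Complex.im hn
  simp only [Complex.add_im, Complex.mul_im, Complex.intCast_re, Complex.intCast_im,
    Complex.mul_re, Complex.re_ofNat, Complex.im_ofNat, Complex.ofReal_re, Complex.ofReal_im,
    Complex.I_re, Complex.I_im] at him
  have him' : θ = φ + n * (2 * Real.pi) := by linarith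
  have hpi := Real.pi_pos
  have hn1 : n < 1 := by
    by_contra! hcon
    have : (1 : ℝ) ≤ n := by exact_mod_cast hcon
    nlinarith
  have hn2 : -1 < n := by
    by_contra! hcon
    have : (n : ℝ) ≤ -1 := by exact_mod_cast hcon
    nlinarith
  have : n = 0 := by omega
  rw [him', this]
  simp

theorem disjoint_sector {α β γ : ℝ} (h : γ ≤ α + 2 * Real.pi) :
    Disjoint (sector α β) (sector β γ) := by
  rw [Set.disjoint_left]
  intro z h1 h2
  obtain ⟨s, θ, hs, hθ1, hθ2, rfl⟩ := mem_sector.1 h1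
  obtain ⟨t, φ, ht, hφ1, hφ2, heq⟩ := mem_sector.1 h2
  have := exp_mul_I_inj hs ht (by linarith [Real.pi_pos]) (by linarith) heq
  linarith

theorem exists_angle (z : ℂ) (α : ℝ) :
    ∃ θ : ℝ, α ≤ θ ∧ θ < α + 2 * Real.pi ∧ z = ‖z‖ * Complex.exp (θ * Complex.I) := by
  refine ⟨toIcoMod Real.two_pi_pos α z.arg, left_le_toIcoMod _ _ _, toIcoMod_lt_right _ _ _, ?_⟩
  have hm := toIcoMod_add_toIcoDiv_zsmul Real.two_pi_pos α z.arg
  generalize toIcoMod Real.two_pi_pos α z.arg = m at hm ⊢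
  generalize toIcoDiv Real.two_pi_pos α z.arg = n at hm
  have h1 : ((z.arg : ℝ) : ℂ) * Complex.I = m * Complex.I + n * (2 * Real.pi * Complex.I) := by
    rw [← hm]
    push_cast [zsmul_eq_mul]
    ring
  have h2 := Complex.norm_mul_exp_arg_mul_I z
  rw [h1, Complex.exp_add, Complex.exp_int_mul_two_pi_mul_I, mul_one] at h2
  exact h2.symm

/-- A direction which does not belong to a finite nonempty set of directions lies in a sector
between two of these directions which contains none of them. -/
theorem exists_sector {D : Finset ℂ} (hD : D.Nonempty) (hD1 : ∀ d ∈ D, ‖d‖ = 1) {θ : ℝ}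
    (hθ : Complex.exp (θ * Complex.I) ∉ D) :
    ∃ α β : ℝ, α < θ ∧ θ < β ∧ β ≤ α + 2 * Real.pi ∧ Complex.exp (α * Complex.I) ∈ D ∧
      Complex.exp (β * Complex.I) ∈ D ∧
      ∀ φ : ℝ, α < φ → φ < β → Complex.exp (φ * Complex.I) ∉ D := by
  classical
  have hang : ∀ d ∈ D, ∃ φ : ℝ, θ < φ ∧ φ < θ + 2 * Real.pi ∧ Complex.exp (φ * Complex.I) = d := by
    intro d hd
    obtain ⟨φ, h1, h2, h3⟩ := exists_angle d θ
    rw [hD1 d hd, Complex.ofReal_one, one_mul] at h3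
    refine ⟨φ, h1.lt_of_ne ?_, h2, h3.symm⟩
    rintro rfl
    exact hθ (h3 ▸ hd)
  choose! A hA1 hA2 hA3 using hang
  -- With all angles measured in `(θ, θ + 2π)`, the least one gives `β` and the greatest one, turned
  -- back by `2π`, gives `α`; a single direction yields the slit `β = α + 2π`.
  obtain ⟨b, hb, hbmin⟩ := D.exists_min_image A hD
  obtain ⟨a, ha, hamax⟩ := D.exists_max_image A hD
  have hshift : ∀ φ : ℝ, Complex.exp ((φ - 2 * Real.pi : ℝ) * Complex.I) =
      Complex.exp (φ * Complex.I) := by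
    intro φ
    have : ((φ - 2 * Real.pi : ℝ) : ℂ) * Complex.I = φ * Complex.I - 2 * Real.pi * Complex.I := by
      push_cast; ring
    rw [this, Complex.exp_sub, Complex.exp_two_pi_mul_I, div_one]
  refine ⟨A a - 2 * Real.pi, A b, by linarith [hA2 a ha], hA1 b hb, by linarith [hbmin a ha], ?_,
    by rw [hA3 b hb]; exact hb, ?_⟩
  · rw [hshift, hA3 a ha]
    exact ha
  · intro φ h1 h2 hφ
    have e1 := hbmin _ hφ
    have e2 := hamax _ hφ
    have e3 := hA3 _ hφ
    have := exp_mul_I_inj (s := 1) (t := 1) one_pos one_pos (θ := A _) (φ := φ)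
      (by linarith) (by linarith) (by rw [e3])
    linarith

theorem exists_cone_angle {r : ℝ} {z x : ℂ} (hz : z ≠ x) (hzr : dist z x < r) (α : ℝ) :
    ∃ s θ : ℝ, 0 < s ∧ s < r ∧ α ≤ θ ∧ θ < α + 2 * Real.pi ∧
      z = x + s * Complex.exp (θ * Complex.I) := by
  obtain ⟨θ, h1, h2, h3⟩ := exists_angle (z - x) α
  rw [dist_eq_norm] at hzr
  exact ⟨‖z - x‖, θ, norm_pos_iff.2 (sub_ne_zero.2 hz), hzr, h1, h2, by linear_combination h3⟩

/-- The face structure at a vertex. -/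
theorem exists_unique_sector {K Ω : Set ℂ} {x : ℂ} {r : ℝ} {D : Finset ℂ} (hΩ : IsBoundedComplComponent K Ω)
    (hD1 : ∀ d ∈ D, ‖d‖ = 1) (hDn : D.Nonempty)
    (hcone : ∀ s : ℝ, 0 < s → s < r → ∀ u : ℂ, ‖u‖ = 1 → (x + s * u ∈ K ↔ u ∈ D))
    (hxK : x ∈ K) (hr : 0 < r) (hx : x ∈ closure Ω) :
    ∃ α β : ℝ, α < β ∧ β ≤ α + 2 * Real.pi ∧ Complex.exp (α * Complex.I) ∈ D ∧
      Complex.exp (β * Complex.I) ∈ D ∧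
      (∀ φ : ℝ, α < φ → φ < β → Complex.exp (φ * Complex.I) ∉ D) ∧
      (∀ z ∈ sector α β, ‖z‖ < r → x + z ∈ Ω) ∧
      ∀ N : Set ℂ, N ∈ 𝓝 x → N ⊆ Metric.ball x r → IsPreconnected (N ∩ Ω) →
        ∀ z ∈ N ∩ Ω, z - x ∈ sector α β := by
  have hΩK := IsFace.subset_compl hΩ
  obtain ⟨z, hzΩ, hz⟩ := Metric.mem_closure_iff.1 hx r hr
  rw [dist_comm] at hz
  have hzx : z ≠ x := fun h => hΩK hzΩ (h ▸ hxK)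
  obtain ⟨s, θ, hs, hsr, -, -, rfl⟩ := exists_cone_angle hzx hz 0
  have hexp : ∀ φ : ℝ, ‖Complex.exp (φ * Complex.I)‖ = 1 := Complex.norm_exp_ofReal_mul_I
  have hθD : Complex.exp (θ * Complex.I) ∉ D := fun h =>
    hΩK hzΩ ((hcone s hs hsr _ (hexp θ)).2 h)
  obtain ⟨α, β, h1, h2, h3, h4, h5, h6⟩ := exists_sector hDn hD1 hθD
  have hT : ∀ z ∈ sector α β, ‖z‖ < r → x + z ∈ Ω := by
    have hpre : IsPreconnected ((fun z => x + z) '' {z | z ∈ sector α β ∧ ‖z‖ < r}) :=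
      (isPreconnected_sector_inter_ball α β r).image _ (by fun_prop)
    have hsub : (fun z => x + z) '' {z | z ∈ sector α β ∧ ‖z‖ < r} ⊆ Ω := by
      refine IsFace.subset_of_meets hΩ hpre ?_
        ⟨s * Complex.exp (θ * Complex.I), ⟨mem_sector.2 ⟨s, θ, hs, h1, h2, rfl⟩, ?_⟩, rfl⟩ hzΩ
      · rintro _ ⟨w, ⟨hw, hwr⟩, rfl⟩ hwK
        obtain ⟨t, φ, ht, hφ1, hφ2, rfl⟩ := mem_sector.1 hw
        refine h6 φ hφ1 hφ2 ((hcone t ht ?_ _ (hexp φ)).1 hwK)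
        rwa [norm_mul, hexp, mul_one, Complex.norm_real, Real.norm_of_nonneg ht.le] at hwr
      · rwa [norm_mul, hexp, mul_one, Complex.norm_real, Real.norm_of_nonneg hs.le]
    exact fun z hz hzr => hsub ⟨z, ⟨hz, hzr⟩, rfl⟩
  refine ⟨α, β, h1.trans h2, h3, h4, h5, h6, hT, ?_⟩
  intro N hN hNr hpre
  have hopen : ∀ a b, IsOpen ((fun z : ℂ => z - x) ⁻¹' sector a b) := fun a b =>
    (isOpen_sector a b).preimage (by fun_prop)
  suffices hsuff : N ∩ Ω ⊆ (fun z : ℂ => z - x) ⁻¹' sector α β from fun z hz => hsuff hz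
  -- `N ∩ Ω` avoids both boundary rays, so it is covered by the sector and its opposite sector;
  -- being connected and meeting the first one, it stays there.
  refine hpre.subset_left_of_subset_union (hopen α β) (hopen β (α + 2 * Real.pi))
    ((disjoint_sector le_rfl).preimage _) ?_ ?_
  · rintro z ⟨hzN, hz⟩
    have hzx : z ≠ x := fun h => hΩK hz (h ▸ hxK)
    obtain ⟨t, φ, ht, htr, hφ1, hφ2, rfl⟩ := exists_cone_angle hzx (hNr hzN) α
    have hφD : Complex.exp (φ * Complex.I) ∉ D := fun h =>
      hΩK hz ((hcone t ht htr _ (hexp φ)).2 h)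
    have hφα : α ≠ φ := by rintro rfl; exact hφD h4
    simp only [Set.mem_union, Set.mem_preimage, add_sub_cancel_left]
    rcases lt_trichotomy φ β with h | h | h
    · exact Or.inl (mem_sector.2 ⟨t, φ, ht, hφ1.lt_of_ne hφα, h, rfl⟩)
    · exact absurd h5 (h ▸ hφD)
    · exact Or.inr (mem_sector.2 ⟨t, φ, ht, h, hφ2, rfl⟩)
  · obtain ⟨ε, hε, hball⟩ := Metric.mem_nhds_iff.1 hN
    set t := min ε r / 2 with ht
    have hm := lt_min hε hr
    have ht0 : 0 < t := by positivity
    have hnorm : ‖(t : ℂ) * Complex.exp (θ * Complex.I)‖ = t := by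
      rw [norm_mul, hexp, mul_one, Complex.norm_real, Real.norm_of_nonneg ht0.le]
    have hsec : (t : ℂ) * Complex.exp (θ * Complex.I) ∈ sector α β :=
      mem_sector.2 ⟨t, θ, ht0, h1, h2, rfl⟩
    refine ⟨x + t * Complex.exp (θ * Complex.I), ⟨hball ?_, hT _ hsec ?_⟩, ?_⟩
    · rw [Metric.mem_ball, dist_eq_norm, add_sub_cancel_left, hnorm]
      linarith [min_le_left ε r]
    · rw [hnorm]
      linarith [min_le_right ε r]
    · simpa using hsec

theorem PSLG.exists_edge_of_isRay (Γ : PSLG) {x d : ℂ} (hx : x ∈ Γ.verts) (hd : ‖d‖ = 1)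
    (h : IsRay Γ.carrier x d) :
    ∃ y, s(x, y) ∈ Γ.edges ∧ x ≠ y ∧ d = (y - x) / ‖y - x‖ := by
  rw [Γ.carrier_eq] at h
  have hc1 : ∀ v ∈ Γ.verts, HasCone ({v} : Set ℂ) x := fun v _ => by
    simpa using hasCone_segment v v x
  have hc2 : ∀ e ∈ Γ.edges, HasCone (closedEdge e) x := fun e _ => by
    induction e with | _ a b => exact hasCone_segment a b x
  rcases h.or_of_union hd (HasCone.biUnion hc1) with h | h
  · obtain ⟨v, -, h⟩ := h.exists_of_biUnion hd hc1
    obtain ⟨r, hr, h⟩ := h.exists_pos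
    have e1 := h (r / 2) (by positivity) (by linarith)
    have e2 := h (r / 3) (by positivity) (by linarith)
    simp only [Set.mem_singleton_iff] at e1 e2
    have e3 : ((r / 2 - r / 3 : ℝ) : ℂ) * d = 0 := by
      push_cast at e1 e2 ⊢
      linear_combination e1 - e2
    rcases mul_eq_zero.1 e3 with h | h
    · have : r / 2 - r / 3 = 0 := by exact_mod_cast h
      linarith
    · rw [h, norm_zero] at hd
      exact absurd hd zero_ne_one
  · obtain ⟨e, he, h⟩ := h.exists_of_biUnion hd hc2
    have hxe : x ∈ e := by
      rcases mem_closedEdge.1 (h.mem (isCompact_closedEdge e).isClosed) with h' | h'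
      · exact h'
      · exact absurd h' (Γ.vertex_notMem e he x hx)
    obtain ⟨y, rfl⟩ := Sym2.mem_iff_exists.1 hxe
    have hne : x ≠ y := by simpa using Γ.not_isDiag _ he
    refine ⟨y, he, hne, ?_⟩
    rcases IsRay.eq_of_segment hne hd h with ⟨h, -⟩ | ⟨-, h⟩
    · exact h
    · exact absurd rfl h

theorem isRay_segment {x y : ℂ} (h : x ≠ y) :
    IsRay (openSegment ℝ x y) x ((y - x) / ‖y - x‖) := by
  have hpos : 0 < ‖y - x‖ := norm_pos_iff.2 (sub_ne_zero.2 h.symm)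
  refine eventually_nhdsGT_zero_iff.2 ⟨‖y - x‖, hpos, fun s hs hsr =>
    mem_openSegment_complex.2 ⟨s / ‖y - x‖, by positivity, by rwa [div_lt_one hpos], ?_⟩⟩
  push_cast
  ring

theorem PSLG.edge_unique (Γ : PSLG) {x y y' : ℂ} (h : s(x, y) ∈ Γ.edges) (h' : s(x, y') ∈ Γ.edges)
    (hd : (y - x) / (‖y - x‖ : ℂ) = (y' - x) / ‖y' - x‖) : y = y' := by
  have hne : x ≠ y := by simpa using Γ.not_isDiag _ h
  have hne' : x ≠ y' := by simpa using Γ.not_isDiag _ h'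
  have h1 := isRay_segment hne
  have h2 := isRay_segment hne'
  rw [← hd] at h2
  obtain ⟨r, hr, hh⟩ := (h1.and h2 : ∀ᶠ s : ℝ in 𝓝[>] 0, _) |> eventually_nhdsGT_zero_iff.1
  have := hh (r / 2) (by positivity) (by linarith)
  have := Γ.eq_of_mem_openEdge h h' this.1 this.2
  exact Sym2.congr_right.1 this

/-- The component of the vector `w` orthogonal to `u`. -/
def crs (u w : ℂ) : ℝ := u.re * w.im - u.im * w.re

theorem crs_eq_dot (u w : ℂ) : crs u w = dot w (Complex.I * u) := by
  simp [crs, dot]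
  ring

theorem convex_lt_dot (a n : ℂ) (c : ℝ) : Convex ℝ {z | c < dot (z - a) n} := by
  have h := convex_halfSpace_gt (𝕜 := ℝ) (f := fun z : ℂ => dot z n)
    ⟨fun x y => dot_add_left x y n, fun t x => by
      rw [Complex.real_smul, dot_smul_left, smul_eq_mul]⟩ (c + dot a n)
  have e : {z | c < dot (z - a) n} = {z | c + dot a n < dot z n} := by
    ext z
    simp only [Set.mem_ofPred_eq, dot_sub_left]
    constructor <;> intro h <;> linarith
  rw [e]
  exact h

theorem convex_dot_lt (a n : ℂ) (c : ℝ) : Convex ℝ {z | dot (z - a) n < c} := by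
  have e : {z | dot (z - a) n < c} = {z | -c < dot (z - a) (-n)} := by
    ext z
    simp only [Set.mem_ofPred_eq, dot_neg_right]
    constructor <;> intro h <;> linarith
  rw [e]
  exact convex_lt_dot a (-n) (-c)

theorem eq_dot_smul_of_crs_eq_zero {u w : ℂ} (hu : ‖u‖ = 1) (h : crs u w = 0) :
    w = dot u w * u := by
  have hu2 := dot_self u
  rw [hu] at hu2
  simp only [dot, crs] at *
  apply Complex.ext
  · simp only [Complex.re_ofReal_mul]
    linear_combination -w.re * hu2 - u.im * h
  · simp only [Complex.im_ofReal_mul]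
    linear_combination -w.im * hu2 + u.re * h

/-- Near an inner point of the edge the graph is a line, so a face adherent to that point contains a
whole half-disc there. The adherent points of the edge are therefore relatively open, and they are
closed. -/
theorem PSLG.openEdge_subset_frontier (Γ : PSLG) {Ω : Set ℂ} (hΩ : Γ.IsFace Ω) {e : Sym2 ℂ}
    (he : e ∈ Γ.edges) {z : ℂ} (hz : z ∈ openEdge e) (hzΩ : z ∈ closure Ω) :
    openEdge e ⊆ frontier Ω := by
  have hopen := IsFace.isOpen Γ.isClosed_carrier hΩ
  have hΩK := IsFace.subset_compl hΩ
  have heK : openEdge e ⊆ Γ.carrier := fun w hw => Γ.mem_carrier.2 (Or.inr ⟨e, he, hw⟩)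
  have hconn : IsPreconnected (openEdge e) := by
    induction e with | _ a b => exact (convex_openSegment a b).isPreconnected
  have hloc : ∀ y ∈ openEdge e, y ∈ closure Ω → y ∈ interior (closure Ω ∪ (openEdge e)ᶜ) := by
    intro y hy hyΩ
    rw [mem_interior_iff_mem_nhds]
    obtain ⟨u, hu, h⟩ := Γ.exists_isLineNear (heK hy) (fun h => Γ.vertex_notMem e he y h hy)
      isClosed_empty (Set.notMem_empty y)
    rw [Set.empty_union] at h
    obtain ⟨r, hr, h⟩ := h
    obtain ⟨z₀, hz₀, hz₀r⟩ := Metric.mem_closure_iff.1 hyΩ r hr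
    rw [dist_comm] at hz₀r
    -- The sign is chosen so that the nearby point `z₀` of the face is on the positive side.
    have hside : ∃ u' : ℂ, ‖u'‖ = 1 ∧ (u' = u ∨ u' = -u) ∧ 0 < crs u' (z₀ - y) := by
      rcases lt_trichotomy 0 (crs u (z₀ - y)) with h' | h' | h'
      · exact ⟨u, hu, Or.inl rfl, h'⟩
      · refine absurd ((h z₀ hz₀r).2 ⟨dot u (z₀ - y), ?_⟩) (hΩK hz₀)
        rw [← eq_dot_smul_of_crs_eq_zero hu h'.symm]
        ring
      · refine ⟨-u, by rwa [norm_neg], Or.inr rfl, ?_⟩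
        simp only [crs, Complex.neg_re, Complex.neg_im] at h' ⊢
        linarith
    obtain ⟨u', -, huu', hpos⟩ := hside
    have hline : ∀ t : ℝ, ∀ w : ℂ, w = y + t * u → crs u' (w - y) = 0 := by
      rintro t w rfl
      rcases huu' with rfl | rfl <;>
      · simp only [crs, add_sub_cancel_left, Complex.re_ofReal_mul, Complex.im_ofReal_mul,
          Complex.neg_re, Complex.neg_im]
        ring
    have hH : {w | dist w y < r ∧ 0 < crs u' (w - y)} ⊆ Ω := by
      refine IsFace.subset_of_meets hΩ (Convex.isPreconnected ?_) ?_ ⟨hz₀r, hpos⟩ hz₀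
      · refine (convex_ball y r).inter ?_
        have := convex_lt_dot y (Complex.I * u') 0
        simp only [← crs_eq_dot] at this
        exact this
      · rintro w ⟨hw1, hw2⟩ hwK
        obtain ⟨t, ht⟩ := (h w hw1).1 hwK
        rw [hline t w ht] at hw2
        exact lt_irrefl _ hw2
    filter_upwards [Metric.ball_mem_nhds y hr] with w hw
    by_cases hwe : w ∈ openEdge e
    · left
      obtain ⟨t, ht⟩ := (h w hw).1 (heK hwe)
      have h0 := hline t w ht
      have hseg : openSegment ℝ w z₀ ⊆ Ω := by
        intro p hp
        refine hH ⟨(convex_ball y r).openSegment_subset hw hz₀r hp, ?_⟩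
        obtain ⟨s, hs0, hs1, rfl⟩ := mem_openSegment_complex.1 hp
        have : crs u' (w + s * (z₀ - w) - y) = (1 - s) * crs u' (w - y) + s * crs u' (z₀ - y) := by
          simp only [crs, Complex.add_re, Complex.add_im, Complex.sub_re,
            Complex.sub_im, Complex.re_ofReal_mul, Complex.im_ofReal_mul]
          ring
        rw [this, h0]
        have := mul_pos hs0 hpos
        linarith
      have := closure_mono hseg
      rw [closure_openSegment] at this
      exact this (left_mem_segment _ _ _)
    · exact Or.inr hwe
  have hcl : openEdge e ⊆ closure Ω := by
    rcases isPreconnected_iff_subset_of_disjoint.1 hconn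
      (interior (closure Ω ∪ (openEdge e)ᶜ)) (closure Ω)ᶜ isOpen_interior
      isClosed_closure.isOpen_compl
      (fun z hz => by
        by_cases hzP : z ∈ closure Ω
        exacts [Or.inl (hloc z hz hzP), Or.inr hzP])
      (by
        rw [Set.eq_empty_iff_forall_notMem]
        rintro z ⟨hze, hz1, hz2⟩
        rcases interior_subset hz1 with h | h
        exacts [hz2 h, h hze]) with h | h
    · intro w hw
      exact (interior_subset (h hw)).resolve_right fun h => h hw
    · exact absurd hzΩ (h hz)
  intro w hw
  rw [hopen.frontier_eq]
  exact ⟨hcl hw, fun h => hΩK h (heK hw)⟩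

/-- A connected set with an isolated point is a single point, and the complement of a point is
connected and unbounded. -/
theorem IsFace.not_isolated {K Ω : Set ℂ} (hΩ : IsBoundedComplComponent K Ω)
    (hKc : IsPreconnected K) {x : ℂ} (hx : x ∈ K) {r : ℝ} (hr : 0 < r)
    (hiso : ∀ z, dist z x < r → z ∈ K → z = x) : False := by
  have hKx : K ⊆ {x} := by
    have hsub : K ⊆ Metric.ball x (r / 2) := by
      refine hKc.subset_left_of_subset_union Metric.isOpen_ball
        (Metric.isClosed_closedBall (x := x) (ε := r / 2)).isOpen_compl ?_ ?_
        ⟨x, hx, Metric.mem_ball_self (by positivity)⟩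
      · exact Set.disjoint_left.2 fun z h1 h2 => h2 (Metric.ball_subset_closedBall h1)
      · intro z hz
        by_cases h : dist z x < r
        · rw [hiso z h hz]
          exact Or.inl (Metric.mem_ball_self (by positivity))
        · exact Or.inr fun h' => h (by rw [Metric.mem_closedBall] at h'; linarith)
    intro z hz
    exact hiso z ((hsub hz).trans (by linarith)) hz
  have hconn : IsPreconnected ({x}ᶜ : Set ℂ) :=
    (isConnected_compl_singleton_of_one_lt_rank (by rw [Complex.rank_real_complex]; norm_num)
      x).isPreconnected
  obtain ⟨z, hz⟩ := IsFace.nonempty hΩ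
  have hzx : z ∈ ({x}ᶜ : Set ℂ) := fun h => IsFace.subset_compl hΩ hz (by rwa [Set.mem_singleton_iff.1 h])
  have hsub := IsFace.subset_of_meets hΩ hconn (Set.compl_subset_compl.2 hKx) hzx hz
  refine NormedSpace.unbounded_univ ℝ ℂ (((hΩ.1.subset hsub).union
    (Bornology.isBounded_singleton (x := x))).subset ?_)
  rw [Set.compl_union_self]

/-- `hloc` makes the face occupy a single sector at `x`, and `htip` says that its two bounding rays
are distinct. These rays give the two neighbors. -/
theorem PSLG.exists_two_neighbors (Γ : PSLG) {Ω : Set ℂ} (hΩ : Γ.IsFace Ω)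
    (hconn : IsPreconnected Γ.carrier) {x : ℂ} (hx : x ∈ Γ.verts) (hxΩ : x ∈ closure Ω)
    (hloc : ∀ ρ : ℝ, 0 < ρ → ∃ N ∈ 𝓝 x, N ⊆ Metric.ball x ρ ∧ IsPreconnected (N ∩ Ω))
    (htip : ∀ α r : ℝ, 0 < r →
      ¬ ∀ z ∈ sector α (α + 2 * Real.pi), ‖z‖ < r → x + z ∈ Ω) :
    ∃ y₁ y₂, y₁ ≠ y₂ ∧ ∀ y, (s(x, y) ∈ Γ.edges ∧ openSegment ℝ x y ⊆ frontier Ω) ↔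
      y = y₁ ∨ y = y₂ := by
  have hxK : x ∈ Γ.carrier := Γ.mem_carrier.2 (Or.inl hx)
  obtain ⟨r, hr, D, hD1, hcone⟩ := Γ.hasCone_carrier x
  have hDn : D.Nonempty := by
    by_contra hcon
    rw [Finset.not_nonempty_iff_eq_empty] at hcon
    refine IsFace.not_isolated hΩ hconn hxK hr fun z hz hzK => ?_
    by_contra hzx
    obtain ⟨s, θ, hs, hsr, -, -, rfl⟩ := exists_cone_angle hzx hz 0
    have := (hcone s hs hsr _ (Complex.norm_exp_ofReal_mul_I θ)).1 hzK
    simp [hcon] at this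
  obtain ⟨α, β, hαβ, hβ2, hαD, hβD, hfree, hsec, huniq⟩ :=
    exists_unique_sector hΩ hD1 hDn hcone hxK hr hxΩ
  have hβlt : β < α + 2 * Real.pi := by
    refine hβ2.lt_of_ne ?_
    rintro rfl
    exact htip α r hr hsec
  have hray : ∀ d ∈ D, ∃ y, s(x, y) ∈ Γ.edges ∧ x ≠ y ∧ d = (y - x) / ‖y - x‖ := fun d hd =>
    Γ.exists_edge_of_isRay hx (hD1 d hd)
      (eventually_nhdsGT_zero_iff.2 ⟨r, hr, fun s h1 h2 => (hcone s h1 h2 d (hD1 d hd)).2 hd⟩)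
  have hfront : ∀ θ ∈ Set.Icc α β, ∀ y, s(x, y) ∈ Γ.edges → x ≠ y →
      Complex.exp (θ * Complex.I) = (y - x) / ‖y - x‖ → openSegment ℝ x y ⊆ frontier Ω := by
    intro θ hθ y hy hxy hd
    obtain ⟨r', hr', h⟩ := (isRay_segment hxy).exists_pos
    rw [← hd] at h
    set s := min r r' / 2 with hs
    have hm := lt_min hr hr'
    have hs0 : 0 < s := by positivity
    have hs1 : s < r := by linarith [min_le_left r r']
    have hs2 : s < r' := by linarith [min_le_right r r']
    refine Γ.openEdge_subset_frontier hΩ hy (h s hs0 hs2) ?_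
    have hc : Continuous fun φ : ℝ => x + s * Complex.exp (φ * Complex.I) := by fun_prop
    have hmem : θ ∈ closure (Set.Ioo α β) := by rwa [closure_Ioo hαβ.ne]
    refine closure_minimal (s := Set.Ioo α β) ?_ (isClosed_closure.preimage hc) hmem
    intro φ hφ
    refine subset_closure (hsec _ (mem_sector.2 ⟨s, φ, hs0, hφ.1, hφ.2, rfl⟩) ?_)
    rwa [norm_mul, Complex.norm_exp_ofReal_mul_I, mul_one, Complex.norm_real,
      Real.norm_of_nonneg hs0.le]
  obtain ⟨y₁, h11, h12, h13⟩ := hray _ hαD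
  obtain ⟨y₂, h21, h22, h23⟩ := hray _ hβD
  refine ⟨y₁, y₂, ?_, ?_⟩
  · rintro rfl
    have := exp_mul_I_inj (s := 1) (t := 1) one_pos one_pos (θ := α) (φ := β)
      (by linarith [Real.pi_pos]) (by linarith) (by rw [h13, ← h23])
    linarith
  · intro y
    constructor
    · rintro ⟨hy, hyΩ⟩
      have hxy : x ≠ y := by simpa using Γ.not_isDiag _ hy
      obtain ⟨N, hN, hNr, hNc⟩ := hloc r hr
      have huniq := huniq N hN hNr hNc
      have hray := isRay_segment hxy
      set d := (y - x) / (‖y - x‖ : ℂ) with hd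
      have hd1 : ‖d‖ = 1 := by
        have : ‖y - x‖ ≠ 0 := norm_ne_zero_iff.2 (sub_ne_zero.2 hxy.symm)
        simp [hd, this]
      obtain ⟨r', hr', h⟩ := hray.exists_pos
      obtain ⟨ε, hε, hball⟩ := Metric.mem_nhds_iff.1 hN
      set s := min (min r r') ε / 2 with hs
      have hm := lt_min (lt_min hr hr') hε
      have hs0 : 0 < s := by positivity
      have hs1 : s < r := by linarith [min_le_left r r', min_le_left (min r r') ε]
      have hs2 : s < r' := by linarith [min_le_right r r', min_le_left (min r r') ε]
      have hs3 : s < ε := by linarith [min_le_right (min r r') ε]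
      have hz := h s hs0 hs2
      have hzK : x + s * d ∈ Γ.carrier := Γ.mem_carrier.2 (Or.inr ⟨_, hy, hz⟩)
      have hdD := (hcone s hs0 hs1 d hd1).1 hzK
      have hzcl : x + s * d ∈ closure Ω := frontier_subset_closure (hyΩ hz)
      have hzball : x + s * d ∈ Metric.ball x ε := by
        rw [Metric.mem_ball, dist_eq_norm, add_sub_cancel_left, norm_mul, hd1, mul_one,
          Complex.norm_real, Real.norm_of_nonneg hs0.le]
        exact hs3
      obtain ⟨θ, hθ1, hθ2, hθ⟩ := exists_angle d α
      rw [hd1, Complex.ofReal_one, one_mul] at hθ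
      rcases hθ1.eq_or_lt with h1 | h1
      · left
        refine Γ.edge_unique hy h11 ?_
        rw [← hd, ← h13, hθ, h1]
      rcases lt_trichotomy θ β with h2 | h2 | h2
      · exact absurd (hθ ▸ hdD) (hfree θ h1 h2)
      · right
        refine Γ.edge_unique hy h21 ?_
        rw [← hd, ← h23, hθ, h2]
      -- An edge in the opposite open sector would have points of the face close to it there,
      -- contrary to the uniqueness of the sector.
      · exfalso
        have hO : IsOpen ((fun z : ℂ => z - x) ⁻¹' sector β (α + 2 * Real.pi)) :=
          (isOpen_sector _ _).preimage (by fun_prop)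
        obtain ⟨w, ⟨hw1, hw2⟩, hwΩ⟩ := mem_closure_iff.1 hzcl _ (hO.inter Metric.isOpen_ball)
          ⟨by
            rw [Set.mem_preimage, add_sub_cancel_left, hθ]
            exact mem_sector.2 ⟨s, θ, hs0, h2, hθ2, rfl⟩, hzball⟩
        exact Set.disjoint_left.1 (disjoint_sector le_rfl) (huniq w ⟨hball hw2, hwΩ⟩) hw1
    · rintro (rfl | rfl)
      · exact ⟨h11, hfront α ⟨le_rfl, hαβ.le⟩ _ h11 h12 h13⟩
      · exact ⟨h21, hfront β ⟨hαβ.le, le_rfl⟩ _ h21 h22 h23⟩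

/-! ### The boundary of a face as a simple polygon -/

/-- The graph on the vertices of `Γ` formed by the edges in the boundary of `Ω`. -/
def PSLG.boundaryGraph (Γ : PSLG) (Ω : Set ℂ) : SimpleGraph Γ.verts where
  Adj a b := s((a : ℂ), (b : ℂ)) ∈ Γ.edges ∧ openSegment ℝ (a : ℂ) b ⊆ frontier Ω
  symm := ⟨fun a b h => by rwa [Sym2.eq_swap, openSegment_symm]⟩
  loopless := ⟨fun a h => Γ.not_isDiag _ h.1 (by simp)⟩

theorem PSLG.boundaryGraph_adj (Γ : PSLG) (Ω : Set ℂ) (a b : Γ.verts) :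
    (Γ.boundaryGraph Ω).Adj a b ↔
      s((a : ℂ), (b : ℂ)) ∈ Γ.edges ∧ openSegment ℝ (a : ℂ) b ⊆ frontier Ω := Iff.rfl

/-- A cycle of edges of a planar straight line graph is a simple polygon. -/
theorem PSLG.exists_polygon (Γ : PSLG) (G : SimpleGraph Γ.verts)
    (hG : ∀ a b, G.Adj a b → s((a : ℂ), (b : ℂ)) ∈ Γ.edges) {v : Γ.verts} (p : G.Walk v v)
    (hp : p.IsCycle) :
    ∃ (k : ℕ) (P : Polygon ℂ k), P.IsSimpleClosed ∧
      P.boundary ℝ = ⋃ i ∈ Finset.range p.length,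
        segment ℝ (p.getVert i : ℂ) (p.getVert (i + 1)) := by
  have h3 := hp.three_le_length
  let P : Polygon ℂ p.length := ⟨fun i => (p.getVert i : ℂ)⟩
  have hrot : ∀ i : Fin p.length, P (finRotate p.length i) = (p.getVert (i + 1) : ℂ) := by
    intro i
    change ((p.getVert ((finRotate p.length i : Fin p.length) : ℕ) : Γ.verts) : ℂ) = _
    have := i.neZero
    rw [finRotate_apply]
    rcases Nat.lt_or_ge (i.1 + 1) p.length with h | h
    · rw [Fin.val_add_one_of_lt' h]
    -- The last index wraps around to 0, and the closed walk returns to its start.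
    · have hi : i.1 + 1 = p.length := le_antisymm i.2 h
      have h0 : ((i + 1 : Fin p.length) : ℕ) = 0 := by
        rw [Fin.val_add, Fin.val_one', Nat.mod_eq_of_lt (by omega : 1 < p.length), hi, Nat.mod_self]
      rw [h0, hi, p.getVert_length, p.getVert_zero]
  have hinj : ∀ i j : ℕ, i < p.length → j < p.length → p.getVert i = p.getVert j → i = j :=
    fun i j hi hj h => hp.getVert_injOn' (by simp; omega) (by simp; omega) h
  have hedge : ∀ i : Fin p.length, s((p.getVert i : ℂ), (p.getVert (i + 1) : ℂ)) ∈ Γ.edges :=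
    fun i => hG _ _ (p.adj_getVert_succ i.2)
  refine ⟨p.length, P, ⟨h3, ?_, ?_, ?_⟩, ?_⟩
  · intro i j hij
    exact Fin.ext (hinj i j i.2 j.2 (Subtype.ext hij))
  · intro i j hij
    rw [hrot, hrot]
    refine Γ.disjoint_edges _ (hedge i) _ (hedge j) fun heq => hij ?_
    have hmap : Sym2.map ((↑) : Γ.verts → ℂ) s(p.getVert i, p.getVert (i + 1)) =
        Sym2.map ((↑) : Γ.verts → ℂ) s(p.getVert j, p.getVert (j + 1)) := heq
    have hs := Sym2.map.injective Subtype.coe_injective hmap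
    have hi : i.1 < p.edges.length := by rw [p.length_edges]; exact i.2
    have hj : j.1 < p.edges.length := by rw [p.length_edges]; exact j.2
    rw [← SimpleGraph.Walk.getElem_edges hi, ← SimpleGraph.Walk.getElem_edges hj] at hs
    exact Fin.ext ((hp.edges_nodup.getElem_inj_iff).1 hs)
  · intro i j
    rw [hrot]
    exact Γ.vertex_notMem _ (hedge j) _ (p.getVert i).2
  · ext z
    simp only [Polygon.boundary, Polygon.edgeSet, affineSegment_eq_segment, hrot, Set.mem_iUnion,
      Finset.mem_range, exists_prop]
    constructor
    · rintro ⟨i, hi⟩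
      exact ⟨i, i.2, hi⟩
    · rintro ⟨i, hi, h⟩
      exact ⟨⟨i, hi⟩, h⟩

/-- Non-isolated vertices have degree two here, and a cycle already uses two edges at each of its
vertices, so it uses all of them. -/
theorem SimpleGraph.Walk.IsCycle.mk_mem_edges_of_isCycles {V : Type*} [Finite V] {G : SimpleGraph V}
    (hG : G.IsCycles) {v : V} {p : G.Walk v v} (hp : p.IsCycle) {a b : V} (ha : a ∈ p.support)
    (hab : G.Adj a b) : s(a, b) ∈ p.edges := by
  have h1 := hp.ncard_neighborSet_toSubgraph_eq_two ha
  have h2 := hG (v := a) ⟨b, hab⟩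
  have heq : p.toSubgraph.neighborSet a = G.neighborSet a :=
    Set.eq_of_subset_of_ncard_le (p.toSubgraph.neighborSet_subset a) (by rw [h1, h2])
      (Set.toFinite _)
  have : b ∈ p.toSubgraph.neighborSet a := by rw [heq]; exact hab
  exact SimpleGraph.Walk.adj_toSubgraph_iff_mem_edges.1 this

/-- All degrees in the boundary graph are 0 or 2, so it contains a cycle `A`. The remaining boundary
edges form a closed set `B` disjoint from `A`. The frontier is connected because `Γ` is, so it is
`A`. -/
theorem PSLG.isSimplePolygonalDomain (Γ : PSLG) {Ω : Set ℂ} (hΩ : Γ.IsFace Ω)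
    (hconn : IsPreconnected Γ.carrier)
    (hloc : ∀ x ∈ Γ.verts, ∀ ρ : ℝ, 0 < ρ →
      ∃ N ∈ 𝓝 x, N ⊆ Metric.ball x ρ ∧ IsPreconnected (N ∩ Ω))
    (htip : ∀ x ∈ Γ.verts, ∀ α r : ℝ, 0 < r →
      ¬ ∀ z ∈ sector α (α + 2 * Real.pi), ‖z‖ < r → x + z ∈ Ω) :
    IsSimplePolygonalDomain Ω := by
  classical
  have hK := Γ.isClosed_carrier
  have hopen := IsFace.isOpen hK hΩ
  have hΩK := IsFace.subset_compl hΩ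
  have hfrK := IsFace.frontier_subset hK hΩ
  set G := Γ.boundaryGraph Ω with hGdef
  have htwo : ∀ x : Γ.verts, (x : ℂ) ∈ closure Ω → ∃ y₁ y₂ : Γ.verts, y₁ ≠ y₂ ∧
      G.neighborSet x = {y₁, y₂} := by
    intro x hx
    obtain ⟨y₁, y₂, hne, h⟩ := Γ.exists_two_neighbors hΩ hconn x.2 hx (hloc x x.2) (htip x x.2)
    have hv : ∀ y, (y = y₁ ∨ y = y₂) → y ∈ Γ.verts := fun y hy =>
      Γ.endpoint_mem _ ((h y).2 hy).1 y (by simp)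
    refine ⟨⟨y₁, hv y₁ (Or.inl rfl)⟩, ⟨y₂, hv y₂ (Or.inr rfl)⟩, fun h => hne (Subtype.ext_iff.1 h), ?_⟩
    ext y
    rw [SimpleGraph.mem_neighborSet, hGdef, Γ.boundaryGraph_adj, h]
    simp [Subtype.ext_iff]
  have hadjcl : ∀ a b : Γ.verts, G.Adj a b → segment ℝ (a : ℂ) b ⊆ frontier Ω := by
    intro a b h
    rw [← closure_openSegment]
    exact closure_minimal h.2 isClosed_frontier
  have hcyc : G.IsCycles := by
    rintro x ⟨y, hy⟩
    obtain ⟨y₁, y₂, hne, h⟩ := htwo x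
      (frontier_subset_closure (hadjcl _ _ hy (left_mem_segment _ _ _)))
    rw [h, Set.ncard_pair hne]
  have hcover : ∀ z ∈ frontier Ω, ∃ a b : Γ.verts, G.Adj a b ∧ z ∈ segment ℝ (a : ℂ) b := by
    intro z hz
    rcases Γ.mem_carrier.1 (hfrK hz) with hzV | ⟨e, he, hze⟩
    · obtain ⟨y₁, y₂, -, h⟩ := htwo ⟨z, hzV⟩ (frontier_subset_closure hz)
      exact ⟨⟨z, hzV⟩, y₁, by rw [← SimpleGraph.mem_neighborSet, h]; simp,
        left_mem_segment _ _ _⟩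
    · have hsub := Γ.openEdge_subset_frontier hΩ he hze (frontier_subset_closure hz)
      have hend := Γ.endpoint_mem e he
      induction e with | _ a b =>
      exact ⟨⟨a, hend a (by simp)⟩, ⟨b, hend b (by simp)⟩, ⟨he, hsub⟩,
        openSegment_subset_segment _ _ _ hze⟩
  obtain ⟨ζ, hζ⟩ : (frontier Ω).Nonempty :=
    frontier_nonempty_of_isBounded (IsFace.nonempty hΩ) hΩ.1
  obtain ⟨v, b, hvb, -⟩ := hcover ζ hζ
  obtain ⟨p, hp, -⟩ := hcyc.exists_cycle_toSubgraph_verts_eq_connectedComponentSupp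
    (v := v) (c := G.connectedComponentMk v) rfl ⟨b, hvb⟩
  obtain ⟨k, P, hP, hPb⟩ := Γ.exists_polygon G (fun a b h => h.1) p hp
  set A := ⋃ i ∈ Finset.range p.length, segment ℝ (p.getVert i : ℂ) (p.getVert (i + 1)) with hA
  let B := ⋃ q ∈ (Finset.univ : Finset (Γ.verts × Γ.verts)).filter
    (fun q => G.Adj q.1 q.2 ∧ s(q.1, q.2) ∉ p.edges), segment ℝ (q.1 : ℂ) q.2
  have hAcl : IsClosed A :=
    (Finset.isCompact_biUnion _ fun i _ => isCompact_segment_complex _ _).isClosed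
  have hBcl : IsClosed B :=
    (Finset.isCompact_biUnion _ fun i _ => isCompact_segment_complex _ _).isClosed
  have hmemA : ∀ a b : Γ.verts, s(a, b) ∈ p.edges → segment ℝ (a : ℂ) b ⊆ A := by
    intro a b hab z hz
    obtain ⟨i, hi, heq⟩ := p.mk_mem_edges_iff_exists.1 hab
    refine Set.mem_biUnion (Finset.mem_coe.2 (Finset.mem_range.2 hi)) ?_
    rcases Sym2.eq_iff.1 heq with ⟨h1, h2⟩ | ⟨h1, h2⟩
    · rwa [h1, h2]
    · rwa [h1, h2, segment_symm]
  have hAfr : A ⊆ frontier Ω := by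
    intro z hz
    simp only [hA, Set.mem_iUnion, Finset.mem_range, exists_prop] at hz
    obtain ⟨i, hi, h⟩ := hz
    exact hadjcl _ _ (p.adj_getVert_succ hi) h
  have hAB : frontier Ω ⊆ A ∪ B := by
    intro z hz
    obtain ⟨a, b, hab, h⟩ := hcover z hz
    by_cases hp : s(a, b) ∈ p.edges
    · exact Or.inl (hmemA a b hp h)
    · exact Or.inr (Set.mem_biUnion (x := (a, b)) (by simpa using ⟨hab, hp⟩) h)
  have hdisj : Disjoint A B := by
    rw [Set.disjoint_left]
    intro z hzA hzB
    simp only [hA, Set.mem_iUnion, Finset.mem_range, exists_prop] at hzA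
    obtain ⟨i, hi, hzA⟩ := hzA
    simp only [B, Set.mem_iUnion, Finset.mem_filter, Finset.mem_univ, true_and, exists_prop] at hzB
    obtain ⟨⟨c, d⟩, ⟨hcd, hcdp⟩, hzB⟩ := hzB
    simp only at hcd hcdp hzB
    have hE : s((p.getVert i : ℂ), (p.getVert (i + 1) : ℂ)) ∈ Γ.edges := (p.adj_getVert_succ hi).1
    have hF : s((c : ℂ), (d : ℂ)) ∈ Γ.edges := hcd.1
    have hsupp : ∀ a : Γ.verts, (a = p.getVert i ∨ a = p.getVert (i + 1)) → a ∈ p.support := by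
      rintro a (rfl | rfl) <;> exact p.getVert_mem_support _
    have hzE : z ∈ closedEdge s((p.getVert i : ℂ), (p.getVert (i + 1) : ℂ)) := hzA
    have hzF : z ∈ closedEdge s((c : ℂ), (d : ℂ)) := hzB
    -- An edge outside the cycle cannot share a vertex with it, since the cycle takes every boundary
    -- edge at its vertices.
    have hcase : ∀ a : Γ.verts, (a = p.getVert i ∨ a = p.getVert (i + 1)) →
        (a = c ∨ a = d) → False := by
      rintro a ha (rfl | rfl)
      · exact hcdp (hp.mk_mem_edges_of_isCycles hcyc (hsupp _ ha) hcd)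
      · exact hcdp (by
          rw [Sym2.eq_swap]
          exact hp.mk_mem_edges_of_isCycles hcyc (hsupp _ ha) hcd.symm)
    have hends : z ∈ Γ.verts → False := by
      intro hzV
      have h1 := (mem_closedEdge.1 hzE).resolve_right (Γ.vertex_notMem _ hE z hzV)
      have h2 := (mem_closedEdge.1 hzF).resolve_right (Γ.vertex_notMem _ hF z hzV)
      rw [Sym2.mem_iff] at h1 h2
      exact hcase ⟨z, hzV⟩ (h1.imp Subtype.ext Subtype.ext) (h2.imp Subtype.ext Subtype.ext)
    have h1 := (mem_closedEdge.1 hzE).resolve_left fun h => hends (Γ.endpoint_mem _ hE z h)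
    have h2 := (mem_closedEdge.1 hzF).resolve_left fun h => hends (Γ.endpoint_mem _ hF z h)
    have heq := Γ.eq_of_mem_openEdge hE hF h1 h2
    rcases Sym2.eq_iff.1 heq with ⟨h3, -⟩ | ⟨h3, -⟩
    · exact hcase _ (Or.inl rfl) (Or.inl (Subtype.ext h3))
    · exact hcase _ (Or.inl rfl) (Or.inr (Subtype.ext h3))
  have hfrc : IsPreconnected (frontier Ω) := by
    refine hopen.isPreconnected_frontier_of_compl (IsFace.isPreconnected hΩ) ?_
    obtain ⟨z, hz⟩ := IsFace.nonempty hΩ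
    rw [IsFace.eq_component hΩ hz]
    exact isPreconnected_compl_component hK hconn ⟨v, Γ.mem_carrier.2 (Or.inl v.2)⟩ z
  have hfr : frontier Ω = A := by
    refine Set.Subset.antisymm ?_ hAfr
    rcases (isPreconnected_iff_subset_of_fully_disjoint_closed isClosed_frontier).1 hfrc A B hAcl
      hBcl hAB hdisj with h | h
    · exact h
    · exfalso
      have hvA : (v : ℂ) ∈ A := hmemA v b (hp.mk_mem_edges_of_isCycles hcyc
        p.start_mem_support hvb) (left_mem_segment _ _ _)
      exact Set.disjoint_left.1 hdisj hvA (h (hAfr hvA))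
  obtain ⟨z, hz⟩ := IsFace.nonempty hΩ
  have hΩA : Ω ⊆ Aᶜ := fun w hw hwA => hΩK hw (hfrK (hAfr hwA))
  refine ⟨k, P, hP, hΩ.1, z, ?_, ?_⟩
  · rw [hPb]; exact hΩA hz
  · rw [hPb]
    refine Set.Subset.antisymm ((IsFace.isPreconnected hΩ).subset_connectedComponentIn hz hΩA) ?_
    -- The frontier of `Ω` is exactly the polygon, so no connected set avoiding the polygon can
    -- leave `Ω`.
    exact IsPreconnected.subset_of_frontier_subset hopen hfr.le isPreconnected_connectedComponentIn
      (Set.disjoint_left.2 fun w hw => connectedComponentIn_subset _ _ hw)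
      ⟨z, mem_connectedComponentIn (hΩA hz), hz⟩

/-! ### Regular hexagons -/

/-- The sixth root of unity `exp (iπ/3)`. -/
noncomputable def zeta : ℂ := ⟨1 / 2, √3 / 2⟩

theorem zeta_sq : zeta * zeta = zeta - 1 := by
  have h3 : √3 * √3 = 3 := Real.mul_self_sqrt (by norm_num)
  apply Complex.ext
  · simp only [zeta, Complex.mul_re, Complex.sub_re, Complex.one_re]
    linear_combination (-1 / 4) * h3
  · simp only [zeta, Complex.mul_im, Complex.sub_im, Complex.one_im]
    ring

theorem dot_zeta_mul (z n : ℂ) :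
    dot z (zeta * n) = dot z n / 2 + √3 / 2 * dot z (Complex.I * n) := by
  simp only [zeta, dot, Complex.mul_re, Complex.mul_im, Complex.I_re, Complex.I_im]
  ring

theorem dot_one_sub_zeta_mul (z n : ℂ) :
    dot z ((1 - zeta) * n) = dot z n / 2 - √3 / 2 * dot z (Complex.I * n) := by
  rw [sub_mul, one_mul, dot_sub_right, dot_zeta_mul]
  ring

/-- The unit normals of the sides of a regular hexagon: the sixth roots of unity. -/
noncomputable def hexNormals : Finset ℂ := by
  classical exact {1, -1, zeta, -zeta, 1 - zeta, zeta - 1}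

theorem mem_hexNormals {n : ℂ} : n ∈ hexNormals ↔
    n = 1 ∨ n = -1 ∨ n = zeta ∨ n = -zeta ∨ n = 1 - zeta ∨ n = zeta - 1 := by
  simp [hexNormals]

theorem hexNormals_nonempty : hexNormals.Nonempty := ⟨1, mem_hexNormals.2 (Or.inl rfl)⟩

theorem neg_mem_hexNormals {n : ℂ} (h : n ∈ hexNormals) : -n ∈ hexNormals := by
  rw [mem_hexNormals] at *
  rcases h with rfl | rfl | rfl | rfl | rfl | rfl <;> simp

theorem zeta_mul_mem_hexNormals {n : ℂ} (h : n ∈ hexNormals) : zeta * n ∈ hexNormals := by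
  have hz := zeta_sq
  rw [mem_hexNormals] at *
  rcases h with rfl | rfl | rfl | rfl | rfl | rfl
  · simp
  · simp
  · exact Or.inr (Or.inr (Or.inr (Or.inr (Or.inr hz))))
  · exact Or.inr (Or.inr (Or.inr (Or.inr (Or.inl (by linear_combination -hz)))))
  · exact Or.inl (by linear_combination -hz)
  · exact Or.inr (Or.inl (by linear_combination hz))

theorem one_sub_zeta_mul_mem_hexNormals {n : ℂ} (h : n ∈ hexNormals) :
    (1 - zeta) * n ∈ hexNormals := by
  have h2 := neg_mem_hexNormals (zeta_mul_mem_hexNormals (zeta_mul_mem_hexNormals h))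
  have : (1 - zeta) * n = -(zeta * (zeta * n)) := by linear_combination n * zeta_sq
  rwa [this]

theorem norm_of_mem_hexNormals {n : ℂ} (h : n ∈ hexNormals) : ‖n‖ = 1 := by
  have h3 : √3 * √3 = 3 := Real.mul_self_sqrt (by norm_num)
  have key : ∀ z : ℂ, dot z z = 1 → ‖z‖ = 1 := fun z hz => by
    rw [dot_self] at hz
    exact (pow_eq_one_iff_of_nonneg (norm_nonneg z) two_ne_zero).1 hz
  refine key n ?_
  rw [mem_hexNormals] at h
  rcases h with rfl | rfl | rfl | rfl | rfl | rfl <;>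
    simp only [dot, zeta, Complex.neg_re, Complex.neg_im, Complex.one_re, Complex.one_im,
      Complex.sub_re, Complex.sub_im] <;> linarith

/-- The position of a normal relative to another one. -/
theorem hexNormals_cases {n m : ℂ} (hn : n ∈ hexNormals) (hm : m ∈ hexNormals) :
    m = n ∨ m = -n ∨ m = zeta * n ∨ m = -(zeta * n) ∨ m = (1 - zeta) * n ∨
      m = -((1 - zeta) * n) := by
  have hz := zeta_sq
  have key : ∀ k : ℂ, k ∈ hexNormals → (k = 1 ∨ k = -1 ∨ k = zeta ∨ k = -zeta ∨ k = 1 - zeta ∨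
      k = -(1 - zeta)) := fun k hk => by
    rw [mem_hexNormals] at hk
    simpa using hk
  have hinv : ∃ k ∈ hexNormals, n * k = 1 := by
    rcases key n hn with rfl | rfl | rfl | rfl | rfl | rfl
    · exact ⟨1, mem_hexNormals.2 (by simp), by ring⟩
    · exact ⟨-1, mem_hexNormals.2 (by simp), by ring⟩
    · exact ⟨1 - zeta, mem_hexNormals.2 (by simp), by linear_combination -hz⟩
    · exact ⟨zeta - 1, mem_hexNormals.2 (by simp), by linear_combination -hz⟩
    · exact ⟨zeta, mem_hexNormals.2 (by simp), by linear_combination -hz⟩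
    · exact ⟨-zeta, mem_hexNormals.2 (by simp), by linear_combination -hz⟩
  obtain ⟨k, hk, hnk⟩ := hinv
  have hmk : m * k ∈ hexNormals := by
    rcases key m hm with rfl | rfl | rfl | rfl | rfl | rfl
    · simpa using hk
    · simpa using neg_mem_hexNormals hk
    · exact zeta_mul_mem_hexNormals hk
    · simpa using neg_mem_hexNormals (zeta_mul_mem_hexNormals hk)
    · exact one_sub_zeta_mul_mem_hexNormals hk
    · have := neg_mem_hexNormals (one_sub_zeta_mul_mem_hexNormals hk)
      rwa [← neg_mul] at this
  have hm' : m = m * k * n := by linear_combination -m * hnk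
  rcases key _ hmk with h | h | h | h | h | h <;> rw [h] at hm'
  · exact Or.inl (hm'.trans (by ring))
  · exact Or.inr (Or.inl (hm'.trans (by ring)))
  · exact Or.inr (Or.inr (Or.inl hm'))
  · exact Or.inr (Or.inr (Or.inr (Or.inl (hm'.trans (by ring)))))
  · exact Or.inr (Or.inr (Or.inr (Or.inr (Or.inl hm'))))
  · exact Or.inr (Or.inr (Or.inr (Or.inr (Or.inr (hm'.trans (by ring))))))

/-- Every direction is within 30° of a sixth root of unity. With `a`, `b`, `x = a + b` the products
with three of the normals, `3/4 ‖z‖² = a² + ab + b²`, and the signs of `ab` and `b (a + b)` tell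
which of `x²`, `a²`, `b²` is at least this. -/
theorem exists_hexNormal (z : ℂ) : ∃ n ∈ hexNormals, √3 / 2 * ‖z‖ ≤ dot z n := by
  have h3 : √3 * √3 = 3 := Real.mul_self_sqrt (by norm_num)
  have h30 : 0 ≤ √3 := Real.sqrt_nonneg 3
  have hz := dot_self z
  set x := dot z 1
  set a := dot z zeta
  set b := dot z (1 - zeta)
  have hxab : x = a + b := by simp only [x, a, b, dot_sub_right]; ring
  have hnorm : 3 / 4 * ‖z‖ ^ 2 = a ^ 2 + a * b + b ^ 2 := by
    rw [← hz]
    simp only [a, b, dot, zeta, Complex.sub_re, Complex.sub_im, Complex.one_re, Complex.one_im]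
    linear_combination (-z.im ^ 2 / 4) * h3
  have hle : ∀ c : ℝ, a ^ 2 + a * b + b ^ 2 ≤ c ^ 2 → √3 / 2 * ‖z‖ ≤ |c| := by
    intro c hc
    refine abs_le_of_sq_le_sq' ?_ (abs_nonneg c) |>.2
    rw [sq_abs, mul_pow, div_pow, sq √3, h3]
    linarith
  have hmax : a ^ 2 + a * b + b ^ 2 ≤ x ^ 2 ∨ a ^ 2 + a * b + b ^ 2 ≤ a ^ 2 ∨
      a ^ 2 + a * b + b ^ 2 ≤ b ^ 2 := by
    rcases le_total 0 (a * b) with h | h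
    · left; rw [hxab]; nlinarith
    · rcases le_or_gt (b * (a + b)) 0 with h' | h'
      · right; left; linarith
      · right; right
        by_contra! hcon
        have : 0 < a * (a + b) := by linarith
        nlinarith [mul_pos this h', mul_nonneg (neg_nonneg.2 h) (sq_nonneg (a + b))]
  have hsgn : ∀ m ∈ hexNormals, √3 / 2 * ‖z‖ ≤ |dot z m| →
      ∃ n ∈ hexNormals, √3 / 2 * ‖z‖ ≤ dot z n := by
    intro m hm h
    rcases abs_cases (dot z m) with ⟨h', -⟩ | ⟨h', -⟩
    · exact ⟨m, hm, by rwa [h'] at h⟩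
    · exact ⟨-m, neg_mem_hexNormals hm, by rwa [dot_neg_right, ← h']⟩
  rcases hmax with h | h | h
  · exact hsgn 1 (mem_hexNormals.2 (by simp)) (hle _ h)
  · exact hsgn zeta (mem_hexNormals.2 (by simp)) (hle _ h)
  · exact hsgn (1 - zeta) (mem_hexNormals.2 (by simp)) (hle _ h)

theorem dot_le_norm {z n : ℂ} (hn : ‖n‖ = 1) : dot z n ≤ ‖z‖ := by
  have h1 := dot_self z
  have h2 := dot_self n
  rw [hn] at h2
  refine le_of_sq_le_sq ?_ (norm_nonneg z) |> fun h => h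
  rw [← h1]
  simp only [dot] at *
  nlinarith [sq_nonneg (z.re * n.im - z.im * n.re)]

theorem abs_dot_le_norm {z n : ℂ} (hn : ‖n‖ = 1) : |dot z n| ≤ ‖z‖ := by
  refine abs_le.2 ⟨?_, dot_le_norm hn⟩
  have := dot_le_norm (z := z) (n := -n) (by rwa [norm_neg])
  rw [dot_neg_right] at this
  linarith

/-- The norm whose balls are regular hexagons. -/
noncomputable def hexNorm (z : ℂ) : ℝ := hexNormals.sup' hexNormals_nonempty (dot z)

theorem dot_le_hexNorm {z n : ℂ} (hn : n ∈ hexNormals) : dot z n ≤ hexNorm z :=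
  Finset.le_sup' (dot z) hn

theorem exists_dot_eq_hexNorm (z : ℂ) : ∃ n ∈ hexNormals, dot z n = hexNorm z := by
  obtain ⟨n, hn, h⟩ := Finset.exists_mem_eq_sup' hexNormals_nonempty (dot z)
  exact ⟨n, hn, h.symm⟩

theorem norm_le_hexNorm (z : ℂ) : √3 / 2 * ‖z‖ ≤ hexNorm z := by
  obtain ⟨n, hn, h⟩ := exists_hexNormal z
  exact h.trans (dot_le_hexNorm hn)

theorem hexNorm_le_norm (z : ℂ) : hexNorm z ≤ ‖z‖ :=
  Finset.sup'_le _ _ fun _ hn => dot_le_norm (norm_of_mem_hexNormals hn)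

theorem hexNorm_smul {t : ℝ} (ht : 0 ≤ t) (z : ℂ) : hexNorm (t * z) = t * hexNorm z := by
  apply le_antisymm
  · refine Finset.sup'_le _ _ fun n hn => ?_
    rw [dot_smul_left]
    exact mul_le_mul_of_nonneg_left (dot_le_hexNorm hn) ht
  · obtain ⟨n, hn, h⟩ := exists_dot_eq_hexNorm z
    rw [← h, ← dot_smul_left]
    exact dot_le_hexNorm hn

theorem hexNorm_lt_iff {z : ℂ} {R : ℝ} : hexNorm z < R ↔ ∀ n ∈ hexNormals, dot z n < R :=
  Finset.sup'_lt_iff _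

theorem hexNorm_le_iff {z : ℂ} {R : ℝ} : hexNorm z ≤ R ↔ ∀ n ∈ hexNormals, dot z n ≤ R :=
  Finset.sup'_le_iff _ _

theorem continuous_hexNorm : Continuous hexNorm :=
  Continuous.finset_sup'_apply _ fun n _ => continuous_dot_left n

theorem sqrt_three_bounds : 17 / 10 < √3 ∧ √3 < 18 / 10 := by
  constructor
  · exact (Real.lt_sqrt (by norm_num)).2 (by norm_num)
  · exact (Real.sqrt_lt' (by norm_num)).2 (by norm_num)

theorem hexNorm_unit {u : ℂ} (hu : ‖u‖ = 1) : √3 / 2 ≤ hexNorm u ∧ hexNorm u ≤ 1 := by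
  have h1 := norm_le_hexNorm u
  have h2 := hexNorm_le_norm u
  rw [hu] at h1 h2
  exact ⟨by linarith, h2⟩

theorem eq_dot_add_dot (z : ℂ) {n : ℂ} (hn : ‖n‖ = 1) :
    z = dot z n * n + dot z (Complex.I * n) * (Complex.I * n) := by
  have h2 := dot_self n
  rw [hn] at h2
  apply Complex.ext <;> simp only [Complex.add_re, Complex.add_im, Complex.re_ofReal_mul,
      Complex.im_ofReal_mul] <;>
    simp only [dot, Complex.mul_re, Complex.mul_im, Complex.I_re, Complex.I_im] at h2 ⊢
  · linear_combination -z.re * h2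
  · linear_combination -z.im * h2

theorem dot_I_mul_self (n : ℂ) : dot n (Complex.I * n) = 0 := by
  simp only [dot, Complex.mul_re, Complex.mul_im, Complex.I_re, Complex.I_im]
  ring

theorem dot_I_mul_I_mul (z w : ℂ) : dot (Complex.I * z) (Complex.I * w) = dot z w := by
  simp only [dot, Complex.mul_re, Complex.mul_im, Complex.I_re, Complex.I_im]
  ring

/-- One of the two endpoints of the side with normal `n` of a hexagon with center `v`. -/
noncomputable def hexCorner (v : ℂ) (R : ℝ) (n : ℂ) : ℂ :=
  v + R * n + (R / √3 : ℝ) * (Complex.I * n)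

/-- The other endpoint of the side with normal `n` of a hexagon with center `v`. -/
noncomputable def hexCorner' (v : ℂ) (R : ℝ) (n : ℂ) : ℂ :=
  v + R * n + (-(R / √3) : ℝ) * (Complex.I * n)

/-- The side with normal `n` of a hexagon with center `v`. -/
def hexSide (v : ℂ) (R : ℝ) (n : ℂ) : Set ℂ := segment ℝ (hexCorner' v R n) (hexCorner v R n)

theorem mem_hexSide {v n z : ℂ} {R : ℝ} (hR : 0 < R) (hn : n ∈ hexNormals) :
    z ∈ hexSide v R n ↔ dot (z - v) n = R ∧ hexNorm (z - v) ≤ R := by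
  have hn1 := norm_of_mem_hexNormals hn
  have h3 : √3 * √3 = 3 := Real.mul_self_sqrt (by norm_num)
  have h30 : 0 < √3 := Real.sqrt_pos.2 (by norm_num)
  have hself := dot_self n
  rw [hn1, one_pow] at hself
  have hI := dot_I_mul_self n
  have hII := dot_I_mul_I_mul n n
  have hI' : dot (Complex.I * n) n = 0 := by rw [dot_comm]; exact hI
  have hdiv : √3 * (R / √3) = R := by field_simp
  -- In the coordinates along `n` and `I * n` the side is the segment at height `R` with tangential
  -- coordinate at most `R / √3` in absolute value.
  have hq : ∀ z : ℂ, z ∈ hexSide v R n ↔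
      ∃ q : ℝ, -(R / √3) ≤ q ∧ q ≤ R / √3 ∧ z = v + R * n + q * (Complex.I * n) := by
    intro z
    rw [hexSide, mem_segment_complex]
    have hpos : 0 < R / √3 := by positivity
    constructor
    · rintro ⟨t, h0, h1, rfl⟩
      refine ⟨-(R / √3) + t * (2 * (R / √3)), by nlinarith, by nlinarith, ?_⟩
      simp only [hexCorner, hexCorner']
      push_cast
      ring
    · rintro ⟨q, h0, h1, rfl⟩
      refine ⟨(q + R / √3) / (2 * (R / √3)), div_nonneg (by linarith) (by positivity), ?_, ?_⟩
      · rw [div_le_one (by positivity)]; linarith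
      · have e : q = -(R / √3) + (q + R / √3) / (2 * (R / √3)) * (2 * (R / √3)) := by
          field_simp; ring
        simp only [hexCorner, hexCorner']
        have e' : (q : ℂ) = ((-(R / √3) + (q + R / √3) / (2 * (R / √3)) * (2 * (R / √3)) : ℝ) : ℂ) :=
          congrArg _ e
        rw [e']
        push_cast
        ring
  rw [hq]
  constructor
  · rintro ⟨q, h0, h1, rfl⟩
    have hsub : v + R * n + q * (Complex.I * n) - v = R * n + q * (Complex.I * n) := by ring
    have hp : dot (R * n + q * (Complex.I * n)) n = R := by
      rw [dot_add_left, dot_smul_left, dot_smul_left, hself, hI']; ring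
    have hqq : dot (R * n + q * (Complex.I * n)) (Complex.I * n) = q := by
      rw [dot_add_left, dot_smul_left, dot_smul_left, hI, hII, hself]; ring
    rw [hsub]
    refine ⟨hp, hexNorm_le_iff.2 fun m hm => ?_⟩
    have e1 : √3 * q ≤ R := by nlinarith
    have e2 : -R ≤ √3 * q := by nlinarith
    rcases hexNormals_cases hn hm with rfl | rfl | rfl | rfl | rfl | rfl
    · exact hp.le
    · rw [dot_neg_right, hp]; linarith
    · rw [dot_zeta_mul, hp, hqq]; linarith
    · rw [dot_neg_right, dot_zeta_mul, hp, hqq]; linarith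
    · rw [dot_one_sub_zeta_mul, hp, hqq]; linarith
    · rw [dot_neg_right, dot_one_sub_zeta_mul, hp, hqq]; linarith
  · rintro ⟨h1, h2⟩
    have e1 := hexNorm_le_iff.1 h2 _ (zeta_mul_mem_hexNormals hn)
    have e2 := hexNorm_le_iff.1 h2 _ (one_sub_zeta_mul_mem_hexNormals hn)
    rw [dot_zeta_mul, h1] at e1
    rw [dot_one_sub_zeta_mul, h1] at e2
    refine ⟨dot (z - v) (Complex.I * n), ?_, ?_, ?_⟩
    · rw [← neg_div, div_le_iff₀ h30]; linarith
    · rw [le_div_iff₀ h30]; linarith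
    · have := eq_dot_add_dot (z - v) hn1
      rw [h1] at this
      linear_combination this

/-- A point on two sides of a hexagon is a corner. -/
theorem hexSide_inter {v n m z : ℂ} {R : ℝ} (hR : 0 < R) (hn : n ∈ hexNormals)
    (hm : m ∈ hexNormals) (hnm : n ≠ m) (hzn : dot (z - v) n = R) (hzm : dot (z - v) m = R)
    (hz : hexNorm (z - v) ≤ R) :
    (z = hexCorner v R n ∧ m = zeta * n) ∨ (z = hexCorner' v R n ∧ m = (1 - zeta) * n) := by
  have hn1 := norm_of_mem_hexNormals hn
  have h3 : √3 * √3 = 3 := Real.mul_self_sqrt (by norm_num)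
  have h30 : 0 < √3 := Real.sqrt_pos.2 (by norm_num)
  have e1 := hexNorm_le_iff.1 hz _ (zeta_mul_mem_hexNormals hn)
  have e2 := hexNorm_le_iff.1 hz _ (one_sub_zeta_mul_mem_hexNormals hn)
  rw [dot_zeta_mul, hzn] at e1
  rw [dot_one_sub_zeta_mul, hzn] at e2
  have hzz := eq_dot_add_dot (z - v) hn1
  rw [hzn] at hzz
  rcases hexNormals_cases hn hm with rfl | rfl | rfl | rfl | rfl | rfl
  · exact absurd rfl hnm
  · rw [dot_neg_right, hzn] at hzm
    linarith
  · left
    rw [dot_zeta_mul, hzn] at hzm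
    have hq : dot (z - v) (Complex.I * n) = R / √3 := by
      rw [eq_div_iff h30.ne']; linarith
    rw [hq] at hzz
    exact ⟨by rw [hexCorner]; linear_combination hzz, rfl⟩
  · rw [dot_neg_right, dot_zeta_mul, hzn] at hzm
    linarith
  · right
    rw [dot_one_sub_zeta_mul, hzn] at hzm
    have hq : dot (z - v) (Complex.I * n) = -(R / √3) := by
      rw [← neg_div, eq_div_iff h30.ne']; linarith
    rw [hq] at hzz
    exact ⟨by rw [hexCorner']; linear_combination hzz, rfl⟩
  · rw [dot_neg_right, dot_one_sub_zeta_mul, hzn] at hzm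
    linarith

/-- Two directions along the boundary of a hexagon form an angle of at least `120°`. -/
theorem dot_le_of_tangent {v n m x d₁ d₂ : ℂ} {R : ℝ} (hR : 0 < R) (hn : n ∈ hexNormals)
    (hm : m ∈ hexNormals) (hxn : dot (x - v) n = R) (hxm : dot (x - v) m = R)
    (hx : hexNorm (x - v) ≤ R) (h1 : ‖d₁‖ = 1) (h2 : ‖d₂‖ = 1) (hne : d₁ ≠ d₂)
    (hd1 : dot d₁ n = 0) (hd2 : dot d₂ m = 0) (hd1m : dot d₁ m ≤ 0) (hd2n : dot d₂ n ≤ 0) :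
    dot d₁ d₂ ≤ 1 / 2 := by
  have hn1 := norm_of_mem_hexNormals hn
  have h3 : √3 * √3 = 3 := Real.mul_self_sqrt (by norm_num)
  have h30 : 0 < √3 := Real.sqrt_pos.2 (by norm_num)
  have e1 := eq_dot_add_dot d₁ hn1
  rw [hd1] at e1
  have e2 := eq_dot_add_dot d₂ hn1
  have hself := dot_self n
  rw [hn1, one_pow] at hself
  set p := dot d₁ (Complex.I * n)
  set q := dot d₂ (Complex.I * n)
  set k := dot d₂ n
  have hdd : ∀ a b c e : ℝ, dot (a * n + b * (Complex.I * n)) (c * n + e * (Complex.I * n)) =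
      a * c + b * e := by
    intro a b c e
    rw [dot_add_left, dot_add_right, dot_add_right]
    simp only [dot_smul_left, dot_smul_right, dot_I_mul_I_mul, dot_I_mul_self, hself,
      dot_comm (Complex.I * n) n]
    ring
  have hp : p ^ 2 = 1 := by
    have := dot_self d₁
    rw [h1, e1, hdd] at this
    linarith
  have hq : k ^ 2 + q ^ 2 = 1 := by
    have := dot_self d₂
    rw [h2, e2, hdd] at this
    linarith
  have hgoal : dot d₁ d₂ = p * q := by
    conv_lhs => rw [e1, e2, hdd]
    ring
  rw [hgoal]
  by_cases hnm : n = m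
  · subst hnm
    have hk : k = 0 := hd2
    have hpq : p ≠ q := by
      rintro h
      apply hne
      rw [e1, e2, ← h, hk]
    nlinarith [sq_pos_of_pos (abs_pos.2 (sub_ne_zero.2 hpq)), sq_abs (p - q)]
  -- At a corner the conditions `hd1m` and `hd2n`, that each direction stays in the half-plane of
  -- the other side, force `p` and `q` to have opposite signs.
  · rcases hexSide_inter hR hn hm hnm hxn hxm hx with ⟨-, rfl⟩ | ⟨-, rfl⟩
    · rw [dot_zeta_mul] at hd2 hd1m
      rw [hd1] at hd1m
      have hd2' : k + √3 * q = 0 := by linarith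
      have hp0 : p ≤ 0 := by by_contra! h; nlinarith [mul_pos h30 h]
      have hq0 : 0 ≤ q := by by_contra! h; nlinarith [mul_pos h30 (neg_pos.2 h)]
      nlinarith [mul_nonneg (neg_nonneg.2 hp0) hq0]
    · rw [dot_one_sub_zeta_mul] at hd2 hd1m
      rw [hd1] at hd1m
      have hd2' : k - √3 * q = 0 := by linarith
      have hp0 : 0 ≤ p := by by_contra! h; nlinarith [mul_pos h30 (neg_pos.2 h)]
      have hq0 : q ≤ 0 := by by_contra! h; nlinarith [mul_pos h30 h]
      nlinarith [mul_nonneg hp0 (neg_nonneg.2 hq0)]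

/-- A line through the center of a hexagon, or a line hitting a side in such a direction, makes an
angle of at least `60°` with the side. -/
theorem dot_le_of_transversal {u n d e : ℂ} (hu : ‖u‖ = 1) (hd : ‖d‖ = 1) (hn : ‖n‖ = 1)
    (hun : √3 / 2 ≤ dot u n) (hdn : dot d n = 0) (he : e = u ∨ e = -u) : dot e d ≤ 1 / 2 := by
  have h3 : √3 * √3 = 3 := Real.mul_self_sqrt (by norm_num)
  have h30 : 0 < √3 := Real.sqrt_pos.2 (by norm_num)
  have e1 := dot_self u
  have e2 := dot_self d
  have e3 := dot_self n
  rw [hu] at e1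
  rw [hd] at e2
  rw [hn] at e3
  have key : dot u d ^ 2 ≤ 1 / 4 := by
    -- `n` and `d` are orthonormal, so a large normal component of `u` leaves at most 1/2 for the
    -- tangential one.
    have hid : dot u n ^ 2 + dot u d ^ 2 = 1 := by
      have hu' := eq_dot_add_dot u hn
      have hd' := eq_dot_add_dot d hn
      rw [hdn] at hd'
      have a1 : dot u n ^ 2 + dot u (Complex.I * n) ^ 2 = 1 := by
        simp only [dot, Complex.mul_re, Complex.mul_im, Complex.I_re, Complex.I_im] at *
        linear_combination (u.re * u.re + u.im * u.im) * e3 + e1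
      have a2 : dot d n ^ 2 + dot d (Complex.I * n) ^ 2 = 1 := by
        simp only [dot, Complex.mul_re, Complex.mul_im, Complex.I_re, Complex.I_im] at *
        linear_combination (d.re * d.re + d.im * d.im) * e3 + e2
      rw [hdn] at a2
      have a3 : dot u d = dot d (Complex.I * n) * dot u (Complex.I * n) := by
        conv_lhs => rw [hd']
        rw [dot_add_right, dot_smul_right, dot_smul_right]
        simp
      rw [a3]
      linear_combination a1 + dot u (Complex.I * n) ^ 2 * a2
    nlinarith
  have habs : |dot u d| ≤ 1 / 2 := by
    refine abs_le_of_sq_le_sq ?_ (by norm_num)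
    linarith
  rcases he with rfl | rfl
  · exact (le_abs_self _).trans habs
  · rw [dot_neg_left]
    exact (neg_le_abs _).trans habs

/-! ### Directions, ports and spokes -/

/-- The unit vector pointing from `a` to `b`. -/
noncomputable def udir (a b : ℂ) : ℂ := (b - a) / ‖b - a‖

theorem norm_udir {a b : ℂ} (h : a ≠ b) : ‖udir a b‖ = 1 := by
  have : ‖b - a‖ ≠ 0 := norm_ne_zero_iff.2 (sub_ne_zero.2 h.symm)
  simp [udir, this]

theorem udir_symm (a b : ℂ) : udir b a = -udir a b := by
  rw [udir, udir, norm_sub_rev, ← neg_div, neg_sub]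

theorem sub_eq_norm_mul_udir {a b : ℂ} (h : a ≠ b) : b - a = ‖b - a‖ * udir a b := by
  have : (‖b - a‖ : ℂ) ≠ 0 := by exact_mod_cast norm_ne_zero_iff.2 (sub_ne_zero.2 h.symm)
  rw [udir]
  field_simp

/-- `a` and `b` are joined by an edge. -/
def PSLG.Adj (Γ : PSLG) (a b : ℂ) : Prop := s(a, b) ∈ Γ.edges

namespace PSLG.Adj

variable {Γ : PSLG} {a b : ℂ}

theorem symm (h : Γ.Adj a b) : Γ.Adj b a := by rwa [PSLG.Adj, Sym2.eq_swap]

theorem ne (h : Γ.Adj a b) : a ≠ b := by simpa using Γ.not_isDiag _ h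

theorem left (h : Γ.Adj a b) : a ∈ Γ.verts := Γ.endpoint_mem _ h a (by simp)

theorem right (h : Γ.Adj a b) : b ∈ Γ.verts := Γ.endpoint_mem _ h b (by simp)

theorem norm (h : Γ.Adj a b) : ‖udir a b‖ = 1 := norm_udir h.ne

end PSLG.Adj

/-- The two sides of a direction. -/
def IsSide (u J : ℂ) : Prop := J = Complex.I * u ∨ J = -(Complex.I * u)

theorem IsSide.neg_left {u J : ℂ} (h : IsSide u J) : IsSide (-u) J := by
  rcases h with rfl | rfl
  · right; ring
  · left; ring

theorem IsSide.neg_right {u J : ℂ} (h : IsSide u J) : IsSide u (-J) := by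
  rcases h with rfl | rfl
  · right; ring
  · left; ring

theorem IsSide.norm {u J : ℂ} (h : IsSide u J) (hu : ‖u‖ = 1) : ‖J‖ = 1 := by
  rcases h with rfl | rfl <;> simp [hu]

theorem IsSide.dot_eq_zero {u J : ℂ} (h : IsSide u J) : dot u J = 0 := by
  rcases h with rfl | rfl
  · exact dot_I_mul_self u
  · rw [dot_neg_right, dot_I_mul_self, neg_zero]

theorem IsSide.eq_add {u J : ℂ} (h : IsSide u J) (hu : ‖u‖ = 1) (z : ℂ) :
    z = dot z u * u + dot z J * J := by
  rcases h with rfl | rfl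
  · exact eq_dot_add_dot z hu
  · rw [dot_neg_right]
    push_cast
    rw [neg_mul_neg]
    exact eq_dot_add_dot z hu

theorem IsSide.dot_eq {u J : ℂ} (h : IsSide u J) (hu : ‖u‖ = 1) (z m : ℂ) :
    dot z m = dot z u * dot u m + dot z J * dot J m := by
  conv_lhs => rw [h.eq_add hu z]
  rw [dot_add_left, dot_smul_left, dot_smul_left]

/-- If the ray leaves through a corner, two normals maximize the product with `u`; the strip lies on
the side of `J`, so the tie is broken by the product with `J`. The two products determine a normal,
hence the strictness. -/
theorem exists_port {u J : ℂ} (hu : ‖u‖ = 1) (hJ : IsSide u J) :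
    ∃ n ∈ hexNormals, dot u n = hexNorm u ∧ ∀ m ∈ hexNormals, m ≠ n →
      dot u m < dot u n ∨ dot u m = dot u n ∧ dot J m < dot J n := by
  obtain ⟨n₀, hn₀, hn₀'⟩ := exists_dot_eq_hexNorm u
  obtain ⟨n, hn, hmax⟩ := (hexNormals.filter fun n => dot u n = hexNorm u).exists_max_image (dot J)
    ⟨n₀, Finset.mem_filter.2 ⟨hn₀, hn₀'⟩⟩
  rw [Finset.mem_filter] at hn
  refine ⟨n, hn.1, hn.2, fun m hm hmn => ?_⟩
  rcases (dot_le_hexNorm hm : dot u m ≤ hexNorm u).lt_or_eq with h | h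
  · exact Or.inl (hn.2 ▸ h)
  · refine Or.inr ⟨h.trans hn.2.symm, (hmax m (Finset.mem_filter.2 ⟨hm, h⟩)).lt_of_ne fun h' => ?_⟩
    apply hmn
    have h1 := hJ.eq_add hu m
    have h2 := hJ.eq_add hu n
    rw [h1, h2, dot_comm m, dot_comm m, dot_comm n, dot_comm n, h, h', hn.2]

open Classical in
/-- The normal of the side of a hexagon through which a strip along the ray of direction `u`, on the
side of `J`, leaves. -/
noncomputable def port (u J : ℂ) : ℂ :=
  if h : ‖u‖ = 1 ∧ IsSide u J then (exists_port h.1 h.2).choose else 1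

theorem port_spec {u J : ℂ} (hu : ‖u‖ = 1) (hJ : IsSide u J) :
    port u J ∈ hexNormals ∧ dot u (port u J) = hexNorm u ∧ ∀ m ∈ hexNormals, m ≠ port u J →
      dot u m < dot u (port u J) ∨ dot u m = dot u (port u J) ∧ dot J m < dot J (port u J) := by
  have h : ‖u‖ = 1 ∧ IsSide u J := ⟨hu, hJ⟩
  rw [port, dif_pos h]
  exact (exists_port h.1 h.2).choose_spec

/-- On the line of the port side, at small height `y > 0` on the side of `J`, all other side
conditions hold strictly. For a normal with a strictly smaller product with `u` this is continuity
at `y = 0`; for a tie it holds at every positive height. -/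
theorem eventually_port_lt {u J : ℂ} (hu : ‖u‖ = 1) (hJ : IsSide u J) {R : ℝ} (hR : 0 < R) :
    ∀ᶠ δ in 𝓝[>] (0 : ℝ), ∀ m ∈ hexNormals, m ≠ port u J → ∀ x y : ℝ, 0 < y → y ≤ δ →
      x * dot u (port u J) + y * dot J (port u J) = R → x * dot u m + y * dot J m < R := by
  obtain ⟨-, hn2, hn3⟩ := port_spec hu hJ
  have hpos : 0 < dot u (port u J) := by
    rw [hn2]
    exact lt_of_lt_of_le (by positivity) (hexNorm_unit hu).1
  set n := port u J
  rw [Filter.eventually_all_finset]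
  intro m hm
  by_cases hmn : m = n
  · exact Eventually.of_forall fun _ h => absurd hmn h
  have hexp : ∀ x y : ℝ, x * dot u n + y * dot J n = R →
      dot u n * (x * dot u m + y * dot J m) =
        R * dot u m + y * (dot u n * dot J m - dot u m * dot J n) := by
    intro x y h
    linear_combination dot u m * h
  rcases hn3 m hm hmn with h | ⟨h, h'⟩
  · have hc : Tendsto (fun y : ℝ => R * dot u m + y * |dot u n * dot J m - dot u m * dot J n|)
        (𝓝[>] 0) (𝓝 (R * dot u m + 0 * |dot u n * dot J m - dot u m * dot J n|)) :=
      tendsto_nhdsWithin_of_tendsto_nhds (Continuous.tendsto (by fun_prop) 0)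
    have hlt : R * dot u m + 0 * |dot u n * dot J m - dot u m * dot J n| < R * dot u n := by
      rw [zero_mul, add_zero]
      exact mul_lt_mul_of_pos_left h hR
    filter_upwards [hc.eventually_lt_const hlt] with δ hδ _ x y hy hyδ hxy
    have h1 := hexp x y hxy
    have h2 : y * (dot u n * dot J m - dot u m * dot J n) ≤
        δ * |dot u n * dot J m - dot u m * dot J n| :=
      (mul_le_mul_of_nonneg_left (le_abs_self _) hy.le).trans
        (mul_le_mul_of_nonneg_right hyδ (abs_nonneg _))
    refine lt_of_mul_lt_mul_left ?_ hpos.le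
    linarith
  · refine Eventually.of_forall fun δ _ x y hy _ hxy => ?_
    rw [h]
    have := mul_lt_mul_of_pos_left h' hy
    linarith

/-- Unit vectors in an open half-plane have a unit vector at obtuse angles to all of them that lies in
every half-plane disjoint from them. -/
theorem exists_spoke (D : Finset ℂ) (hD : D.Nonempty) {n₀ : ℂ} (hn₀ : ∀ d ∈ D, dot d n₀ < 0) :
    ∃ w : ℂ, ‖w‖ = 1 ∧ (∀ d ∈ D, dot d w ≤ 0) ∧
      ∀ n, (∀ d ∈ D, dot d n < 0) → 0 ≤ dot w n := by
  have hneg : ∀ n, (∀ d ∈ D, dot d n < 0) → ∀ z ∈ convexHull ℝ (D : Set ℂ), dot z n < 0 := by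
    intro n hn
    have hc := convex_dot_lt 0 n 0
    simp only [sub_zero] at hc
    have hsub : (D : Set ℂ) ⊆ {z | dot z n < 0} := hn
    exact fun z hz => convexHull_min hsub hc hz
  -- The spoke is opposite to the point `m` of the convex hull of the directions nearest to the
  -- origin.
  obtain ⟨m, hm, hmin⟩ := (D.finite_toSet.isCompact_convexHull ℝ).exists_isMinOn
    (hD.to_set.convexHull) continuous_norm.continuousOn
  have hm0 : m ≠ 0 := by
    rintro rfl
    have := hneg n₀ hn₀ 0 hm
    rw [dot_zero_left] at this
    exact this.false
  have hpos : 0 < ‖m‖ := norm_pos_iff.2 hm0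
  have hfirst : ∀ d ∈ D, 0 ≤ dot d m := by
    intro d hd
    by_contra! hcon
    have hdm : dot (d - m) m < 0 := by
      rw [dot_sub_left, dot_self]
      have := sq_nonneg ‖m‖
      linarith
    set q := dot (d - m) m with hq
    -- Minimality of the norm at `m` along the segment from `m` to `d`, divided by `t`.
    have key : ∀ t : ℝ, 0 < t → t < 1 → 0 ≤ 2 * q + t * ‖d - m‖ ^ 2 := by
      intro t h0 h1
      have hmem : m + t * (d - m) ∈ convexHull ℝ (D : Set ℂ) :=
        (convex_convexHull ℝ _).segment_subset hm (subset_convexHull ℝ _ hd)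
          (mem_segment_complex.2 ⟨t, h0.le, h1.le, rfl⟩)
      have hle : ‖m‖ ≤ ‖m + t * (d - m)‖ := hmin hmem
      have hsq := pow_le_pow_left₀ (norm_nonneg _) hle 2
      rw [← dot_self, ← dot_self] at hsq
      rw [← dot_self]
      rw [dot_add_left, dot_add_right, dot_add_right, dot_smul_left, dot_smul_left, dot_smul_right,
        dot_smul_right, dot_comm m (d - m), ← hq] at hsq
      nlinarith
    have hs : 0 < ‖d - m‖ ^ 2 + 1 := by positivity
    have h1 := key (min (1 / 2) (-q / (‖d - m‖ ^ 2 + 1)))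
      (lt_min (by norm_num) (div_pos (by linarith) hs)) ((min_le_left _ _).trans_lt (by norm_num))
    have h2 : min (1 / 2) (-q / (‖d - m‖ ^ 2 + 1)) * ‖d - m‖ ^ 2 ≤ -q := by
      calc _ ≤ -q / (‖d - m‖ ^ 2 + 1) * (‖d - m‖ ^ 2 + 1) := by
            refine mul_le_mul (min_le_right _ _) (by linarith) (by positivity)
              (div_nonneg (by linarith) hs.le)
        _ = -q := by field_simp
    linarith
  have hw : ∀ z, dot z (-(m / ‖m‖)) = -(dot z m / ‖m‖) := fun z => by
    have : m / (‖m‖ : ℂ) = ((‖m‖⁻¹ : ℝ) : ℂ) * m := by push_cast; ring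
    rw [dot_neg_right, this, dot_smul_right]
    ring
  refine ⟨-(m / ‖m‖), by simp [hpos.ne'], fun d hd => ?_, fun n hn => ?_⟩
  · rw [hw]
    have := div_nonneg (hfirst d hd) hpos.le
    linarith
  · rw [dot_comm, hw, dot_comm]
    have := div_nonneg (neg_nonneg.2 (hneg n hn m hm).le) hpos.le
    rw [neg_div] at this
    linarith

/-! ### Sizes of the hexagons and strips -/

/-- The sizes of the hexagons and strips that are used to refine a graph. -/
structure StripData (Γ : PSLG) where
  /-- The inradius of the hexagons around the vertices. -/
  R : ℝ
  /-- The width of the strips along the edges. -/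
  δ : ℝ
  /-- The vertices from which a spoke issues. -/
  spokes : Finset ℂ
  /-- The directions of the spokes. -/
  spokeDir : ℂ → ℂ
  R_pos : 0 < R
  δ_pos : 0 < δ
  δ_lt : 10 * δ < R
  -- A closed hexagon of inradius `R` lies in the disc of radius `2 * R`, so different hexagons are
  -- far apart.
  vert_sep : ∀ v ∈ Γ.verts, ∀ v' ∈ Γ.verts, v ≠ v' → 8 * R < dist v v'
  edge_sep : ∀ e ∈ Γ.edges, ∀ v ∈ Γ.verts, v ∉ e → ∀ z ∈ closedEdge e, 8 * R < dist z v
  -- Edges with a common end cannot be separated near it; the separation is needed only for points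
  -- of `e` at distance `R / 2` from its ends. Points in two strips have feet within `2 * δ` of each
  -- other.
  core_sep : ∀ e ∈ Γ.edges, ∀ f ∈ Γ.edges, e ≠ f → ∀ z ∈ closedEdge e, ∀ z' ∈ closedEdge f,
    (∀ v ∈ e, R / 2 ≤ dist z v) → 4 * δ < dist z z'
  spokes_subset : spokes ⊆ Γ.verts
  norm_spokeDir : ∀ v ∈ spokes, ‖spokeDir v‖ = 1
  spokeDir_le : ∀ v ∈ spokes, ∀ b, Γ.Adj v b → dot (udir v b) (spokeDir v) ≤ 0
  -- Every closed half-plane at `v` contains the direction of an edge or the spoke, so no sector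
  -- free of them exceeds 180°.
  no_reflex : ∀ v ∈ Γ.verts, ∀ n, (∃ b, Γ.Adj v b ∧ 0 ≤ dot (udir v b) n) ∨
    v ∈ spokes ∧ 0 ≤ dot (spokeDir v) n
  port_lt : ∀ a b J, Γ.Adj a b → IsSide (udir a b) J → ∀ m ∈ hexNormals, m ≠ port (udir a b) J →
    ∀ x y : ℝ, 0 < y → y ≤ δ →
      x * dot (udir a b) (port (udir a b) J) + y * dot J (port (udir a b) J) = R →
      x * dot (udir a b) m + y * dot J m < R

theorem PSLG.eventually_edge_sep (Γ : PSLG) : ∀ᶠ r in 𝓝[>] (0 : ℝ), ∀ e ∈ Γ.edges,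
    ∀ v ∈ Γ.verts, v ∉ e → ∀ z ∈ closedEdge e, r < dist z v := by
  rw [Filter.eventually_all_finset]
  intro e he
  rw [Filter.eventually_all_finset]
  intro v hv
  by_cases hve : v ∈ e
  · exact Eventually.of_forall fun _ h => absurd hve h
  have hnot : v ∉ closedEdge e := fun h =>
    (mem_closedEdge.1 h).elim hve (Γ.vertex_notMem e he v hv)
  obtain ⟨r, hr, hball⟩ := Metric.isOpen_iff.1 (isCompact_closedEdge e).isClosed.isOpen_compl v hnot
  refine eventually_nhdsGT_zero_iff.2 ⟨r, hr, fun s _ hsr _ z hz => ?_⟩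
  by_contra! hle
  exact hball (Metric.mem_ball.2 (hle.trans_lt hsr)) hz

theorem PSLG.eventually_vert_sep (Γ : PSLG) : ∀ᶠ r in 𝓝[>] (0 : ℝ), ∀ v ∈ Γ.verts,
    ∀ v' ∈ Γ.verts, v ≠ v' → r < dist v v' := by
  rw [Filter.eventually_all_finset]
  intro v _
  rw [Filter.eventually_all_finset]
  intro v' _
  by_cases h : v = v'
  · exact Eventually.of_forall fun _ h' => absurd h h'
  · exact eventually_nhdsGT_zero_iff.2 ⟨dist v v', dist_pos.2 h, fun s _ hs _ => hs⟩

theorem PSLG.eventually_core_sep (Γ : PSLG) {ρ : ℝ} (hρ : 0 < ρ) : ∀ᶠ r in 𝓝[>] (0 : ℝ),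
    ∀ e ∈ Γ.edges, ∀ f ∈ Γ.edges, e ≠ f → ∀ z ∈ closedEdge e, ∀ z' ∈ closedEdge f,
      (∀ v ∈ e, ρ ≤ dist z v) → r < dist z z' := by
  rw [Filter.eventually_all_finset]
  intro e he
  rw [Filter.eventually_all_finset]
  intro f hf
  by_cases hef : e = f
  · exact Eventually.of_forall fun _ h => absurd hef h
  have hcl : IsClosed {z : ℂ | ∀ v ∈ e, ρ ≤ dist z v} := by
    have : {z : ℂ | ∀ v ∈ e, ρ ≤ dist z v} = ⋂ v ∈ e, (fun z => dist z v) ⁻¹' Set.Ici ρ := by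
      ext z; simp
    rw [this]
    exact isClosed_biInter fun v _ => isClosed_Ici.preimage (by fun_prop)
  have hdisj : Disjoint (closedEdge e ∩ {z : ℂ | ∀ v ∈ e, ρ ≤ dist z v}) (closedEdge f) := by
    refine Set.disjoint_left.2 fun z hz hzf => ?_
    have hze : z ∉ e := fun h => by
      have := hz.2 z h
      rw [dist_self] at this
      linarith
    have hzo := (mem_closedEdge.1 hz.1).resolve_left hze
    rcases mem_closedEdge.1 hzf with h | h
    · exact Γ.vertex_notMem e he z (Γ.endpoint_mem f hf z h) hzo
    · exact hef (Γ.eq_of_mem_openEdge he hf hzo h)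
  obtain ⟨r, hr, hthick⟩ := hdisj.exists_thickenings
    ((isCompact_closedEdge e).inter_right hcl) (isCompact_closedEdge f).isClosed
  refine eventually_nhdsGT_zero_iff.2 ⟨r, hr, fun s _ hsr _ z hz z' hz' hzv => ?_⟩
  by_contra! hle
  exact Set.disjoint_left.1 hthick
    (Metric.mem_thickening_iff.2 ⟨z, ⟨hz, hzv⟩, by rwa [dist_self]⟩)
    (Metric.mem_thickening_iff.2 ⟨z', hz', hle.trans_lt hsr⟩)

theorem eventually_const_mul {c : ℝ} (hc : 0 < c) {p : ℝ → Prop}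
    (h : ∀ᶠ r in 𝓝[>] (0 : ℝ), p r) : ∀ᶠ r in 𝓝[>] (0 : ℝ), p (c * r) := by
  obtain ⟨r, hr, h⟩ := eventually_nhdsGT_zero_iff.1 h
  refine eventually_nhdsGT_zero_iff.2 ⟨r / c, by positivity, fun s hs hsr => h _ (by positivity) ?_⟩
  rwa [lt_div_iff₀ hc, mul_comm] at hsr

/-- `R` is chosen first from the separation of vertices and edges; `δ` depends on `R`, through the
separation of the cores of the edges and through the ports. Spokes are needed exactly where some `n`
has negative product with all edge directions. -/
theorem exists_stripData (Γ : PSLG) (hedge : ∀ v ∈ Γ.verts, ∃ b, Γ.Adj v b) :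
    Nonempty (StripData Γ) := by
  classical
  have hspoke : ∀ v : ℂ, ∃ w : ℂ, v ∈ Γ.verts →
      (¬ ∃ n, ∀ b, Γ.Adj v b → dot (udir v b) n < 0) ∨
      (‖w‖ = 1 ∧ (∀ b, Γ.Adj v b → dot (udir v b) w ≤ 0) ∧
        ∀ n, (∀ b, Γ.Adj v b → dot (udir v b) n < 0) → 0 ≤ dot w n) := by
    intro v
    by_cases hv : v ∈ Γ.verts
    · by_cases hn : ∃ n, ∀ b, Γ.Adj v b → dot (udir v b) n < 0
      · obtain ⟨n₀, hn₀⟩ := hn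
        set D : Finset ℂ := (Γ.verts.filter fun b => Γ.Adj v b).image (udir v)
        have hD : ∀ d, d ∈ D ↔ ∃ b, Γ.Adj v b ∧ udir v b = d := fun d => by
          simp only [D, Finset.mem_image, Finset.mem_filter]
          exact exists_congr fun b => ⟨fun h => ⟨h.1.2, h.2⟩, fun h => ⟨⟨h.1.right, h.1⟩, h.2⟩⟩
        obtain ⟨b, hb⟩ := hedge v hv
        obtain ⟨w, hw1, hw2, hw3⟩ := exists_spoke D ⟨_, (hD _).2 ⟨b, hb, rfl⟩⟩ (n₀ := n₀) (by
          intro d hd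
          obtain ⟨b, hb, rfl⟩ := (hD d).1 hd
          exact hn₀ b hb)
        refine ⟨w, fun _ => Or.inr ⟨hw1, fun b hb => hw2 _ ((hD _).2 ⟨b, hb, rfl⟩), fun n hn =>
          hw3 n fun d hd => ?_⟩⟩
        obtain ⟨b, hb, rfl⟩ := (hD d).1 hd
        exact hn b hb
      · exact ⟨0, fun _ => Or.inl hn⟩
    · exact ⟨0, fun h => absurd h hv⟩
  choose w hw using hspoke
  have hR := (eventually_const_mul (show (0 : ℝ) < 8 by norm_num) Γ.eventually_edge_sep).and
    (eventually_const_mul (show (0 : ℝ) < 8 by norm_num) Γ.eventually_vert_sep)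
  obtain ⟨r, hr, hR⟩ := eventually_nhdsGT_zero_iff.1 hR
  obtain ⟨hR1, hR2⟩ := hR (r / 2) (by positivity) (by linarith)
  have hR0 : 0 < r / 2 := by positivity
  set R := r / 2
  have hδ : ∀ᶠ δ in 𝓝[>] (0 : ℝ), ∀ a ∈ Γ.verts, ∀ b ∈ Γ.verts, Γ.Adj a b →
      (∀ m ∈ hexNormals, m ≠ port (udir a b) (Complex.I * udir a b) → ∀ x y : ℝ, 0 < y → y ≤ δ →
        x * dot (udir a b) (port (udir a b) (Complex.I * udir a b)) +
          y * dot (Complex.I * udir a b) (port (udir a b) (Complex.I * udir a b)) = R →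
        x * dot (udir a b) m + y * dot (Complex.I * udir a b) m < R) ∧
      (∀ m ∈ hexNormals, m ≠ port (udir a b) (-(Complex.I * udir a b)) → ∀ x y : ℝ, 0 < y → y ≤ δ →
        x * dot (udir a b) (port (udir a b) (-(Complex.I * udir a b))) +
          y * dot (-(Complex.I * udir a b)) (port (udir a b) (-(Complex.I * udir a b))) = R →
        x * dot (udir a b) m + y * dot (-(Complex.I * udir a b)) m < R) := by
    rw [Filter.eventually_all_finset]
    intro a _
    rw [Filter.eventually_all_finset]
    intro b _
    by_cases hab : Γ.Adj a b
    · filter_upwards [eventually_port_lt hab.norm (Or.inl rfl) hR0,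
        eventually_port_lt hab.norm (Or.inr rfl) hR0] with δ h1 h2 _
      exact ⟨h1, h2⟩
    · exact Eventually.of_forall fun _ h => absurd h hab
  obtain ⟨d, hd, hδ⟩ := eventually_nhdsGT_zero_iff.1 (hδ.and
    (eventually_const_mul (show (0 : ℝ) < 4 by norm_num)
      (Γ.eventually_core_sep (show 0 < R / 2 by positivity))))
  have hm : 0 < min d (R / 10) := by positivity
  obtain ⟨hδ1, hδ2⟩ := hδ (min d (R / 10) / 2) (by positivity)
    (by have := min_le_left d (R / 10); linarith)
  refine ⟨⟨R, min d (R / 10) / 2, Γ.verts.filter fun v => ∃ n, ∀ b, Γ.Adj v b →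
    dot (udir v b) n < 0, w, hR0, by positivity, ?_, hR2, hR1, hδ2, Finset.filter_subset _ _, ?_, ?_, ?_, ?_⟩⟩
  · have := min_le_right d (R / 10)
    linarith
  · intro v hv
    rw [Finset.mem_filter] at hv
    exact ((hw v hv.1).resolve_left (not_not.2 hv.2)).1
  · intro v hv
    rw [Finset.mem_filter] at hv
    exact ((hw v hv.1).resolve_left (not_not.2 hv.2)).2.1
  · intro v hv n
    by_cases h : ∃ b, Γ.Adj v b ∧ 0 ≤ dot (udir v b) n
    · exact Or.inl h
    · push Not at h
      have hn : ∃ n, ∀ b, Γ.Adj v b → dot (udir v b) n < 0 := ⟨n, h⟩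
      exact Or.inr ⟨Finset.mem_filter.2 ⟨hv, hn⟩,
        ((hw v hv).resolve_left (not_not.2 hn)).2.2 n h⟩
  · rintro a b J hab (rfl | rfl)
    · exact (hδ1 a hab.left b hab.right hab).1
    · exact (hδ1 a hab.left b hab.right hab).2

/-! ### Geometry of hexagons, strips and spokes -/

namespace StripData

variable {Γ : PSLG} (S : StripData Γ)

/-- The open hexagon around a vertex. -/
def hex (v : ℂ) : Set ℂ := {z | hexNorm (z - v) < S.R}

/-- The closed hexagon around a vertex. -/
def chex (v : ℂ) : Set ℂ := {z | hexNorm (z - v) ≤ S.R}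

/-- The closed strip along an edge `ab`, on the side of `J`. -/
def strip (a b J : ℂ) : Set ℂ :=
  {z | 0 ≤ dot (z - a) J ∧ dot (z - a) J ≤ S.δ ∧ S.R ≤ dot (z - a) (port (udir a b) J) ∧
    S.R ≤ dot (z - b) (port (udir b a) J)}

/-- The interior of the strip along an edge. -/
def ostrip (a b J : ℂ) : Set ℂ :=
  {z | 0 < dot (z - a) J ∧ dot (z - a) J < S.δ ∧ S.R < dot (z - a) (port (udir a b) J) ∧
    S.R < dot (z - b) (port (udir b a) J)}

/-- The point where the ray of direction `u` leaves the hexagon around `v`. -/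
noncomputable def hexExit (v u : ℂ) : ℂ := v + (S.R / hexNorm u : ℝ) * u

/-- The spoke from `v`. -/
noncomputable def spokeSeg (v : ℂ) : Set ℂ := segment ℝ v (S.hexExit v (S.spokeDir v))

/-- The endpoint near `a` of the side of a strip that is opposite to the edge. -/
noncomputable def topEnd (a b J : ℂ) : ℂ :=
  a + ((S.R - S.δ * dot J (port (udir a b) J)) / dot (udir a b) (port (udir a b) J) : ℝ) * udir a b +
    S.δ * J

/-- The side of a strip that is opposite to the edge. -/
noncomputable def topSeg (a b J : ℂ) : Set ℂ := segment ℝ (S.topEnd a b J) (S.topEnd b a J)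

theorem hex_subset_chex (v : ℂ) : S.hex v ⊆ S.chex v := by
  intro z h
  have h : hexNorm (z - v) < S.R := h
  exact h.le

theorem isClosed_chex (v : ℂ) : IsClosed (S.chex v) :=
  isClosed_le (continuous_hexNorm.comp (by fun_prop)) continuous_const

theorem isOpen_hex (v : ℂ) : IsOpen (S.hex v) :=
  isOpen_lt (continuous_hexNorm.comp (by fun_prop)) continuous_const

theorem convex_hex (v : ℂ) : Convex ℝ (S.hex v) := by
  have : S.hex v = ⋂ n ∈ hexNormals, {z | dot (z - v) n < S.R} := by
    ext z
    simp only [hex, Set.mem_ofPred_eq, hexNorm_lt_iff, Set.mem_iInter]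
  rw [this]
  exact convex_iInter₂ fun n _ => convex_dot_lt v n S.R

theorem isClosed_strip (a b J : ℂ) : IsClosed (S.strip a b J) := by
  have : S.strip a b J = (fun z => dot (z - a) J) ⁻¹' Set.Icc 0 S.δ ∩
      ((fun z => dot (z - a) (port (udir a b) J)) ⁻¹' Set.Ici S.R ∩
        (fun z => dot (z - b) (port (udir b a) J)) ⁻¹' Set.Ici S.R) := by
    ext z
    exact and_assoc.symm
  rw [this]
  exact (isClosed_Icc.preimage (by fun_prop)).inter
    ((isClosed_Ici.preimage (by fun_prop)).inter (isClosed_Ici.preimage (by fun_prop)))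

theorem isOpen_ostrip (a b J : ℂ) : IsOpen (S.ostrip a b J) := by
  have : S.ostrip a b J = (fun z => dot (z - a) J) ⁻¹' Set.Ioo 0 S.δ ∩
      ((fun z => dot (z - a) (port (udir a b) J)) ⁻¹' Set.Ioi S.R ∩
        (fun z => dot (z - b) (port (udir b a) J)) ⁻¹' Set.Ioi S.R) := by
    ext z
    exact and_assoc.symm
  rw [this]
  exact (isOpen_Ioo.preimage (by fun_prop)).inter
    ((isOpen_Ioi.preimage (by fun_prop)).inter (isOpen_Ioi.preimage (by fun_prop)))

theorem convex_ostrip (a b J : ℂ) : Convex ℝ (S.ostrip a b J) :=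
  (convex_lt_dot a J 0).inter ((convex_dot_lt a J S.δ).inter
    ((convex_lt_dot a (port (udir a b) J) S.R).inter (convex_lt_dot b (port (udir b a) J) S.R)))

theorem ostrip_subset_strip (a b J : ℂ) : S.ostrip a b J ⊆ S.strip a b J :=
  fun _ h => ⟨h.1.le, h.2.1.le, h.2.2.1.le, h.2.2.2.le⟩

theorem dist_le_of_mem_chex {v z : ℂ} (h : z ∈ S.chex v) : dist z v ≤ 2 * S.R := by
  have h1 := norm_le_hexNorm (z - v)
  have h2 : hexNorm (z - v) ≤ S.R := h
  have h3 := sqrt_three_bounds.1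
  rw [dist_eq_norm]
  nlinarith [norm_nonneg (z - v)]

theorem center_mem_hex (v : ℂ) : v ∈ S.hex v := by
  have : hexNorm (v - v) ≤ 0 := (hexNorm_le_norm _).trans (by simp)
  exact this.trans_lt S.R_pos

theorem eq_of_mem_chex {v v' z : ℂ} (hv : v ∈ Γ.verts) (hv' : v' ∈ Γ.verts) (h : z ∈ S.chex v)
    (h' : z ∈ S.chex v') : v = v' := by
  by_contra hne
  have h1 := S.vert_sep v hv v' hv' hne
  have h2 := S.dist_le_of_mem_chex h
  have h3 := S.dist_le_of_mem_chex h'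
  have h4 := dist_triangle_left v v' z
  have := S.R_pos
  linarith

variable {a b J z : ℂ}

theorem isSide_swap (hJ : IsSide (udir a b) J) : IsSide (udir b a) J := by
  rw [udir_symm]
  exact hJ.neg_left

theorem dot_sub_side (hab : a ≠ b) (hJ : IsSide (udir a b) J) (z : ℂ) :
    dot (z - a) J = dot (z - b) J := by
  have h : z - a = (z - b) + ‖b - a‖ * udir a b := by
    rw [← sub_eq_norm_mul_udir hab]; ring
  rw [h, dot_add_left, dot_smul_left, hJ.dot_eq_zero]
  ring

theorem dot_sub_udir (hab : a ≠ b) (z : ℂ) :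
    dot (z - b) (udir b a) = ‖b - a‖ - dot (z - a) (udir a b) := by
  have h : z - b = (z - a) - ‖b - a‖ * udir a b := by
    rw [← sub_eq_norm_mul_udir hab]; ring
  rw [udir_symm, h, dot_neg_right, dot_sub_left, dot_smul_left, dot_self, norm_udir hab]
  ring

theorem strip_symm (hab : a ≠ b) (hJ : IsSide (udir a b) J) : S.strip a b J = S.strip b a J := by
  ext z
  simp only [strip, Set.mem_ofPred_eq, dot_sub_side hab hJ]
  tauto

section

variable (hab : Γ.Adj a b) (hJ : IsSide (udir a b) J)
include hab hJ

/-- The port condition reads `x * hexNorm u + y * dot J n ≥ R` with `y ≤ δ < R / 10` and `hexNorm u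
≤ 1`, which gives the factor 9/10. -/
theorem le_dot_of_mem_strip (hz : z ∈ S.strip a b J) : 9 / 10 * S.R ≤ dot (z - a) (udir a b) := by
  obtain ⟨h1, h2, h3, -⟩ := hz
  obtain ⟨hn, hn1, -⟩ := port_spec hab.norm hJ
  have hδ := S.δ_lt
  have hR := S.R_pos
  have hu := hexNorm_unit hab.norm
  rw [hJ.dot_eq hab.norm, hn1] at h3
  have h4 : dot J (port (udir a b) J) ≤ 1 := by
    rw [← hJ.norm hab.norm]
    exact dot_le_norm (norm_of_mem_hexNormals hn)
  have h5 : dot (z - a) J * dot J (port (udir a b) J) ≤ S.R / 10 := by nlinarith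
  have h6 : 9 / 10 * S.R ≤ dot (z - a) (udir a b) * hexNorm (udir a b) := by linarith
  have h0 : 0 < √3 := Real.sqrt_pos.2 (by norm_num)
  by_contra! hcon
  rcases le_or_gt (dot (z - a) (udir a b)) 0 with h | h
  · nlinarith
  · nlinarith

/-- The foot of a point of a strip on the edge. -/
theorem exists_foot (hz : z ∈ S.strip a b J) : ∃ p ∈ closedEdge s(a, b),
    z = p + dot (z - a) J * J ∧ 9 / 10 * S.R ≤ dist p a ∧ 9 / 10 * S.R ≤ dist p b := by
  have h1 := S.le_dot_of_mem_strip hab hJ hz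
  have h2 := S.le_dot_of_mem_strip hab.symm (isSide_swap hJ) (S.strip_symm hab.ne hJ ▸ hz)
  rw [dot_sub_udir hab.ne] at h2
  have hR := S.R_pos
  have hb := sub_eq_norm_mul_udir hab.ne
  set x := dot (z - a) (udir a b)
  have hL : 0 < ‖b - a‖ := by linarith
  have hLC : (‖b - a‖ : ℂ) ≠ 0 := by exact_mod_cast hL.ne'
  refine ⟨a + x * udir a b, ?_, ?_, ?_, ?_⟩
  · rw [closedEdge_mk, mem_segment_complex]
    refine ⟨x / ‖b - a‖, div_nonneg (by linarith) hL.le, (div_le_one hL).2 (by linarith), ?_⟩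
    rw [hb]
    simp only [norm_mul, hab.norm]
    push_cast
    simp only [Complex.norm_real, norm_norm, mul_one]
    field_simp
  · linear_combination hJ.eq_add hab.norm (z - a)
  · rw [dist_eq_norm, add_sub_cancel_left, norm_mul, hab.norm, mul_one, Complex.norm_real]
    exact h1.trans (le_abs_self _)
  · have : a + x * udir a b - b = -((‖b - a‖ - x : ℝ) * udir a b) := by
      push_cast
      linear_combination -hb
    rw [dist_eq_norm, this, norm_neg, norm_mul, hab.norm, mul_one, Complex.norm_real]
    exact h2.trans (le_abs_self _)

theorem dist_foot {p : ℂ} (hz : z ∈ S.strip a b J) (hp : z = p + dot (z - a) J * J) :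
    dist z p ≤ S.δ := by
  have h : z - p = dot (z - a) J * J := by linear_combination hp
  rw [dist_eq_norm, h, norm_mul, hJ.norm hab.norm, mul_one, Complex.norm_real, Real.norm_eq_abs,
    abs_of_nonneg hz.1]
  exact hz.2.1

theorem lt_dist_of_mem_strip (hz : z ∈ S.strip a b J) {v : ℂ} (hv : v ∈ Γ.verts) (hva : v ≠ a)
    (hvb : v ≠ b) : 7 * S.R < dist z v := by
  obtain ⟨p, hp, hzp, -⟩ := S.exists_foot hab hJ hz
  have h1 := S.dist_foot hab hJ hz hzp
  have h2 := S.edge_sep _ hab v hv (by simp [hva, hvb]) p hp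
  have h3 := dist_triangle_left p v z
  have := S.δ_lt
  have := S.R_pos
  linarith

theorem eq_of_mem_strip_of_mem_chex (hz : z ∈ S.strip a b J) {v : ℂ} (hv : v ∈ Γ.verts)
    (hzv : z ∈ S.chex v) : (v = a ∧ dot (z - a) (port (udir a b) J) = S.R) ∨
      (v = b ∧ dot (z - b) (port (udir b a) J) = S.R) := by
  by_cases hva : v = a
  · subst hva
    exact Or.inl ⟨rfl, le_antisymm (hexNorm_le_iff.1 hzv _ (port_spec hab.norm hJ).1) hz.2.2.1⟩
  by_cases hvb : v = b
  · subst hvb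
    exact Or.inr ⟨rfl, le_antisymm
      (hexNorm_le_iff.1 hzv _ (port_spec hab.symm.norm (isSide_swap hJ)).1) hz.2.2.2⟩
  have h1 := S.lt_dist_of_mem_strip hab hJ hz hv hva hvb
  have h2 := S.dist_le_of_mem_chex hzv
  have := S.R_pos
  linarith

theorem edge_eq_of_near {f : Sym2 ℂ} (hf : f ∈ Γ.edges) {p q : ℂ} (hp : p ∈ closedEdge s(a, b))
    (hpa : 9 / 10 * S.R ≤ dist p a) (hpb : 9 / 10 * S.R ≤ dist p b) (hq : q ∈ closedEdge f)
    (hpq : dist p q ≤ 4 * S.δ) : s(a, b) = f := by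
  by_contra hne
  have := S.core_sep _ hab f hf hne p hp q hq (fun v hv => ?_)
  · linarith
  · have := S.R_pos
    rcases Sym2.mem_iff.1 hv with rfl | rfl <;> linarith

/-- The foot of `z` on `ab` is far from both ends and within `δ` of the graph, so `core_sep` leaves
only the edge `ab` itself. -/
theorem dot_eq_zero_of_mem_strip_of_mem_carrier (hz : z ∈ S.strip a b J) (hzΓ : z ∈ Γ.carrier) :
    dot (z - a) J = 0 := by
  obtain ⟨p, hp, hzp, hpa, hpb⟩ := S.exists_foot hab hJ hz
  have h1 := S.dist_foot hab hJ hz hzp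
  have hδ := S.δ_lt
  have hδ0 := S.δ_pos
  have hR := S.R_pos
  rcases Γ.mem_carrier.1 hzΓ with h | ⟨f, hf, h⟩
  · exfalso
    by_cases hza : z = a
    · rw [dist_comm, hza] at h1; linarith
    by_cases hzb : z = b
    · rw [dist_comm, hzb] at h1; linarith
    have := S.lt_dist_of_mem_strip hab hJ hz h hza hzb
    rw [dist_self] at this
    linarith
  · have h' := openEdge_subset_closedEdge f h
    have := S.edge_eq_of_near hab hJ hf hp hpa hpb h' (by rw [dist_comm]; linarith)
    subst this
    rw [closedEdge_mk, mem_segment_complex] at h'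
    obtain ⟨t, -, -, rfl⟩ := h'
    rw [add_sub_cancel_left, sub_eq_norm_mul_udir hab.ne, dot_smul_left, dot_smul_left,
      hJ.dot_eq_zero]
    ring

/-- The feet of a common point are within `2 * δ`, so the edges agree; strips on opposite sides of
an edge meet only on the edge. -/
theorem eq_of_mem_strip_of_mem_strip {a' b' J' : ℂ} (hab' : Γ.Adj a' b')
    (hJ' : IsSide (udir a' b') J') (hz : z ∈ S.strip a b J) (hz' : z ∈ S.strip a' b' J') :
    (s(a, b) = s(a', b') ∧ J = J') ∨ dot (z - a) J = 0 := by
  obtain ⟨p, hp, hzp, hpa, hpb⟩ := S.exists_foot hab hJ hz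
  obtain ⟨p', hp', hzp', -⟩ := S.exists_foot hab' hJ' hz'
  have h1 := S.dist_foot hab hJ hz hzp
  have h2 := S.dist_foot hab' hJ' hz' hzp'
  have hδ := S.δ_pos
  have he := S.edge_eq_of_near hab hJ hab' hp hpa hpb hp'
    (by have := dist_triangle_left p p' z; linarith)
  have hside : IsSide (udir a b) J' ∧ z ∈ S.strip a b J' := by
    rcases Sym2.eq_iff.1 he with ⟨rfl, rfl⟩ | ⟨rfl, rfl⟩
    · exact ⟨hJ', hz'⟩
    · exact ⟨isSide_swap hJ', (S.strip_symm hab'.ne hJ') ▸ hz'⟩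
  by_cases hJJ : J = J'
  · exact Or.inl ⟨he, hJJ⟩
  right
  have hneg : J' = -J := by
    rcases hJ with h | h <;> rcases hside.1 with h' | h'
    · exact absurd (h.trans h'.symm) hJJ
    · rw [h, h']
    · rw [h, h', neg_neg]
    · exact absurd (h.trans h'.symm) hJJ
  have h3 := hside.2.1
  rw [hneg, dot_neg_right] at h3
  linarith [hz.1]

/-- Within the strip's range of heights the port side alone decides membership in the hexagon, so
that hexagon and strip fit together along it. -/
theorem mem_chex_of_dot_le (hx : 0 ≤ dot (z - a) (udir a b)) (hy : 0 ≤ dot (z - a) J)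
    (hyδ : dot (z - a) J ≤ S.δ) (h : dot (z - a) (port (udir a b) J) ≤ S.R) : z ∈ S.chex a := by
  refine hexNorm_le_iff.2 fun m hm => ?_
  by_cases hmn : m = port (udir a b) J
  · rwa [hmn]
  obtain ⟨hn, hn1, -⟩ := port_spec hab.norm hJ
  have hlt := S.port_lt a b J hab hJ m hm hmn
  rw [hJ.dot_eq hab.norm] at h ⊢
  have hpos : 0 < dot (udir a b) (port (udir a b) J) := by
    rw [hn1]
    exact lt_of_lt_of_le (by positivity) (hexNorm_unit hab.norm).1
  have hle : dot (udir a b) m ≤ dot (udir a b) (port (udir a b) J) := by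
    rw [hn1]; exact dot_le_hexNorm hm
  rcases hy.eq_or_lt with h0 | h0
  · rw [← h0] at h ⊢
    nlinarith
  · have hlt' := hlt ((S.R - dot (z - a) J * dot J (port (udir a b) J)) /
      dot (udir a b) (port (udir a b) J)) (dot (z - a) J) h0 hyδ (by field_simp; ring)
    -- If `m` points forward, compare with the point of the port line at the same height; if it
    -- points backward, the product is at most `δ`.
    rcases le_or_gt 0 (dot (udir a b) m) with h1 | h1
    · have : dot (z - a) (udir a b) ≤ (S.R - dot (z - a) J * dot J (port (udir a b) J)) /
          dot (udir a b) (port (udir a b) J) := by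
        rw [le_div_iff₀ hpos]; linarith
      have := mul_le_mul_of_nonneg_right this h1
      linarith
    · have h2 : dot J m ≤ 1 := by
        rw [← hJ.norm hab.norm]
        exact dot_le_norm (norm_of_mem_hexNormals hm)
      have := S.δ_lt
      nlinarith

end

theorem eq_of_mem_carrier_of_near {v : ℂ} (hv : v ∈ Γ.verts) (hz : z ∈ Γ.carrier)
    (hzv : dist z v ≤ 2 * S.R) :
    z = v ∨ ∃ b, Γ.Adj v b ∧ ∃ τ : ℝ, 0 < τ ∧ τ ≤ 2 * S.R ∧ z = v + τ * udir v b := by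
  have hR := S.R_pos
  by_cases hzv' : z = v
  · exact Or.inl hzv'
  right
  rcases Γ.mem_carrier.1 hz with h | ⟨e, he, h⟩
  · have := S.vert_sep z h v hv hzv'
    linarith
  · have h := openEdge_subset_closedEdge e h
    have hve : v ∈ e := by
      by_contra hve
      have := S.edge_sep e he v hv hve z h
      linarith
    obtain ⟨b, rfl⟩ := Sym2.mem_iff_exists.1 hve
    have hvb : Γ.Adj v b := he
    rw [closedEdge_mk, mem_segment_complex] at h
    obtain ⟨t, h0, -, ht⟩ := h
    have ht' : z = v + (t * ‖b - v‖ : ℝ) * udir v b := by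
      rw [ht, sub_eq_norm_mul_udir hvb.ne]
      push_cast
      simp only [norm_mul, hvb.norm, Complex.norm_real, norm_norm]
      push_cast
      ring
    refine ⟨b, hvb, t * ‖b - v‖, ?_, ?_, ht'⟩
    · refine lt_of_le_of_ne (by positivity) fun h => hzv' ?_
      rw [ht', ← h]
      simp
    · rw [dist_eq_norm, ht', add_sub_cancel_left, norm_mul, hvb.norm, mul_one,
        Complex.norm_real] at hzv
      exact (le_abs_self _).trans hzv

theorem mem_openEdge_of_near (hab : Γ.Adj a b) {τ : ℝ} (h0 : 0 < τ) (h1 : τ ≤ 2 * S.R) :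
    a + τ * udir a b ∈ openEdge s(a, b) := by
  have hL := S.vert_sep a hab.left b hab.right hab.ne
  rw [dist_comm, dist_eq_norm] at hL
  have hR := S.R_pos
  have hL0 : 0 < ‖b - a‖ := by linarith
  have hLC : (‖b - a‖ : ℂ) ≠ 0 := by exact_mod_cast hL0.ne'
  refine mem_openSegment_complex.2 ⟨τ / ‖b - a‖, by positivity, (div_lt_one hL0).2 (by linarith), ?_⟩
  rw [udir]
  push_cast
  ring

theorem mem_carrier_of_near (hab : Γ.Adj a b) {τ : ℝ} (h0 : 0 ≤ τ) (h1 : τ ≤ 2 * S.R) :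
    a + τ * udir a b ∈ Γ.carrier := by
  rcases h0.eq_or_lt with rfl | h
  · simpa using Γ.mem_carrier.2 (Or.inl hab.left)
  · exact Γ.closedEdge_subset_carrier hab
      (openEdge_subset_closedEdge _ (S.mem_openEdge_of_near hab h h1))

theorem mem_chex_or_mem_strip (hab : Γ.Adj a b) (hJ : IsSide (udir a b) J)
    (hz : z ∈ closedEdge s(a, b)) : z ∈ S.chex a ∨ z ∈ S.chex b ∨ z ∈ S.strip a b J := by
  have key : ∀ a b : ℂ, Γ.Adj a b → IsSide (udir a b) J → z ∈ segment ℝ a b →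
      z ∈ S.chex a ∨ S.R ≤ dot (z - a) (port (udir a b) J) := by
    intro a b hab hJ hz
    obtain ⟨t, h0, -, ht⟩ := mem_segment_complex.1 hz
    have hza : z - a = (t * ‖b - a‖ : ℝ) * udir a b := by
      rw [ht, add_sub_cancel_left]
      conv_lhs => rw [sub_eq_norm_mul_udir hab.ne]
      push_cast
      ring
    rw [chex, Set.mem_ofPred_eq, hza, hexNorm_smul (by positivity), dot_smul_left,
      (port_spec hab.norm hJ).2.1]
    exact le_total _ _
  rw [closedEdge_mk] at hz
  have hy : dot (z - a) J = 0 := by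
    obtain ⟨t, h0, -, rfl⟩ := mem_segment_complex.1 hz
    rw [add_sub_cancel_left, dot_smul_left, sub_eq_norm_mul_udir hab.ne, dot_smul_left,
      hJ.dot_eq_zero]
    ring
  rcases key a b hab hJ hz with h | h
  · exact Or.inl h
  rcases key b a hab.symm (isSide_swap hJ) (segment_symm ℝ a b ▸ hz) with h' | h'
  · exact Or.inr (Or.inl h')
  exact Or.inr (Or.inr ⟨hy.ge, hy.le.trans S.δ_pos.le, h, h'⟩)

theorem hexNorm_pos {u : ℂ} (hu : ‖u‖ = 1) : 0 < hexNorm u :=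
  lt_of_lt_of_le (by positivity) (hexNorm_unit hu).1

theorem hexNorm_hexExit {v u : ℂ} (hu : ‖u‖ = 1) : hexNorm (S.hexExit v u - v) = S.R := by
  have := hexNorm_pos hu
  rw [hexExit, add_sub_cancel_left, hexNorm_smul (div_nonneg S.R_pos.le this.le)]
  field_simp

theorem mem_spokeSeg {v : ℂ} (hv : v ∈ S.spokes) : z ∈ S.spokeSeg v ↔
    ∃ t : ℝ, 0 ≤ t ∧ t * hexNorm (S.spokeDir v) ≤ S.R ∧ z = v + t * S.spokeDir v := by
  have hw := hexNorm_pos (S.norm_spokeDir v hv)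
  have hR := S.R_pos
  have hpos : 0 < S.R / hexNorm (S.spokeDir v) := by positivity
  rw [spokeSeg, mem_segment_complex]
  constructor
  · rintro ⟨t, h0, h1, rfl⟩
    refine ⟨t * (S.R / hexNorm (S.spokeDir v)), by positivity, ?_, ?_⟩
    · rw [mul_assoc, div_mul_cancel₀ _ hw.ne']
      nlinarith
    · rw [hexExit]
      push_cast
      ring
  · rintro ⟨t, h0, h1, rfl⟩
    refine ⟨t / (S.R / hexNorm (S.spokeDir v)), by positivity, ?_, ?_⟩
    · rw [div_le_one hpos, le_div_iff₀ hw]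
      exact h1
    · have hC : ((S.R / hexNorm (S.spokeDir v) : ℝ) : ℂ) ≠ 0 := by exact_mod_cast hpos.ne'
      rw [hexExit, Complex.ofReal_div t, add_sub_cancel_left, ← mul_assoc, div_mul_cancel₀ _ hC]

theorem spokeSeg_subset_chex {v : ℂ} (hv : v ∈ S.spokes) : S.spokeSeg v ⊆ S.chex v := by
  intro z hz
  obtain ⟨t, h0, h1, rfl⟩ := (S.mem_spokeSeg hv).1 hz
  rwa [chex, Set.mem_ofPred_eq, add_sub_cancel_left, hexNorm_smul h0]

/-- The spoke makes no acute angle with an edge at `v`, and no other edge comes near the hexagon. -/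
theorem eq_of_mem_spokeSeg_of_mem_carrier {v : ℂ} (hv : v ∈ S.spokes) (hz : z ∈ S.spokeSeg v)
    (hzΓ : z ∈ Γ.carrier) : z = v := by
  rcases S.eq_of_mem_carrier_of_near (S.spokes_subset hv) hzΓ
    (S.dist_le_of_mem_chex (S.spokeSeg_subset_chex hv hz)) with h | ⟨b, hb, τ, h0, -, h⟩
  · exact h
  obtain ⟨t, ht0, -, ht⟩ := (S.mem_spokeSeg hv).1 hz
  exfalso
  have h1 := S.spokeDir_le v hv b hb
  have heq : (τ : ℂ) * udir v b = t * S.spokeDir v := by linear_combination ht - h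
  have h2 := congrArg (dot · (udir v b)) heq
  simp only [dot_smul_left, dot_self, hb.norm] at h2
  rw [dot_comm] at h1
  nlinarith

/-- Points of a strip are at least `9/10 * R` ahead in the direction of its edge, while the spoke
never advances in that direction. -/
theorem notMem_spokeSeg_of_mem_strip (hab : Γ.Adj a b) (hJ : IsSide (udir a b) J)
    (hz : z ∈ S.strip a b J) {v : ℂ} (hv : v ∈ S.spokes) : z ∉ S.spokeSeg v := by
  intro hzv
  have hR := S.R_pos
  have key : ∀ b, Γ.Adj v b → 9 / 10 * S.R ≤ dot (z - v) (udir v b) → False := by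
    intro b hb h
    obtain ⟨t, ht0, -, ht⟩ := (S.mem_spokeSeg hv).1 hzv
    have h1 := S.spokeDir_le v hv b hb
    rw [ht, add_sub_cancel_left, dot_smul_left, dot_comm] at h
    nlinarith
  rcases S.eq_of_mem_strip_of_mem_chex hab hJ hz (S.spokes_subset hv)
    (S.spokeSeg_subset_chex hv hzv) with ⟨rfl, -⟩ | ⟨rfl, -⟩
  · exact key b hab (S.le_dot_of_mem_strip hab hJ hz)
  · exact key a hab.symm (S.le_dot_of_mem_strip hab.symm (isSide_swap hJ)
      (S.strip_symm hab.ne hJ ▸ hz))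

theorem topEnd_sub (a b J : ℂ) : S.topEnd a b J - a =
    ((S.R - S.δ * dot J (port (udir a b) J)) / dot (udir a b) (port (udir a b) J) : ℝ) * udir a b +
      S.δ * J := by
  rw [topEnd]; ring

theorem dot_topEnd (hab : Γ.Adj a b) (hJ : IsSide (udir a b) J) :
    dot (S.topEnd a b J - a) J = S.δ ∧ dot (S.topEnd a b J - a) (port (udir a b) J) = S.R ∧
      dot (S.topEnd a b J - a) (udir a b) =
        (S.R - S.δ * dot J (port (udir a b) J)) / dot (udir a b) (port (udir a b) J) := by
  have hpos : 0 < dot (udir a b) (port (udir a b) J) := by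
    rw [(port_spec hab.norm hJ).2.1]
    exact hexNorm_pos hab.norm
  rw [topEnd_sub]
  refine ⟨?_, ?_, ?_⟩
  · rw [dot_add_left, dot_smul_left, dot_smul_left, hJ.dot_eq_zero, dot_self, hJ.norm hab.norm]
    ring
  · rw [dot_add_left, dot_smul_left, dot_smul_left]
    field_simp
    ring
  · rw [dot_add_left, dot_smul_left, dot_smul_left, dot_comm J (udir a b), hJ.dot_eq_zero, dot_self,
      hab.norm]
    ring

theorem eq_topEnd (hab : Γ.Adj a b) (hJ : IsSide (udir a b) J) (h1 : dot (z - a) J = S.δ)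
    (h2 : dot (z - a) (port (udir a b) J) = S.R) : z = S.topEnd a b J := by
  have hpos : 0 < dot (udir a b) (port (udir a b) J) := by
    rw [(port_spec hab.norm hJ).2.1]
    exact hexNorm_pos hab.norm
  rw [hJ.dot_eq hab.norm, h1] at h2
  have hx : dot (z - a) (udir a b) =
      (S.R - S.δ * dot J (port (udir a b) J)) / dot (udir a b) (port (udir a b) J) := by
    rw [eq_div_iff hpos.ne']; linarith
  have := hJ.eq_add hab.norm (z - a)
  rw [h1, hx] at this
  rw [topEnd]
  linear_combination this

theorem topEnd_mem_chex (hab : Γ.Adj a b) (hJ : IsSide (udir a b) J) :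
    S.topEnd a b J ∈ S.chex a := by
  obtain ⟨h1, h2, h3⟩ := S.dot_topEnd hab hJ
  refine S.mem_chex_of_dot_le hab hJ ?_ (h1.ge.trans' S.δ_pos.le) h1.le h2.le
  have hpos : 0 < dot (udir a b) (port (udir a b) J) := by
    rw [(port_spec hab.norm hJ).2.1]
    exact hexNorm_pos hab.norm
  rw [h3]
  refine div_nonneg ?_ hpos.le
  have h4 : dot J (port (udir a b) J) ≤ 1 := by
    rw [← hJ.norm hab.norm]
    exact dot_le_norm (norm_of_mem_hexNormals (port_spec hab.norm hJ).1)
  nlinarith [S.δ_lt, S.δ_pos]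

theorem topEnd_mem_strip (hab : Γ.Adj a b) (hJ : IsSide (udir a b) J) :
    S.topEnd a b J ∈ S.strip a b J := by
  obtain ⟨h1, h2, h3⟩ := S.dot_topEnd hab hJ
  refine ⟨h1.ge.trans' S.δ_pos.le, h1.le, h2.ge, ?_⟩
  have hnear := S.dist_le_of_mem_chex (S.topEnd_mem_chex hab hJ)
  have hsep := S.vert_sep a hab.left b hab.right hab.ne
  rw [dist_eq_norm] at hnear
  rw [dist_comm, dist_eq_norm] at hsep
  obtain ⟨hn, hn1, -⟩ := port_spec hab.symm.norm (isSide_swap hJ)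
  have hu := (hexNorm_unit hab.symm.norm).1
  have h4 := sqrt_three_bounds.1
  have hba : S.topEnd a b J - b = (S.topEnd a b J - a) + ‖b - a‖ * udir b a := by
    rw [udir_symm]
    linear_combination -sub_eq_norm_mul_udir hab.ne
  have h5 := (abs_le.1 (abs_dot_le_norm (z := S.topEnd a b J - a) (norm_of_mem_hexNormals hn))).1
  rw [hba, dot_add_left, dot_smul_left, hn1]
  nlinarith [S.R_pos]

theorem mem_topSeg (hab : Γ.Adj a b) (hJ : IsSide (udir a b) J) :
    z ∈ S.topSeg a b J ↔ z ∈ S.strip a b J ∧ dot (z - a) J = S.δ := by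
  have hA := S.topEnd_mem_strip hab hJ
  have hB : S.topEnd b a J ∈ S.strip a b J := by
    rw [S.strip_symm hab.ne hJ]
    exact S.topEnd_mem_strip hab.symm (isSide_swap hJ)
  obtain ⟨hA1, hA2, hA3⟩ := S.dot_topEnd hab hJ
  obtain ⟨hB1, hB2, hB3⟩ := S.dot_topEnd hab.symm (isSide_swap hJ)
  rw [← dot_sub_side hab.ne hJ] at hB1
  constructor
  · intro hz
    obtain ⟨t, h0, h1, rfl⟩ := mem_segment_complex.1 hz
    have hexp : ∀ c m, dot (S.topEnd a b J + t * (S.topEnd b a J - S.topEnd a b J) - c) m =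
        (1 - t) * dot (S.topEnd a b J - c) m + t * dot (S.topEnd b a J - c) m := by
      intro c m
      have e : S.topEnd a b J + t * (S.topEnd b a J - S.topEnd a b J) - c =
          ((1 - t : ℝ) : ℂ) * (S.topEnd a b J - c) + t * (S.topEnd b a J - c) := by push_cast; ring
      rw [e, dot_add_left, dot_smul_left, dot_smul_left]
    have hy : dot (S.topEnd a b J + t * (S.topEnd b a J - S.topEnd a b J) - a) J = S.δ := by
      rw [hexp, hA1, hB1]; ring
    refine ⟨⟨hy.ge.trans' S.δ_pos.le, hy.le, ?_, ?_⟩, hy⟩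
    · rw [hexp]
      nlinarith [hA.2.2.1, hB.2.2.1]
    · rw [hexp]
      nlinarith [hA.2.2.2, hB.2.2.2]
  · rintro ⟨hz, hy⟩
    have hpos : ∀ a b, Γ.Adj a b → IsSide (udir a b) J →
        0 < dot (udir a b) (port (udir a b) J) := fun a b hab hJ => by
      rw [(port_spec hab.norm hJ).2.1]
      exact hexNorm_pos hab.norm
    have key : ∀ a b, (hab : Γ.Adj a b) → (hJ : IsSide (udir a b) J) → z ∈ S.strip a b J →
        dot (z - a) J = S.δ →
        dot (S.topEnd a b J - a) (udir a b) ≤ dot (z - a) (udir a b) := by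
      intro a b hab hJ hz hy
      rw [(S.dot_topEnd hab hJ).2.2, div_le_iff₀ (hpos a b hab hJ)]
      have := hz.2.2.1
      rw [hJ.dot_eq hab.norm, hy] at this
      linarith
    have k1 := key a b hab hJ hz hy
    have k2 := key b a hab.symm (isSide_swap hJ) (S.strip_symm hab.ne hJ ▸ hz)
      (by rwa [← dot_sub_side hab.ne hJ])
    rw [dot_sub_udir hab.ne, dot_sub_udir hab.ne] at k2
    have hsub : ∀ p : ℂ, dot (p - a) J = S.δ →
        p = a + dot (p - a) (udir a b) * udir a b + S.δ * J := fun p hp => by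
      have := hJ.eq_add hab.norm (p - a)
      rw [hp] at this
      linear_combination this
    have eA := hsub _ hA1
    have eB := hsub _ hB1
    have ez := hsub _ hy
    set xA := dot (S.topEnd a b J - a) (udir a b)
    set xB := dot (S.topEnd b a J - a) (udir a b)
    set x := dot (z - a) (udir a b)
    rw [topSeg, mem_segment_complex]
    rcases eq_or_ne xA xB with h | h
    · exact ⟨0, le_rfl, zero_le_one, by rw [ez, eA]; simp [show x = xA by linarith]⟩
    · have hlt : 0 < xB - xA := sub_pos.2 (lt_of_le_of_ne (by linarith) h)
      refine ⟨(x - xA) / (xB - xA), div_nonneg (by linarith) hlt.le,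
        (div_le_one hlt).2 (by linarith), ?_⟩
      have e : x = xA + (x - xA) / (xB - xA) * (xB - xA) := by field_simp; ring
      have eC : (x : ℂ) = xA + ((x - xA) / (xB - xA) : ℝ) * (xB - xA) := by
        conv_lhs => rw [e]
        push_cast
        rfl
      rw [eA, eB]
      linear_combination ez + eC * udir a b

end StripData

theorem IsRay.dot_nonpos {K : Set ℂ} {x d n : ℂ} (h : IsRay K x d)
    (hK : ∀ z ∈ K, dot z n ≤ dot x n) : dot d n ≤ 0 := by
  obtain ⟨r, hr, h⟩ := h.exists_pos
  have := hK _ (h (r / 2) (by positivity) (by linarith))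
  rw [dot_add_left, dot_smul_left] at this
  nlinarith

theorem IsRay.dot_eq_zero {K : Set ℂ} {x d n : ℂ} (h : IsRay K x d)
    (hK : ∀ z ∈ K, dot z n = dot x n) : dot d n = 0 := by
  refine le_antisymm (h.dot_nonpos fun z hz => (hK z hz).le) ?_
  have := h.dot_nonpos (n := -n) fun z hz => by rw [dot_neg_right, dot_neg_right, hK z hz]
  rw [dot_neg_right] at this
  linarith

theorem IsSide.eq_or_eq_neg {u J d : ℂ} (hJ : IsSide u J) (hu : ‖u‖ = 1) (hd : ‖d‖ = 1)
    (h : dot d J = 0) : d = u ∨ d = -u := by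
  refine eq_or_eq_neg_of_norm_eq_one hu hd (t := dot d u) ?_
  have := hJ.eq_add hu d
  rw [h] at this
  simpa using this

theorem dot_le_of_eq_or_eq_neg {u d e : ℂ} (hu : ‖u‖ = 1) (hd : d = u ∨ d = -u)
    (he : e = u ∨ e = -u) (hne : d ≠ e) : dot d e ≤ 1 / 2 := by
  have h := dot_self u
  rw [hu] at h
  rcases hd with rfl | rfl <;> rcases he with rfl | rfl
  · exact absurd rfl hne
  · rw [dot_neg_right]; linarith
  · rw [dot_neg_left]; linarith
  · exact absurd rfl hne

/-! ### The added segments and their intersections -/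

/-- The segments added to a graph: spokes, sides of hexagons, and top sides of strips. -/
inductive Piece
  | spoke (v : ℂ)
  | side (v n : ℂ)
  -- The order of the ends records the side: the strip is to the left of the direction from `a` to
  -- `b`.
  | top (a b : ℂ)

namespace StripData

variable {Γ : PSLG} (S : StripData Γ)

open Classical in
/-- The pairs of adjacent vertices. -/
noncomputable def darts (_S : StripData Γ) : Finset (ℂ × ℂ) :=
  (Γ.verts ×ˢ Γ.verts).filter fun p => Γ.Adj p.1 p.2

theorem mem_darts {p : ℂ × ℂ} : p ∈ S.darts ↔ Γ.Adj p.1 p.2 := by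
  classical
  rw [darts, Finset.mem_filter, Finset.mem_product]
  exact ⟨fun h => h.2, fun h => ⟨⟨h.left, h.right⟩, h⟩⟩

open Classical in
theorem card_darts_le : S.darts.card ≤ 6 * Γ.verts.card := by
  have h1 : S.darts.card ≤ 2 * Γ.edges.card := by
    refine Finset.card_le_mul_card_image_of_maps_to (f := fun p : ℂ × ℂ => s(p.1, p.2))
      (fun p hp => S.mem_darts.1 hp) 2 fun e _ => ?_
    induction e with | _ a b =>
    refine (Finset.card_le_card (t := {(a, b), (b, a)}) fun p hp => ?_).trans Finset.card_le_two
    have := (Finset.mem_filter.1 hp).2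
    rcases Sym2.eq_iff.1 this with ⟨h, h'⟩ | ⟨h, h'⟩ <;> simp [Prod.ext_iff, h, h']
  have := Γ.card_edges_le
  omega

open Classical in
/-- All added segments. -/
noncomputable def pieces : Finset Piece :=
  S.spokes.image Piece.spoke ∪ (Γ.verts ×ˢ hexNormals).image (fun p => Piece.side p.1 p.2) ∪
    S.darts.image fun p => Piece.top p.1 p.2

theorem spoke_mem_pieces {v : ℂ} : Piece.spoke v ∈ S.pieces ↔ v ∈ S.spokes := by
  simp [pieces]

theorem side_mem_pieces {v n : ℂ} :
    Piece.side v n ∈ S.pieces ↔ v ∈ Γ.verts ∧ n ∈ hexNormals := by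
  simp [pieces]

theorem top_mem_pieces {a b : ℂ} : Piece.top a b ∈ S.pieces ↔ Γ.Adj a b := by
  simp [pieces, mem_darts]

/-- The first endpoint of an added segment. -/
noncomputable def pieceFst : Piece → ℂ
  | .spoke v => v
  | .side v n => hexCorner' v S.R n
  | .top a b => S.topEnd a b (Complex.I * udir a b)

/-- The second endpoint of an added segment. -/
noncomputable def pieceSnd : Piece → ℂ
  | .spoke v => S.hexExit v (S.spokeDir v)
  | .side v n => hexCorner v S.R n
  | .top a b => S.topEnd b a (Complex.I * udir a b)

/-- An added segment. -/
noncomputable def pieceSeg (i : Piece) : Set ℂ := segment ℝ (S.pieceFst i) (S.pieceSnd i)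

/-- The graph together with the added segments. -/
noncomputable def skeleton : Set ℂ := Γ.carrier ∪ ⋃ i ∈ S.pieces, S.pieceSeg i

open Classical in
/-- The vertices of the skeleton. -/
noncomputable def nodes : Finset ℂ :=
  Γ.verts ∪ S.spokes.image (fun v => S.hexExit v (S.spokeDir v)) ∪
    (Γ.verts ×ˢ hexNormals).image (fun p => hexCorner' p.1 S.R p.2) ∪
    (Γ.verts ×ˢ hexNormals).image (fun p => hexCorner p.1 S.R p.2) ∪
    S.darts.image (fun p => S.topEnd p.1 p.2 (Complex.I * udir p.1 p.2)) ∪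
    S.darts.image (fun p => S.topEnd p.2 p.1 (Complex.I * udir p.1 p.2)) ∪
    S.darts.image (fun p => S.hexExit p.1 (udir p.1 p.2))

theorem mem_nodes {z : ℂ} : z ∈ S.nodes ↔ z ∈ Γ.verts ∨
    (∃ v ∈ S.spokes, z = S.hexExit v (S.spokeDir v)) ∨
    (∃ v ∈ Γ.verts, ∃ n ∈ hexNormals, z = hexCorner' v S.R n ∨ z = hexCorner v S.R n) ∨
    (∃ a b, Γ.Adj a b ∧ (z = S.topEnd a b (Complex.I * udir a b) ∨
      z = S.topEnd b a (Complex.I * udir a b) ∨ z = S.hexExit a (udir a b))) := by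
  simp only [nodes, Finset.mem_union, Finset.mem_image, Finset.mem_product, Prod.exists, mem_darts]
  constructor
  · rintro ((((((h | ⟨v, h, rfl⟩) | ⟨v, n, ⟨h, h'⟩, rfl⟩) | ⟨v, n, ⟨h, h'⟩, rfl⟩) | ⟨a, b, h, rfl⟩) |
      ⟨a, b, h, rfl⟩) | ⟨a, b, h, rfl⟩)
    · exact Or.inl h
    · exact Or.inr (Or.inl ⟨v, h, rfl⟩)
    · exact Or.inr (Or.inr (Or.inl ⟨v, h, n, h', Or.inl rfl⟩))
    · exact Or.inr (Or.inr (Or.inl ⟨v, h, n, h', Or.inr rfl⟩))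
    · exact Or.inr (Or.inr (Or.inr ⟨a, b, h, Or.inl rfl⟩))
    · exact Or.inr (Or.inr (Or.inr ⟨a, b, h, Or.inr (Or.inl rfl)⟩))
    · exact Or.inr (Or.inr (Or.inr ⟨a, b, h, Or.inr (Or.inr rfl)⟩))
  · rintro (h | ⟨v, h, rfl⟩ | ⟨v, h, n, h', rfl | rfl⟩ | ⟨a, b, h, rfl | rfl | rfl⟩)
    · exact Or.inl (Or.inl (Or.inl (Or.inl (Or.inl (Or.inl h)))))
    · exact Or.inl (Or.inl (Or.inl (Or.inl (Or.inl (Or.inr ⟨v, h, rfl⟩)))))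
    · exact Or.inl (Or.inl (Or.inl (Or.inl (Or.inr ⟨v, n, ⟨h, h'⟩, rfl⟩))))
    · exact Or.inl (Or.inl (Or.inl (Or.inr ⟨v, n, ⟨h, h'⟩, rfl⟩)))
    · exact Or.inl (Or.inl (Or.inr ⟨a, b, h, rfl⟩))
    · exact Or.inl (Or.inr ⟨a, b, h, rfl⟩)
    · exact Or.inr ⟨a, b, h, rfl⟩

theorem card_hexNormals_le : hexNormals.card ≤ 6 := by
  classical
  have : hexNormals = {1, -1, zeta, -zeta, 1 - zeta, zeta - 1} := by
    ext; simp [mem_hexNormals]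
  rw [this]
  exact Finset.card_le_six

/-- `32 = 1 + 1 + 5 * 6`: vertices, spoke ends, two families indexed by hexagon sides, and three
indexed by ordered pairs of adjacent vertices. -/
theorem card_nodes_le : S.nodes.card ≤ 32 * Γ.verts.card := by
  classical
  have h1 := S.card_darts_le
  have h2 := Finset.card_le_card S.spokes_subset
  have h3 : (Γ.verts ×ˢ hexNormals).card ≤ 6 * Γ.verts.card := by
    rw [Finset.card_product, mul_comm]
    exact Nat.mul_le_mul_right _ card_hexNormals_le
  have h4 : ∀ f : ℂ → ℂ, (S.spokes.image f).card ≤ Γ.verts.card :=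
    fun f => Finset.card_image_le.trans h2
  have h5 : ∀ f : ℂ × ℂ → ℂ, ((Γ.verts ×ˢ hexNormals).image f).card ≤ 6 * Γ.verts.card :=
    fun f => Finset.card_image_le.trans h3
  have h6 : ∀ f : ℂ × ℂ → ℂ, (S.darts.image f).card ≤ 6 * Γ.verts.card :=
    fun f => Finset.card_image_le.trans h1
  rw [nodes]
  refine (Finset.card_union_le _ _).trans ?_
  have e1 := h6 (fun p => S.hexExit p.1 (udir p.1 p.2))
  refine (Nat.add_le_add_right (Finset.card_union_le _ _) _).trans ?_
  have e2 := h6 (fun p => S.topEnd p.2 p.1 (Complex.I * udir p.1 p.2))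
  refine (Nat.add_le_add_right (Nat.add_le_add_right (Finset.card_union_le _ _) _) _).trans ?_
  have e3 := h6 (fun p => S.topEnd p.1 p.2 (Complex.I * udir p.1 p.2))
  refine (Nat.add_le_add_right (Nat.add_le_add_right (Nat.add_le_add_right
    (Finset.card_union_le _ _) _) _) _).trans ?_
  have e4 := h5 (fun p => hexCorner p.1 S.R p.2)
  refine (Nat.add_le_add_right (Nat.add_le_add_right (Nat.add_le_add_right (Nat.add_le_add_right
    (Finset.card_union_le _ _) _) _) _) _).trans ?_
  have e5 := h5 (fun p => hexCorner' p.1 S.R p.2)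
  refine (Nat.add_le_add_right (Nat.add_le_add_right (Nat.add_le_add_right (Nat.add_le_add_right
    (Nat.add_le_add_right (Finset.card_union_le _ _) _) _) _) _) _).trans ?_
  have e6 := h4 (fun v => S.hexExit v (S.spokeDir v))
  omega

section intersections

variable {x z v v' n m a b a' b' J : ℂ}

theorem mem_side (hn : n ∈ hexNormals) :
    z ∈ S.pieceSeg (.side v n) ↔ dot (z - v) n = S.R ∧ z ∈ S.chex v :=
  mem_hexSide S.R_pos hn

theorem mem_top (hab : Γ.Adj a b) : z ∈ S.pieceSeg (.top a b) ↔
    z ∈ S.strip a b (Complex.I * udir a b) ∧ dot (z - a) (Complex.I * udir a b) = S.δ :=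
  S.mem_topSeg hab (Or.inl rfl)

theorem eq_hexExit {u : ℂ} {τ : ℝ} (hu : ‖u‖ = 1) (hτ : 0 ≤ τ) (hn : n ∈ hexNormals)
    (h : dot (v + τ * u - v) n = S.R) (h' : v + τ * u ∈ S.chex v) :
    v + τ * u = S.hexExit v u ∧ dot u n = hexNorm u := by
  have hR := S.R_pos
  have h' : hexNorm (v + τ * u - v) ≤ S.R := h'
  rw [add_sub_cancel_left, dot_smul_left] at h
  rw [add_sub_cancel_left, hexNorm_smul hτ] at h'
  have hle := dot_le_hexNorm (z := u) hn
  have hτ0 : 0 < τ := hτ.lt_of_ne fun h0 => by rw [← h0] at h; linarith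
  have heq : dot u n = hexNorm u := le_antisymm hle (le_of_mul_le_mul_left (h'.trans h.ge) hτ0)
  refine ⟨?_, heq⟩
  have : τ = S.R / hexNorm u := by
    rw [eq_div_iff (hexNorm_pos hu).ne', ← heq, h]
  rw [hexExit, ← this]

theorem eq_of_mem_carrier_of_mem_side (hv : v ∈ Γ.verts) (hn : n ∈ hexNormals)
    (hz : z ∈ Γ.carrier) (hzs : z ∈ S.pieceSeg (.side v n)) :
    ∃ b, Γ.Adj v b ∧ z = S.hexExit v (udir v b) ∧ dot (udir v b) n = hexNorm (udir v b) := by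
  rw [S.mem_side hn] at hzs
  rcases S.eq_of_mem_carrier_of_near hv hz (S.dist_le_of_mem_chex hzs.2) with
    rfl | ⟨b, hb, τ, h0, -, rfl⟩
  · have := hzs.1
    rw [sub_self, dot_zero_left] at this
    exact absurd this S.R_pos.ne
  · obtain ⟨h1, h2⟩ := S.eq_hexExit hb.norm h0.le hn hzs.1 hzs.2
    exact ⟨b, hb, h1, h2⟩

theorem notMem_carrier_of_mem_top (hab : Γ.Adj a b) (hz : z ∈ S.pieceSeg (.top a b)) :
    z ∉ Γ.carrier := fun h => by
  rw [S.mem_top hab] at hz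
  have := S.dot_eq_zero_of_mem_strip_of_mem_carrier hab (Or.inl rfl) hz.1 h
  rw [hz.2] at this
  exact S.δ_pos.ne' this

theorem eq_of_mem_spoke_of_mem_side (hv : v ∈ S.spokes) (hv' : v' ∈ Γ.verts) (hn : n ∈ hexNormals)
    (hz : z ∈ S.pieceSeg (.spoke v)) (hzs : z ∈ S.pieceSeg (.side v' n)) :
    v' = v ∧ z = S.hexExit v (S.spokeDir v) ∧
      dot (S.spokeDir v) n = hexNorm (S.spokeDir v) := by
  rw [S.mem_side hn] at hzs
  have hz : z ∈ S.spokeSeg v := hz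
  obtain rfl := S.eq_of_mem_chex hv' (S.spokes_subset hv) hzs.2 (S.spokeSeg_subset_chex hv hz)
  obtain ⟨t, h0, -, rfl⟩ := (S.mem_spokeSeg hv).1 hz
  exact ⟨rfl, S.eq_hexExit (S.norm_spokeDir _ hv) h0 hn hzs.1 hzs.2⟩

theorem notMem_spoke_of_mem_top (hab : Γ.Adj a b) (hv : v ∈ S.spokes)
    (hz : z ∈ S.pieceSeg (.top a b)) : z ∉ S.pieceSeg (.spoke v) :=
  S.notMem_spokeSeg_of_mem_strip hab (Or.inl rfl) ((S.mem_top hab).1 hz).1 hv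

theorem eq_port (hab : Γ.Adj a b) (hJ : IsSide (udir a b) J) (hy : dot (z - a) J = S.δ)
    (hp : dot (z - a) (port (udir a b) J) = S.R) (hm : m ∈ hexNormals)
    (h : dot (z - a) m = S.R) : m = port (udir a b) J := by
  by_contra hne
  rw [hJ.dot_eq hab.norm] at h hp
  have := S.port_lt a b J hab hJ m hm hne _ _ (hy.symm ▸ S.δ_pos) hy.le hp
  linarith

theorem eq_of_mem_side_of_mem_top (hv : v ∈ Γ.verts) (hn : n ∈ hexNormals) (hab : Γ.Adj a b)
    (hz : z ∈ S.pieceSeg (.side v n)) (hz' : z ∈ S.pieceSeg (.top a b)) :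
    (v = a ∧ n = port (udir a b) (Complex.I * udir a b) ∧
      z = S.topEnd a b (Complex.I * udir a b)) ∨
    (v = b ∧ n = port (udir b a) (Complex.I * udir a b) ∧
      z = S.topEnd b a (Complex.I * udir a b)) := by
  have hJ : IsSide (udir a b) (Complex.I * udir a b) := Or.inl rfl
  rw [S.mem_side hn] at hz
  rw [S.mem_top hab] at hz'
  rcases S.eq_of_mem_strip_of_mem_chex hab hJ hz'.1 hv hz.2 with ⟨rfl, h⟩ | ⟨rfl, h⟩
  · exact Or.inl ⟨rfl, S.eq_port hab hJ hz'.2 h hn hz.1, S.eq_topEnd hab hJ hz'.2 h⟩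
  · have hy := hz'.2
    rw [dot_sub_side hab.ne hJ] at hy
    exact Or.inr ⟨rfl, S.eq_port hab.symm (isSide_swap hJ) hy h hn hz.1,
      S.eq_topEnd hab.symm (isSide_swap hJ) hy h⟩

/-- At positive height the side is known, and reversing the edge would reverse the left normal. -/
theorem eq_of_mem_strip_dart (hab : Γ.Adj a b) (hab' : Γ.Adj a' b')
    (hz : z ∈ S.strip a b (Complex.I * udir a b)) (hz' : z ∈ S.strip a' b' (Complex.I * udir a' b'))
    (hpos : 0 < dot (z - a) (Complex.I * udir a b)) : a = a' ∧ b = b' := by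
  obtain ⟨h, hJ⟩ := (S.eq_of_mem_strip_of_mem_strip hab (Or.inl rfl) hab' (Or.inl rfl) hz
    hz').resolve_right hpos.ne'
  rcases Sym2.eq_iff.1 h with h | ⟨rfl, rfl⟩
  · exact h
  · exfalso
    rw [udir_symm a b] at hJ
    have hu : udir a b = -udir a b := mul_left_cancel₀ Complex.I_ne_zero hJ
    have hu0 : udir a b = 0 := self_eq_neg.1 hu
    have := hab.norm
    rw [hu0, norm_zero] at this
    exact zero_ne_one this

theorem eq_of_mem_top_of_mem_top (hab : Γ.Adj a b) (hab' : Γ.Adj a' b')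
    (hz : z ∈ S.pieceSeg (.top a b)) (hz' : z ∈ S.pieceSeg (.top a' b')) : a = a' ∧ b = b' := by
  rw [S.mem_top hab] at hz
  rw [S.mem_top hab'] at hz'
  exact S.eq_of_mem_strip_dart hab hab' hz.1 hz'.1 (hz.2.symm ▸ S.δ_pos)

theorem carrier_inter_piece {i : Piece} (hi : i ∈ S.pieces) :
    Γ.carrier ∩ S.pieceSeg i ⊆ S.nodes := by
  rintro z ⟨hz, hzi⟩
  rw [Finset.mem_coe, mem_nodes]
  cases i with
  | spoke v =>
    rw [spoke_mem_pieces] at hi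
    left
    rw [S.eq_of_mem_spokeSeg_of_mem_carrier hi hzi hz]
    exact S.spokes_subset hi
  | side v n =>
    rw [side_mem_pieces] at hi
    obtain ⟨b, hb, h, -⟩ := S.eq_of_mem_carrier_of_mem_side hi.1 hi.2 hz hzi
    exact Or.inr (Or.inr (Or.inr ⟨v, b, hb, Or.inr (Or.inr h)⟩))
  | top a b =>
    rw [top_mem_pieces] at hi
    exact absurd hz (S.notMem_carrier_of_mem_top hi hzi)

theorem piece_inter_piece {i j : Piece} (hi : i ∈ S.pieces) (hj : j ∈ S.pieces) (hij : i ≠ j) :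
    S.pieceSeg i ∩ S.pieceSeg j ⊆ S.nodes := by
  have h1 : ∀ v v' n, v ∈ S.spokes → v' ∈ Γ.verts → n ∈ hexNormals →
      S.pieceSeg (.spoke v) ∩ S.pieceSeg (.side v' n) ⊆ S.nodes := by
    rintro v v' n hv hv' hn z ⟨hz, hz'⟩
    rw [Finset.mem_coe, mem_nodes]
    exact Or.inr (Or.inl ⟨v, hv, (S.eq_of_mem_spoke_of_mem_side hv hv' hn hz hz').2.1⟩)
  have h2 : ∀ v a b, v ∈ S.spokes → Γ.Adj a b →
      S.pieceSeg (.spoke v) ∩ S.pieceSeg (.top a b) ⊆ S.nodes := by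
    rintro v a b hv hab z ⟨hz, hz'⟩
    exact absurd hz (S.notMem_spoke_of_mem_top hab hv hz')
  have h3 : ∀ v n a b, v ∈ Γ.verts → n ∈ hexNormals → Γ.Adj a b →
      S.pieceSeg (.side v n) ∩ S.pieceSeg (.top a b) ⊆ S.nodes := by
    rintro v n a b hv hn hab z ⟨hz, hz'⟩
    rw [Finset.mem_coe, mem_nodes]
    rcases S.eq_of_mem_side_of_mem_top hv hn hab hz hz' with ⟨-, -, h⟩ | ⟨-, -, h⟩
    · exact Or.inr (Or.inr (Or.inr ⟨a, b, hab, Or.inl h⟩))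
    · exact Or.inr (Or.inr (Or.inr ⟨a, b, hab, Or.inr (Or.inl h)⟩))
  cases i <;> cases j <;>
    simp only [spoke_mem_pieces, side_mem_pieces, top_mem_pieces] at hi hj
  · rintro z ⟨hz, hz'⟩
    have := S.eq_of_mem_chex (S.spokes_subset hi) (S.spokes_subset hj)
      (S.spokeSeg_subset_chex hi hz) (S.spokeSeg_subset_chex hj hz')
    exact absurd (congrArg Piece.spoke this) hij
  · exact h1 _ _ _ hi hj.1 hj.2
  · exact h2 _ _ _ hi hj
  · rw [Set.inter_comm]
    exact h1 _ _ _ hj hi.1 hi.2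
  · rename_i v n v' m
    rintro z ⟨hz, hz'⟩
    rw [S.mem_side hi.2] at hz
    rw [S.mem_side hj.2] at hz'
    obtain rfl := S.eq_of_mem_chex hi.1 hj.1 hz.2 hz'.2
    have hnm : n ≠ m := fun h => hij (by rw [h])
    rw [Finset.mem_coe, mem_nodes]
    rcases hexSide_inter S.R_pos hi.2 hj.2 hnm hz.1 hz'.1 hz.2 with ⟨h, -⟩ | ⟨h, -⟩
    · exact Or.inr (Or.inr (Or.inl ⟨_, hi.1, n, hi.2, Or.inr h⟩))
    · exact Or.inr (Or.inr (Or.inl ⟨_, hi.1, n, hi.2, Or.inl h⟩))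
  · exact h3 _ _ _ _ hi.1 hi.2 hj
  · rw [Set.inter_comm]
    exact h2 _ _ _ hj hi
  · rw [Set.inter_comm]
    exact h3 _ _ _ _ hj.1 hj.2 hi
  · rintro z ⟨hz, hz'⟩
    obtain ⟨rfl, rfl⟩ := S.eq_of_mem_top_of_mem_top hi hj hz hz'
    exact absurd rfl hij

end intersections

theorem hexExit_mem_side {v u : ℂ} (hu : ‖u‖ = 1) :
    ∃ n ∈ hexNormals, S.hexExit v u ∈ S.pieceSeg (.side v n) := by
  obtain ⟨n, hn, h⟩ := exists_dot_eq_hexNorm (S.hexExit v u - v)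
  rw [S.hexNorm_hexExit hu] at h
  exact ⟨n, hn, (S.mem_side hn).2 ⟨h, (S.hexNorm_hexExit hu).le⟩⟩

theorem pieceSeg_subset_skeleton {i : Piece} (hi : i ∈ S.pieces) :
    S.pieceSeg i ⊆ S.skeleton :=
  fun _ hz => Or.inr (Set.mem_iUnion₂.2 ⟨i, hi, hz⟩)

theorem mem_skeleton {z : ℂ} : z ∈ S.skeleton ↔
    z ∈ Γ.carrier ∨ ∃ i ∈ S.pieces, z ∈ S.pieceSeg i := by
  simp [skeleton]

theorem exists_pslg_skeleton :
    ∃ Γ₁ : PSLG, Γ₁.verts = S.nodes ∧ Γ₁.carrier = S.skeleton := by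
  refine Γ.exists_add S.pieces S.pieceFst S.pieceSnd S.nodes ?_ ?_ ?_
    (fun i hi => S.carrier_inter_piece hi) (fun i hi j hj => S.piece_inter_piece hi hj)
  · exact fun v hv => S.mem_nodes.2 (Or.inl hv)
  · intro i hi
    cases i with
    | spoke v =>
      rw [spoke_mem_pieces] at hi
      exact ⟨S.mem_nodes.2 (Or.inl (S.spokes_subset hi)),
        S.mem_nodes.2 (Or.inr (Or.inl ⟨v, hi, rfl⟩))⟩
    | side v n =>
      rw [side_mem_pieces] at hi
      exact ⟨S.mem_nodes.2 (Or.inr (Or.inr (Or.inl ⟨v, hi.1, n, hi.2, Or.inl rfl⟩))),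
        S.mem_nodes.2 (Or.inr (Or.inr (Or.inl ⟨v, hi.1, n, hi.2, Or.inr rfl⟩)))⟩
    | top a b =>
      rw [top_mem_pieces] at hi
      exact ⟨S.mem_nodes.2 (Or.inr (Or.inr (Or.inr ⟨a, b, hi, Or.inl rfl⟩))),
        S.mem_nodes.2 (Or.inr (Or.inr (Or.inr ⟨a, b, hi, Or.inr (Or.inl rfl)⟩)))⟩
  · intro z hz
    change z ∈ S.skeleton
    rcases S.mem_nodes.1 hz with h | ⟨v, hv, rfl⟩ | ⟨v, hv, n, hn, h⟩ | ⟨a, b, hab, h⟩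
    · exact Or.inl (Γ.mem_carrier.2 (Or.inl h))
    · exact S.pieceSeg_subset_skeleton (S.spoke_mem_pieces.2 hv) (right_mem_segment ℝ _ _)
    · rcases h with rfl | rfl
      · exact S.pieceSeg_subset_skeleton (S.side_mem_pieces.2 ⟨hv, hn⟩) (left_mem_segment ℝ _ _)
      · exact S.pieceSeg_subset_skeleton (S.side_mem_pieces.2 ⟨hv, hn⟩) (right_mem_segment ℝ _ _)
    · rcases h with rfl | rfl | rfl
      · exact S.pieceSeg_subset_skeleton (S.top_mem_pieces.2 hab) (left_mem_segment ℝ _ _)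
      · exact S.pieceSeg_subset_skeleton (S.top_mem_pieces.2 hab) (right_mem_segment ℝ _ _)
      · obtain ⟨n, hn, h⟩ := S.hexExit_mem_side (v := a) hab.norm
        exact S.pieceSeg_subset_skeleton (S.side_mem_pieces.2 ⟨hab.left, hn⟩) h

/-! ### Angles of the skeleton -/

section rays

variable {x v v' n m a b a' b' d d₁ d₂ : ℂ}

theorem dot_eq_zero_of_isRay_side (hn : n ∈ hexNormals) (h : IsRay (S.pieceSeg (.side v n)) x d) :
    dot d n = 0 := by
  have hx := (S.mem_side hn).1 (h.mem (isCompact_segment_complex _ _).isClosed)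
  refine h.dot_eq_zero fun z hz => ?_
  have h1 := ((S.mem_side hn).1 hz).1
  have h2 := hx.1
  rw [dot_sub_left] at h1 h2
  linarith

theorem eq_or_eq_neg_of_isRay_top (hab : Γ.Adj a b) (hd : ‖d‖ = 1)
    (h : IsRay (S.pieceSeg (.top a b)) x d) : d = udir a b ∨ d = -udir a b := by
  have hx := (S.mem_top hab).1 (h.mem (isCompact_segment_complex _ _).isClosed)
  refine IsSide.eq_or_eq_neg (Or.inl rfl) hab.norm hd (h.dot_eq_zero fun z hz => ?_)
  have h1 := ((S.mem_top hab).1 hz).2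
  have h2 := hx.2
  rw [dot_sub_left] at h1 h2
  linarith

theorem eq_or_eq_neg_of_isRay_spoke (hv : v ∈ S.spokes) (hd : ‖d‖ = 1)
    (h : IsRay (S.pieceSeg (.spoke v)) x d) :
    (d = S.spokeDir v ∨ d = -S.spokeDir v) ∧ (x = v → d = S.spokeDir v) := by
  have hw := S.norm_spokeDir v hv
  have hww := dot_self (S.spokeDir v)
  rw [hw] at hww
  have hcon : ∀ z ∈ S.pieceSeg (.spoke v),
      dot z (Complex.I * S.spokeDir v) = dot v (Complex.I * S.spokeDir v) := by
    intro z hz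
    obtain ⟨t, -, -, rfl⟩ := (S.mem_spokeSeg hv).1 hz
    rw [dot_add_left, dot_smul_left, dot_I_mul_self]
    ring
  have hx := h.mem (isCompact_segment_complex _ _).isClosed
  have h1 := IsSide.eq_or_eq_neg (Or.inl rfl) hw hd
    (h.dot_eq_zero fun z hz => (hcon z hz).trans (hcon x hx).symm)
  refine ⟨h1, ?_⟩
  rintro rfl
  refine h1.resolve_right fun hneg => ?_
  have := h.dot_nonpos (n := -S.spokeDir x) fun z hz => by
    obtain ⟨t, h0, -, rfl⟩ := (S.mem_spokeSeg hv).1 hz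
    rw [dot_neg_right, dot_neg_right, dot_add_left, dot_smul_left, hww]
    linarith
  rw [hneg, dot_neg_left, dot_neg_right, hww] at this
  linarith

theorem dot_le_of_isRay_carrier_of_isRay_piece {i : Piece} (hi : i ∈ S.pieces) (hd₁ : ‖d₁‖ = 1)
    (hd₂ : ‖d₂‖ = 1) (h₁ : IsRay Γ.carrier x d₁) (h₂ : IsRay (S.pieceSeg i) x d₂) :
    dot d₁ d₂ ≤ 1 / 2 := by
  have hx1 := h₁.mem Γ.isClosed_carrier
  have hx2 := h₂.mem (isCompact_segment_complex _ _).isClosed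
  have hR := S.R_pos
  cases i with
  | spoke v =>
    rw [spoke_mem_pieces] at hi
    obtain rfl := S.eq_of_mem_spokeSeg_of_mem_carrier hi hx2 hx1
    obtain ⟨b, hb, -, rfl⟩ := Γ.exists_edge_of_isRay (S.spokes_subset hi) hd₁ h₁
    rw [(S.eq_or_eq_neg_of_isRay_spoke hi hd₂ h₂).2 rfl]
    have := S.spokeDir_le x hi b hb
    rw [udir] at this
    linarith
  | side v n =>
    rw [side_mem_pieces] at hi
    obtain ⟨b, hb, rfl, hbn⟩ := S.eq_of_mem_carrier_of_mem_side hi.1 hi.2 hx1 hx2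
    have hu := hexNorm_unit hb.norm
    have hpos := hexNorm_pos hb.norm
    have hτ : S.R / hexNorm (udir v b) < 2 * S.R := by
      rw [div_lt_iff₀ hpos]
      nlinarith [sqrt_three_bounds.1]
    have hτ0 : 0 < S.R / hexNorm (udir v b) := by positivity
    have hopen := S.mem_openEdge_of_near hb hτ0 hτ.le
    have hxV : S.hexExit v (udir v b) ∉ Γ.verts := fun h => Γ.vertex_notMem _ hb _ h hopen
    -- The crossing point is no vertex, so the graph is a line there, in the direction of the edge
    -- from `v`.
    obtain ⟨u, hu1, hline⟩ := Γ.exists_isLineNear hx1 hxV isClosed_empty (Set.notMem_empty _)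
    rw [Set.empty_union] at hline
    have hray : IsRay Γ.carrier (S.hexExit v (udir v b)) (udir v b) := by
      refine eventually_nhdsGT_zero_iff.2 ⟨2 * S.R - S.R / hexNorm (udir v b), by linarith,
        fun s hs hs' => ?_⟩
      have := S.mem_carrier_of_near hb (τ := S.R / hexNorm (udir v b) + s) (by linarith)
        (by linarith)
      rw [hexExit]
      convert this using 1
      push_cast
      ring
    have hd : d₁ = udir v b ∨ d₁ = -udir v b := by
      rcases hline.eq_or_eq_neg hu1 hd₁ h₁ with h | h <;>
        rcases hline.eq_or_eq_neg hu1 hb.norm hray with h' | h' <;> rw [h, h'] <;> simp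
    exact dot_le_of_transversal hb.norm hd₂ (norm_of_mem_hexNormals hi.2) (hbn ▸ hu.1)
      (S.dot_eq_zero_of_isRay_side hi.2 h₂) hd
  | top a b =>
    rw [top_mem_pieces] at hi
    exact absurd hx1 (S.notMem_carrier_of_mem_top hi hx2)

theorem dot_le_of_isRay_spoke_of_isRay_side (hv : v ∈ S.spokes) (hv' : v' ∈ Γ.verts)
    (hn : n ∈ hexNormals) (hd₁ : ‖d₁‖ = 1) (hd₂ : ‖d₂‖ = 1) (h₁ : IsRay (S.pieceSeg (.spoke v)) x d₁)
    (h₂ : IsRay (S.pieceSeg (.side v' n)) x d₂) : dot d₁ d₂ ≤ 1 / 2 := by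
  obtain ⟨-, -, h⟩ := S.eq_of_mem_spoke_of_mem_side hv hv' hn
    (h₁.mem (isCompact_segment_complex _ _).isClosed)
    (h₂.mem (isCompact_segment_complex _ _).isClosed)
  exact dot_le_of_transversal (S.norm_spokeDir v hv) hd₂ (norm_of_mem_hexNormals hn)
    (h ▸ (hexNorm_unit (S.norm_spokeDir v hv)).1) (S.dot_eq_zero_of_isRay_side hn h₂)
    (S.eq_or_eq_neg_of_isRay_spoke hv hd₁ h₁).1

theorem dot_le_of_isRay_side_of_isRay_top (hv : v ∈ Γ.verts) (hn : n ∈ hexNormals)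
    (hab : Γ.Adj a b) (hd₁ : ‖d₁‖ = 1) (hd₂ : ‖d₂‖ = 1) (h₁ : IsRay (S.pieceSeg (.side v n)) x d₁)
    (h₂ : IsRay (S.pieceSeg (.top a b)) x d₂) : dot d₂ d₁ ≤ 1 / 2 := by
  have hJ : IsSide (udir a b) (Complex.I * udir a b) := Or.inl rfl
  have hd := S.eq_or_eq_neg_of_isRay_top hab hd₂ h₂
  have hz := S.dot_eq_zero_of_isRay_side hn h₁
  have hn1 := norm_of_mem_hexNormals hn
  rcases S.eq_of_mem_side_of_mem_top hv hn hab (h₁.mem (isCompact_segment_complex _ _).isClosed)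
    (h₂.mem (isCompact_segment_complex _ _).isClosed) with ⟨-, h, -⟩ | ⟨-, h, -⟩
  · refine dot_le_of_transversal hab.norm hd₁ hn1 ?_ hz hd
    rw [h, (port_spec hab.norm hJ).2.1]
    exact (hexNorm_unit hab.norm).1
  · refine dot_le_of_transversal hab.symm.norm hd₁ hn1 ?_ hz ?_
    · rw [h, (port_spec hab.symm.norm (isSide_swap hJ)).2.1]
      exact (hexNorm_unit hab.symm.norm).1
    · rw [udir_symm a b, neg_neg]
      exact hd.symm

/-- The intersection lemmas leave only pieces of one hexagon, or of a hexagon and a strip fitting to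
it, or the same piece twice. -/
theorem dot_le_of_isRay_piece_of_isRay_piece {i j : Piece} (hi : i ∈ S.pieces) (hj : j ∈ S.pieces)
    (hd₁ : ‖d₁‖ = 1) (hd₂ : ‖d₂‖ = 1) (hne : d₁ ≠ d₂) (h₁ : IsRay (S.pieceSeg i) x d₁)
    (h₂ : IsRay (S.pieceSeg j) x d₂) : dot d₁ d₂ ≤ 1 / 2 := by
  have hx1 := h₁.mem (isCompact_segment_complex _ _).isClosed
  have hx2 := h₂.mem (isCompact_segment_complex _ _).isClosed
  cases i <;> cases j <;>
    simp only [spoke_mem_pieces, side_mem_pieces, top_mem_pieces] at hi hj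
  · obtain rfl := S.eq_of_mem_chex (S.spokes_subset hi) (S.spokes_subset hj)
      (S.spokeSeg_subset_chex hi hx1) (S.spokeSeg_subset_chex hj hx2)
    exact dot_le_of_eq_or_eq_neg (S.norm_spokeDir _ hi)
      (S.eq_or_eq_neg_of_isRay_spoke hi hd₁ h₁).1 (S.eq_or_eq_neg_of_isRay_spoke hi hd₂ h₂).1 hne
  · exact S.dot_le_of_isRay_spoke_of_isRay_side hi hj.1 hj.2 hd₁ hd₂ h₁ h₂
  · exact absurd hx1 (S.notMem_spoke_of_mem_top hj hi hx2)
  · rw [dot_comm]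
    exact S.dot_le_of_isRay_spoke_of_isRay_side hj hi.1 hi.2 hd₂ hd₁ h₂ h₁
  · rename_i v n v' m
    have hz := (S.mem_side hi.2).1 hx1
    have hz' := (S.mem_side hj.2).1 hx2
    obtain rfl := S.eq_of_mem_chex hi.1 hj.1 hz.2 hz'.2
    have key : ∀ n m d, n ∈ hexNormals → m ∈ hexNormals → dot (x - v) m = S.R →
        IsRay (S.pieceSeg (.side v n)) x d → dot d m ≤ 0 := by
      intro n m d hn hm hxm h
      refine h.dot_nonpos fun z hz => ?_
      have := hexNorm_le_iff.1 ((S.mem_side hn).1 hz).2 m hm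
      rw [dot_sub_left] at this hxm
      linarith
    exact dot_le_of_tangent S.R_pos hi.2 hj.2 hz.1 hz'.1 hz.2 hd₁ hd₂ hne
      (S.dot_eq_zero_of_isRay_side hi.2 h₁) (S.dot_eq_zero_of_isRay_side hj.2 h₂)
      (key n m d₁ hi.2 hj.2 hz'.1 h₁) (key m n d₂ hj.2 hi.2 hz.1 h₂)
  · rw [dot_comm]
    exact S.dot_le_of_isRay_side_of_isRay_top hi.1 hi.2 hj hd₁ hd₂ h₁ h₂
  · exact absurd hx2 (S.notMem_spoke_of_mem_top hi hj hx1)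
  · exact S.dot_le_of_isRay_side_of_isRay_top hj.1 hj.2 hi hd₂ hd₁ h₂ h₁
  · obtain ⟨rfl, rfl⟩ := S.eq_of_mem_top_of_mem_top hi hj hx1 hx2
    exact dot_le_of_eq_or_eq_neg hi.norm (S.eq_or_eq_neg_of_isRay_top hi hd₁ h₁)
      (S.eq_or_eq_neg_of_isRay_top hi hd₂ h₂) hne

theorem dot_le_of_isRay_skeleton (hd₁ : ‖d₁‖ = 1) (hd₂ : ‖d₂‖ = 1) (hne : d₁ ≠ d₂)
    (h₁ : IsRay S.skeleton x d₁) (h₂ : IsRay S.skeleton x d₂) :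
    (IsRay Γ.carrier x d₁ ∧ IsRay Γ.carrier x d₂) ∨ dot d₁ d₂ ≤ 1 / 2 := by
  have key : ∀ d, ‖d‖ = 1 → IsRay S.skeleton x d →
      IsRay Γ.carrier x d ∨ ∃ i ∈ S.pieces, IsRay (S.pieceSeg i) x d := fun d hd h =>
    (IsRay.or_of_union h hd (Γ.hasCone_carrier x)).imp_right fun h =>
      h.exists_of_biUnion hd fun i _ => hasCone_segment _ _ x
  rcases key d₁ hd₁ h₁ with h₁ | ⟨i, hi, h₁⟩ <;> rcases key d₂ hd₂ h₂ with h₂ | ⟨j, hj, h₂⟩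
  · exact Or.inl ⟨h₁, h₂⟩
  · exact Or.inr (S.dot_le_of_isRay_carrier_of_isRay_piece hj hd₁ hd₂ h₁ h₂)
  · rw [dot_comm]
    exact Or.inr (S.dot_le_of_isRay_carrier_of_isRay_piece hi hd₂ hd₁ h₂ h₁)
  · exact Or.inr (S.dot_le_of_isRay_piece_of_isRay_piece hi hj hd₁ hd₂ hne h₁ h₂)

end rays

/-- The refinement of a graph by the part of the skeleton inside the polynomial hull. -/
theorem exists_isGoodRefinement : ∃ Γ' : PSLG, Γ'.IsGoodRefinement Γ ∧
    Γ'.carrier = S.skeleton ∩ polyHull Γ.carrier ∧ Γ'.verts ⊆ S.nodes := by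
  obtain ⟨Γ₁, hV, hK⟩ := S.exists_pslg_skeleton
  have hΓK : Γ.carrier ⊆ S.skeleton := fun z hz => Or.inl hz
  obtain ⟨Γ', h1, h2, h3⟩ := Γ.exists_restrict_polyHull Γ₁
    (by rw [hV]; exact fun v hv => S.mem_nodes.2 (Or.inl hv)) (by rwa [hK])
  rw [hK] at h3
  rw [hV] at h2
  refine ⟨Γ', ⟨h1, ?_, ?_, ?_⟩, h3, h2⟩
  · rw [h3]
    exact fun z hz => ⟨hΓK hz, subset_polyHull _ hz⟩
  · rw [h3]
    exact fun z hz => hz.2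
  · intro x d₁ d₂ hd₁ hd₂ hne h₁ h₂
    rw [h3] at h₁ h₂
    exact S.dot_le_of_isRay_skeleton hd₁ hd₂ hne (h₁.mono fun z hz => hz.1)
      (h₂.mono fun z hz => hz.1)

end StripData

/-! ### Connectedness of the skeleton -/

theorem hexNorm_pos_of_ne_zero {z : ℂ} (hz : z ≠ 0) : 0 < hexNorm z :=
  lt_of_lt_of_le (by have := norm_pos_iff.2 hz; positivity) (norm_le_hexNorm z)

/-- The boundary of the hexagon is the radial projection of the punctured plane. -/
theorem isPreconnected_hexNorm_eq (v : ℂ) {R : ℝ} (hR : 0 < R) :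
    IsPreconnected {z : ℂ | hexNorm (z - v) = R} := by
  have himg : {z : ℂ | hexNorm (z - v) = R} =
      (fun z : ℂ => v + (R / hexNorm z : ℝ) * z) '' {0}ᶜ := by
    ext z
    simp only [Set.mem_ofPred_eq, Set.mem_image, Set.mem_compl_iff, Set.mem_singleton_iff]
    constructor
    · intro h
      refine ⟨z - v, fun h0 => ?_, ?_⟩
      · have := hexNorm_le_norm (z - v)
        rw [h, h0, norm_zero] at this
        linarith
      · rw [h, div_self hR.ne']
        simp
    · rintro ⟨y, hy, rfl⟩
      have := hexNorm_pos_of_ne_zero hy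
      rw [add_sub_cancel_left, hexNorm_smul (by positivity)]
      field_simp
  rw [himg]
  refine IsPreconnected.image ?_ _ ?_
  · exact (isConnected_compl_singleton_of_one_lt_rank (by simp) 0).isPreconnected
  · intro z hz
    have h0 : hexNorm z ≠ 0 := (hexNorm_pos_of_ne_zero hz).ne'
    have h1 : ContinuousAt (fun z : ℂ => R / hexNorm z) z :=
      continuousAt_const.div continuous_hexNorm.continuousAt h0
    exact (continuousAt_const.add ((Complex.continuous_ofReal.continuousAt.comp h1).mul
      continuousAt_id)).continuousWithinAt

theorem dot_mul_exp (s φ α : ℝ) : dot (s * Complex.exp (φ * Complex.I))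
    (Complex.I * Complex.exp (α * Complex.I)) = s * Real.sin (φ - α) := by
  rw [dot_smul_left]
  simp only [dot, Complex.mul_re, Complex.mul_im, Complex.I_re, Complex.I_im,
    Complex.exp_ofReal_mul_I_re, Complex.exp_ofReal_mul_I_im, Real.sin_sub]
  ring

namespace StripData

variable {Γ : PSLG} (S : StripData Γ)

theorem mem_skeleton_of_hexNorm_eq {v z : ℂ} (hv : v ∈ Γ.verts) (h : hexNorm (z - v) = S.R) :
    z ∈ S.skeleton := by
  obtain ⟨n, hn, h'⟩ := exists_dot_eq_hexNorm (z - v)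
  exact S.pieceSeg_subset_skeleton (S.side_mem_pieces.2 ⟨hv, hn⟩)
    ((S.mem_side hn).2 ⟨h'.trans h, h.le⟩)

/-- Each hexagon boundary is crossed by an edge from its center, each spoke starts at a vertex, and
each strip top ends on a hexagon. -/
theorem isPreconnected_skeleton (hΓ : IsPreconnected Γ.carrier)
    (hedge : ∀ v ∈ Γ.verts, ∃ b, Γ.Adj v b) : IsPreconnected S.skeleton := by
  have hbd : ∀ v ∈ Γ.verts, IsPreconnected (Γ.carrier ∪ {z : ℂ | hexNorm (z - v) = S.R}) := by
    intro v hv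
    obtain ⟨b, hb⟩ := hedge v hv
    have hpos := hexNorm_pos hb.norm
    have hR := S.R_pos
    have hle : S.R / hexNorm (udir v b) ≤ 2 * S.R := by
      rw [div_le_iff₀ hpos]
      nlinarith [sqrt_three_bounds.1, (hexNorm_unit hb.norm).1]
    refine IsPreconnected.union (S.hexExit v (udir v b)) ?_ ?_ hΓ (isPreconnected_hexNorm_eq v hR)
    · exact S.mem_carrier_of_near hb (by positivity) hle
    · exact S.hexNorm_hexExit hb.norm
  have hbd_sub : ∀ v ∈ Γ.verts, Γ.carrier ∪ {z : ℂ | hexNorm (z - v) = S.R} ⊆ S.skeleton := by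
    rintro v hv z (h | h)
    · exact Or.inl h
    · exact S.mem_skeleton_of_hexNorm_eq hv h
  rcases Set.eq_empty_or_nonempty S.skeleton with hemp | ⟨x₀, hx₀⟩
  · rw [hemp]
    exact isPreconnected_empty
  have hx : ∃ x, x ∈ Γ.carrier := by
    have hvert : ∀ v ∈ Γ.verts, ∃ x, x ∈ Γ.carrier :=
      fun v hv => ⟨v, Γ.mem_carrier.2 (Or.inl hv)⟩
    rcases S.mem_skeleton.1 hx₀ with h | ⟨i, hi, -⟩
    · exact ⟨x₀, h⟩
    · cases i with
      | spoke v => exact hvert v (S.spokes_subset (S.spoke_mem_pieces.1 hi))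
      | side v n => exact hvert v (S.side_mem_pieces.1 hi).1
      | top a b => exact hvert a (S.top_mem_pieces.1 hi).left
  obtain ⟨x, hx⟩ := hx
  refine isPreconnected_of_forall x fun z hz => ?_
  rcases S.mem_skeleton.1 hz with h | ⟨i, hi, hzi⟩
  · exact ⟨Γ.carrier, fun y hy => Or.inl hy, hx, h, hΓ⟩
  have hseg : IsPreconnected (S.pieceSeg i) := (convex_segment _ _).isPreconnected
  cases i with
  | spoke v =>
    have hv := S.spokes_subset (S.spoke_mem_pieces.1 hi)
    refine ⟨Γ.carrier ∪ S.pieceSeg (.spoke v), ?_, Or.inl hx, Or.inr hzi, ?_⟩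
    · rintro y (h | h)
      · exact Or.inl h
      · exact S.pieceSeg_subset_skeleton hi h
    · exact IsPreconnected.union v (Γ.mem_carrier.2 (Or.inl hv)) (left_mem_segment ℝ _ _) hΓ hseg
  | side v n =>
    have h := S.side_mem_pieces.1 hi
    refine ⟨_, hbd_sub v h.1, Or.inl hx, Or.inr ?_, hbd v h.1⟩
    obtain ⟨h1, h2⟩ := (S.mem_side h.2).1 hzi
    exact le_antisymm h2 (h1 ▸ dot_le_hexNorm h.2)
  | top a b =>
    have h := S.top_mem_pieces.1 hi
    refine ⟨(Γ.carrier ∪ {z : ℂ | hexNorm (z - a) = S.R}) ∪ S.pieceSeg (.top a b), ?_,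
      Or.inl (Or.inl hx), Or.inr hzi, ?_⟩
    · rintro y (h' | h')
      · exact hbd_sub a h.left h'
      · exact S.pieceSeg_subset_skeleton hi h'
    · refine IsPreconnected.union (S.topEnd a b (Complex.I * udir a b)) (Or.inr ?_)
        (left_mem_segment ℝ _ _) (hbd a h.left) hseg
      have h1 := S.topEnd_mem_chex h (Or.inl rfl)
      have h2 := (S.dot_topEnd h (Or.inl rfl)).2.1
      exact le_antisymm h1 (h2 ▸ dot_le_hexNorm (port_spec h.norm (Or.inl rfl)).1)

/-! ### Convex faces inside hexagons and strips -/

section pieces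

variable {v z a b : ℂ}

open Classical in
/-- The directions of the rays of the skeleton at a vertex. -/
noncomputable def dirs (v : ℂ) : Finset ℂ :=
  (Γ.verts.filter fun b => Γ.Adj v b).image (udir v) ∪
    (S.spokes.filter fun x => x = v).image S.spokeDir

theorem mem_dirs {d : ℂ} : d ∈ S.dirs v ↔
    (∃ b, Γ.Adj v b ∧ d = udir v b) ∨ (v ∈ S.spokes ∧ d = S.spokeDir v) := by
  classical
  simp only [dirs, Finset.mem_union, Finset.mem_image, Finset.mem_filter]
  constructor
  · rintro (⟨b, ⟨-, h⟩, rfl⟩ | ⟨x, ⟨h, rfl⟩, rfl⟩)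
    · exact Or.inl ⟨b, h, rfl⟩
    · exact Or.inr ⟨h, rfl⟩
  · rintro (⟨b, h, rfl⟩ | ⟨h, rfl⟩)
    · exact Or.inl ⟨b, ⟨h.right, h⟩, rfl⟩
    · exact Or.inr ⟨v, ⟨h, rfl⟩, rfl⟩

theorem norm_of_mem_dirs {d : ℂ} (h : d ∈ S.dirs v) : ‖d‖ = 1 := by
  rcases S.mem_dirs.1 h with ⟨b, hb, rfl⟩ | ⟨hv, rfl⟩
  · exact hb.norm
  · exact S.norm_spokeDir v hv

theorem mem_skeleton_of_mem_hex (hv : v ∈ Γ.verts) (hz : z ∈ S.hex v) :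
    z ∈ S.skeleton ↔ z = v ∨ ∃ d ∈ S.dirs v, ∃ τ : ℝ, 0 < τ ∧ z = v + τ * d := by
  have hzc := S.hex_subset_chex v hz
  constructor
  · intro h
    rcases S.mem_skeleton.1 h with h | ⟨i, hi, h⟩
    · rcases S.eq_of_mem_carrier_of_near hv h (S.dist_le_of_mem_chex hzc) with
        h | ⟨b, hb, τ, h0, -, h⟩
      · exact Or.inl h
      · exact Or.inr ⟨_, S.mem_dirs.2 (Or.inl ⟨b, hb, rfl⟩), τ, h0, h⟩
    · cases i with
      | spoke v' =>
        rw [spoke_mem_pieces] at hi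
        obtain rfl := S.eq_of_mem_chex hv (S.spokes_subset hi) hzc (S.spokeSeg_subset_chex hi h)
        obtain ⟨t, h0, -, rfl⟩ := (S.mem_spokeSeg hi).1 h
        rcases h0.eq_or_lt with rfl | h0
        · left; simp
        · exact Or.inr ⟨_, S.mem_dirs.2 (Or.inr ⟨hi, rfl⟩), t, h0, rfl⟩
      | side v' n =>
        rw [side_mem_pieces] at hi
        rw [S.mem_side hi.2] at h
        obtain rfl := S.eq_of_mem_chex hv hi.1 hzc h.2
        exact absurd h.1 (hexNorm_lt_iff.1 hz n hi.2).ne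
      | top a b =>
        rw [top_mem_pieces] at hi
        have hJ : IsSide (udir a b) (Complex.I * udir a b) := Or.inl rfl
        rcases S.eq_of_mem_strip_of_mem_chex hi hJ ((S.mem_top hi).1 h).1 hv hzc with
          ⟨rfl, h'⟩ | ⟨rfl, h'⟩
        · exact absurd h' (hexNorm_lt_iff.1 hz _ (port_spec hi.norm hJ).1).ne
        · exact absurd h' (hexNorm_lt_iff.1 hz _ (port_spec hi.symm.norm (isSide_swap hJ)).1).ne
  · rintro (rfl | ⟨d, hd, τ, hτ, rfl⟩)
    · exact Or.inl (Γ.mem_carrier.2 (Or.inl hv))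
    · have hR := S.R_pos
      have hd1 := hexNorm_unit (S.norm_of_mem_dirs hd)
      have hlt : τ * hexNorm d < S.R := by
        have : hexNorm (v + τ * d - v) < S.R := hz
        rwa [add_sub_cancel_left, hexNorm_smul hτ.le] at this
      rcases S.mem_dirs.1 hd with ⟨b, hb, rfl⟩ | ⟨hvs, rfl⟩
      · refine Or.inl (S.mem_carrier_of_near hb hτ.le ?_)
        nlinarith [sqrt_three_bounds.1]
      · exact S.pieceSeg_subset_skeleton (S.spoke_mem_pieces.2 hvs)
          ((S.mem_spokeSeg hvs).2 ⟨τ, hτ.le, hlt.le, rfl⟩)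

/-- The components of a hexagon minus the skeleton are convex. -/
theorem exists_convex_of_mem_hex (hedge : ∀ v ∈ Γ.verts, ∃ b, Γ.Adj v b) (hv : v ∈ Γ.verts)
    (hz : z ∈ S.hex v) (hzs : z ∉ S.skeleton) : ∃ Q : Set ℂ, IsOpen Q ∧ Convex ℝ Q ∧ z ∈ Q ∧
      Disjoint Q S.skeleton ∧ frontier Q ⊆ S.skeleton := by
  have hpi := Real.pi_pos
  have hzv : z ≠ v := fun h => hzs ((S.mem_skeleton_of_mem_hex hv hz).2 (Or.inl h))
  obtain ⟨s, θ, hs, -, -, -, hzθ⟩ := exists_cone_angle hzv (lt_add_one (dist z v)) 0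
  obtain ⟨b, hb⟩ := hedge v hv
  obtain ⟨α, β, hαθ, hθβ, hβ, hα, hβD, hnot⟩ := exists_sector
    (D := S.dirs v) ⟨_, S.mem_dirs.2 (Or.inl ⟨b, hb, rfl⟩)⟩ (fun d => S.norm_of_mem_dirs)
    (θ := θ) fun h => hzs ((S.mem_skeleton_of_mem_hex hv hz).2 (Or.inr ⟨_, h, s, hs, hzθ⟩))
  have hangle : ∀ d ∈ S.dirs v, ∃ φ : ℝ, α ≤ φ ∧ φ < α + 2 * Real.pi ∧
      d = Complex.exp (φ * Complex.I) := by
    intro d hd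
    obtain ⟨φ, h1, h2, h3⟩ := exists_angle d α
    rw [S.norm_of_mem_dirs hd, Complex.ofReal_one, one_mul] at h3
    exact ⟨φ, h1, h2, h3⟩
  -- Were the free sector larger than 180°, every available direction would make an obtuse angle
  -- with its bisector, against `no_reflex`.
  have hβα : β ≤ α + Real.pi := by
    by_contra! hcon
    have hex : ∃ d ∈ S.dirs v, 0 ≤ dot d (Complex.exp (((α + β) / 2 : ℝ) * Complex.I)) := by
      rcases S.no_reflex v hv (Complex.exp (((α + β) / 2 : ℝ) * Complex.I)) with ⟨b, hb, h⟩ | ⟨h, h'⟩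
      · exact ⟨_, S.mem_dirs.2 (Or.inl ⟨b, hb, rfl⟩), h⟩
      · exact ⟨_, S.mem_dirs.2 (Or.inr ⟨h, rfl⟩), h'⟩
    obtain ⟨d, hd, h⟩ := hex
    obtain ⟨φ, h1, h2, rfl⟩ := hangle d hd
    rw [dot_exp_exp] at h
    rcases h1.eq_or_lt with rfl | h1
    · have := Real.cos_neg_of_pi_div_two_lt_of_lt (x := (α + β) / 2 - α) (by linarith) (by linarith)
      linarith
    · have hφβ : β ≤ φ := by
        by_contra! hlt
        exact hnot φ h1 hlt hd
      rw [← Real.cos_neg] at h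
      have := Real.cos_neg_of_pi_div_two_lt_of_lt (x := -((α + β) / 2 - φ)) (by linarith)
        (by linarith)
      linarith
  -- With `p` and `q` the left normals of the bounding rays, the piece is the hexagon cut by two
  -- half-planes through `v`; this is the sector because its opening is at most 180°.
  set p := Complex.I * Complex.exp (α * Complex.I) with hp
  set q := Complex.I * Complex.exp (β * Complex.I) with hq
  have hQ : IsOpen (S.hex v ∩ ({z | 0 < dot (z - v) p} ∩ {z | dot (z - v) q < 0})) :=
    (S.isOpen_hex v).inter ((isOpen_lt continuous_const (by fun_prop)).inter
      (isOpen_lt (by fun_prop) continuous_const))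
  refine ⟨_, hQ, (S.convex_hex v).inter ((convex_lt_dot v p 0).inter (convex_dot_lt v q 0)),
    ⟨hz, ?_, ?_⟩, ?_, ?_⟩
  · rw [Set.mem_ofPred_eq, hzθ, add_sub_cancel_left, hp, dot_mul_exp]
    exact mul_pos hs (Real.sin_pos_of_pos_of_lt_pi (by linarith) (by linarith))
  · rw [Set.mem_ofPred_eq, hzθ, add_sub_cancel_left, hq, dot_mul_exp]
    exact mul_neg_of_pos_of_neg hs (Real.sin_neg_of_neg_of_neg_pi_lt (by linarith) (by linarith))
  · rw [Set.disjoint_left]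
    rintro y ⟨hy, h1, h2⟩ hys
    rw [Set.mem_ofPred_eq] at h1 h2
    rcases (S.mem_skeleton_of_mem_hex hv hy).1 hys with rfl | ⟨d, hd, τ, hτ, rfl⟩
    · rw [sub_self, dot_zero_left] at h1
      exact h1.false
    · obtain ⟨φ, h3, h4, rfl⟩ := hangle d hd
      rw [add_sub_cancel_left, hp, dot_mul_exp] at h1
      rw [add_sub_cancel_left, hq, dot_mul_exp] at h2
      have h1 := pos_of_mul_pos_right h1 hτ.le
      have h2 := neg_of_mul_neg_right h2 hτ.le
      have h5 : φ < α + Real.pi := by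
        by_contra! hle
        have := Real.sin_nonneg_of_nonneg_of_le_pi (x := φ - α - Real.pi) (by linarith)
          (by linarith)
        rw [Real.sin_sub_pi] at this
        linarith
      have h6 : α < φ := h3.lt_of_ne fun h => by
        rw [h, sub_self, Real.sin_zero] at h1
        exact h1.false
      have h7 : φ < β := by
        by_contra! hle
        have := Real.sin_nonneg_of_nonneg_of_le_pi (x := φ - β) (by linarith) (by linarith)
        linarith
      exact hnot φ h6 h7 hd
  · intro y hy
    rw [hQ.frontier_eq] at hy
    have hcl : IsClosed (S.chex v ∩ ({z | 0 ≤ dot (z - v) p} ∩ {z | dot (z - v) q ≤ 0})) :=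
      (S.isClosed_chex v).inter ((isClosed_le continuous_const (by fun_prop)).inter
        (isClosed_le (by fun_prop) continuous_const))
    have hmem : y ∈ S.chex v ∩ ({z | 0 ≤ dot (z - v) p} ∩ {z | dot (z - v) q ≤ 0}) := by
      refine closure_minimal ?_ hcl hy.1
      rintro w ⟨hw, h1, h2⟩
      have h1 : 0 < dot (w - v) p := h1
      have h2 : dot (w - v) q < 0 := h2
      exact ⟨S.hex_subset_chex v hw, h1.le, h2.le⟩
    obtain ⟨hyc, h1, h2⟩ := hmem
    rw [Set.mem_ofPred_eq] at h1 h2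
    have hyR : hexNorm (y - v) ≤ S.R := hyc
    rcases hyR.eq_or_lt with h | hyh
    · exact S.mem_skeleton_of_hexNorm_eq hv h
    have hyh : y ∈ S.hex v := hyh
    rw [S.mem_skeleton_of_mem_hex hv hyh]
    by_cases hyv : y = v
    · exact Or.inl hyv
    right
    obtain ⟨s, φ, hs, -, h3, h4, hyφ⟩ := exists_cone_angle hyv (lt_add_one (dist y v)) α
    have hzero : dot (y - v) p = 0 ∨ dot (y - v) q = 0 := by
      by_contra! hne
      exact hy.2 ⟨hyh, h1.lt_of_ne hne.1.symm, h2.lt_of_ne hne.2⟩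
    rw [hyφ, add_sub_cancel_left, hp, dot_mul_exp] at h1 hzero
    rw [hyφ, add_sub_cancel_left, hq, dot_mul_exp] at h2
    rw [hq, dot_mul_exp] at hzero
    have h1 := nonneg_of_mul_nonneg_right h1 hs
    have h2 : Real.sin (φ - β) ≤ 0 := by
      by_contra! hlt
      have := mul_pos hs hlt
      linarith
    have h5 : φ ≤ α + Real.pi := by
      by_contra! hlt
      have := Real.sin_pos_of_pos_of_lt_pi (x := φ - α - Real.pi) (by linarith) (by linarith)
      rw [Real.sin_sub_pi] at this
      linarith
    -- A closure point on one of the two cutting lines lies on a bounding ray, as the other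
    -- half-plane excludes the opposite ray or the rays form one line.
    have hres : φ = α ∨ φ = β := by
      rcases hzero with h | h
      · have h := (mul_eq_zero.1 h).resolve_left hs.ne'
        rcases h3.eq_or_lt with h3 | h3
        · exact Or.inl h3.symm
        rcases h5.eq_or_lt with h5 | h5
        · right
          by_contra hne
          have := Real.sin_pos_of_pos_of_lt_pi (x := φ - β)
            (sub_pos.2 (lt_of_le_of_ne (by linarith) (Ne.symm hne))) (by linarith)
          linarith
        · have := Real.sin_pos_of_pos_of_lt_pi (x := φ - α) (by linarith) (by linarith)
          linarith
      · have h := (mul_eq_zero.1 h).resolve_left hs.ne'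
        rcases lt_trichotomy φ β with h6 | h6 | h6
        · left
          by_contra hne
          have h3 := h3.lt_of_ne (Ne.symm hne)
          have := Real.sin_neg_of_neg_of_neg_pi_lt (x := φ - β) (by linarith) (by linarith)
          linarith
        · exact Or.inr h6
        · have := Real.sin_pos_of_pos_of_lt_pi (x := φ - β) (by linarith) (by linarith)
          linarith
    rcases hres with rfl | rfl
    · exact ⟨_, hα, s, hs, hyφ⟩
    · exact ⟨_, hβD, s, hs, hyφ⟩

theorem mem_skeleton_of_mem_strip (hab : Γ.Adj a b)
    (hz : z ∈ S.strip a b (Complex.I * udir a b))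
    (hz' : z ∉ S.ostrip a b (Complex.I * udir a b)) : z ∈ S.skeleton := by
  have hJ : IsSide (udir a b) (Complex.I * udir a b) := Or.inl rfl
  have key : ∀ a b J, Γ.Adj a b → IsSide (udir a b) J → z ∈ S.strip a b J →
      dot (z - a) (port (udir a b) J) = S.R → z ∈ S.skeleton := by
    intro a b J hab hJ hz h
    have hn := (port_spec hab.norm hJ).1
    have hc := S.mem_chex_of_dot_le hab hJ
      ((S.le_dot_of_mem_strip hab hJ hz).trans' (by have := S.R_pos; positivity)) hz.1 hz.2.1 h.le
    exact S.pieceSeg_subset_skeleton (S.side_mem_pieces.2 ⟨hab.left, hn⟩)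
      ((S.mem_side hn).2 ⟨h, hc⟩)
  by_cases h1 : dot (z - a) (Complex.I * udir a b) = 0
  · obtain ⟨p, hp, hzp, -⟩ := S.exists_foot hab hJ hz
    rw [h1, Complex.ofReal_zero, zero_mul, add_zero] at hzp
    exact Or.inl (Γ.closedEdge_subset_carrier hab (hzp ▸ hp))
  by_cases h2 : dot (z - a) (Complex.I * udir a b) = S.δ
  · exact S.pieceSeg_subset_skeleton (S.top_mem_pieces.2 hab) ((S.mem_top hab).2 ⟨hz, h2⟩)
  by_cases h3 : dot (z - a) (port (udir a b) (Complex.I * udir a b)) = S.R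
  · exact key a b _ hab hJ hz h3
  by_cases h4 : dot (z - b) (port (udir b a) (Complex.I * udir a b)) = S.R
  · exact key b a _ hab.symm (isSide_swap hJ) (S.strip_symm hab.ne hJ ▸ hz) h4
  exact absurd ⟨hz.1.lt_of_ne (Ne.symm h1), hz.2.1.lt_of_ne h2, hz.2.2.1.lt_of_ne (Ne.symm h3),
    hz.2.2.2.lt_of_ne (Ne.symm h4)⟩ hz'

/-- A boundary point of the strip has one of its four inequalities sharp, which puts it on the edge,
the top, or a hexagon side. -/
theorem frontier_ostrip_subset (hab : Γ.Adj a b) :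
    frontier (S.ostrip a b (Complex.I * udir a b)) ⊆ S.skeleton := by
  intro z hz
  rw [(S.isOpen_ostrip _ _ _).frontier_eq] at hz
  exact S.mem_skeleton_of_mem_strip hab
    (closure_minimal (S.ostrip_subset_strip _ _ _) (S.isClosed_strip _ _ _) hz.1) hz.2

theorem disjoint_ostrip_skeleton (hab : Γ.Adj a b) :
    Disjoint (S.ostrip a b (Complex.I * udir a b)) S.skeleton := by
  have hJ : IsSide (udir a b) (Complex.I * udir a b) := Or.inl rfl
  rw [Set.disjoint_left]
  intro z hz hzs
  have hz' := S.ostrip_subset_strip _ _ _ hz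
  rcases S.mem_skeleton.1 hzs with h | ⟨i, hi, h⟩
  · exact hz.1.ne' (S.dot_eq_zero_of_mem_strip_of_mem_carrier hab hJ hz' h)
  · cases i with
    | spoke v =>
      exact S.notMem_spokeSeg_of_mem_strip hab hJ hz' (S.spoke_mem_pieces.1 hi) h
    | side v n =>
      rw [side_mem_pieces] at hi
      rcases S.eq_of_mem_strip_of_mem_chex hab hJ hz' hi.1 ((S.mem_side hi.2).1 h).2 with
        ⟨-, h⟩ | ⟨-, h⟩
      · exact hz.2.2.1.ne' h
      · exact hz.2.2.2.ne' h
    | top a' b' =>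
      rw [top_mem_pieces] at hi
      rw [S.mem_top hi] at h
      obtain ⟨rfl, rfl⟩ := S.eq_of_mem_strip_dart hab hi hz' h.1 hz.1
      exact hz.2.1.ne h.2

end pieces

end StripData

/-- A vertex without edges would be an isolated point of the connected carrier. -/
theorem PSLG.exists_adj_of_isFace (Γ : PSLG) {Ω : Set ℂ} (hΩ : Γ.IsFace Ω)
    (hconn : IsPreconnected Γ.carrier) {v : ℂ} (hv : v ∈ Γ.verts) : ∃ b, Γ.Adj v b := by
  classical
  by_contra! hno
  have hF : IsClosed ((Γ.verts.erase v : Set ℂ) ∪ ⋃ e ∈ Γ.edges, closedEdge e) :=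
    (Γ.verts.erase v).finite_toSet.isClosed.union
      (Γ.edges.isCompact_biUnion fun e _ => isCompact_closedEdge e).isClosed
  have hvF : v ∉ (Γ.verts.erase v : Set ℂ) ∪ ⋃ e ∈ Γ.edges, closedEdge e := by
    rintro (h | h)
    · exact (Finset.mem_erase.1 h).1 rfl
    · obtain ⟨e, he, h⟩ := Set.mem_iUnion₂.1 h
      rcases mem_closedEdge.1 h with h | h
      · obtain ⟨b, rfl⟩ := Sym2.mem_iff_exists.1 h
        exact hno b he
      · exact Γ.vertex_notMem e he v hv h
  obtain ⟨r, hr, hball⟩ := Metric.isOpen_iff.1 hF.isOpen_compl v hvF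
  refine IsFace.not_isolated hΩ hconn (Γ.mem_carrier.2 (Or.inl hv)) hr fun z hz hzK => ?_
  by_contra hne
  refine hball hz ?_
  rcases Γ.mem_carrier.1 hzK with h | ⟨e, he, h⟩
  · exact Or.inl (Finset.mem_erase.2 ⟨hne, h⟩)
  · exact Or.inr (Set.mem_iUnion₂.2 ⟨e, he, openEdge_subset_closedEdge e h⟩)

/-- A convex face meets every disc in a convex set, and it cannot be slit at `x`: the vertex would
be the midpoint of two points of the face. -/
theorem isSimplePolygonalDomain_of_convex (Γ : PSLG) {Ω : Set ℂ} (hΩ : Γ.IsFace Ω)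
    (hconn : IsPreconnected Γ.carrier) (hconv : Convex ℝ Ω) : IsSimplePolygonalDomain Ω := by
  refine Γ.isSimplePolygonalDomain hΩ hconn (fun x _ ρ hρ => ⟨_, Metric.ball_mem_nhds x hρ,
    subset_rfl, ((convex_ball x ρ).inter hconv).isPreconnected⟩) fun x hx α r hr h => ?_
  have hpi := Real.pi_pos
  have key : ∀ θ : ℝ, α < θ → θ < α + 2 * Real.pi →
      x + (r / 2 : ℝ) * Complex.exp (θ * Complex.I) ∈ Ω := fun θ h1 h2 =>
    h _ (mem_sector.2 ⟨r / 2, θ, by positivity, h1, h2, rfl⟩)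
      (by rw [norm_mul, Complex.norm_exp_ofReal_mul_I, mul_one, Complex.norm_real,
            Real.norm_of_nonneg (by positivity)]; linarith)
  have h1 := key (α + Real.pi / 2) (by linarith) (by linarith)
  have h2 := key (α + Real.pi / 2 + Real.pi) (by linarith) (by linarith)
  refine IsFace.subset_compl hΩ (hconv.segment_subset h1 h2
    (mem_segment_complex.2 ⟨1 / 2, by norm_num, by norm_num, ?_⟩)) (Γ.mem_carrier.2 (Or.inl hx))
  rw [Complex.ofReal_add (α + Real.pi / 2), add_mul _ (Real.pi : ℂ), Complex.exp_add,
    Complex.exp_pi_mul_I]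
  push_cast
  ring

/-- A domain disjoint from an open set that is adherent to a point is not slit at that point. -/
theorem not_forall_mem_sector {Ω U : Set ℂ} {x : ℂ} (hU : IsOpen U) (hx : x ∈ closure U)
    (hdisj : Disjoint Ω U) (α r : ℝ) (hr : 0 < r) :
    ¬ ∀ z ∈ sector α (α + 2 * Real.pi), ‖z‖ < r → x + z ∈ Ω := by
  intro h
  obtain ⟨p, hpx, hpU⟩ := mem_closure_iff.1 hx _ Metric.isOpen_ball (Metric.mem_ball_self hr)
  set n := Complex.I * Complex.exp (α * Complex.I) with hn
  have hn1 : dot n n = 1 := by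
    rw [dot_self, hn, norm_mul, Complex.norm_I, Complex.norm_exp_ofReal_mul_I]
    norm_num
  have hV : IsOpen (Metric.ball x r ∩ U) := Metric.isOpen_ball.inter hU
  have hcont : Continuous fun t : ℝ => p + t * n := by fun_prop
  obtain ⟨ε, hε, hball⟩ := Metric.isOpen_iff.1 (hV.preimage hcont) 0 (by
    simpa using ⟨hpx, hpU⟩)
  -- A point of `U` near `x` is moved off the line of the slit, where the full sector would put it
  -- in `Ω`.
  obtain ⟨t, ht, htne⟩ : ∃ t : ℝ, |t| < ε ∧ dot (p - x) n + t ≠ 0 := by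
    by_cases h0 : dot (p - x) n = 0
    · exact ⟨ε / 2, by rw [abs_of_pos (by positivity)]; linarith, by rw [h0]; positivity⟩
    · exact ⟨0, by simpa using hε, by simpa using h0⟩
  obtain ⟨hq1, hq2⟩ := hball (show t ∈ Metric.ball 0 ε by simpa using ht)
  have hdot : dot (p + t * n - x) n ≠ 0 := by
    have e : p + t * n - x = (p - x) + t * n := by ring
    rw [e, dot_add_left, dot_smul_left, hn1, mul_one]
    exact htne
  have hqx : p + t * n ≠ x := fun hq => hdot (by rw [hq, sub_self, dot_zero_left])
  obtain ⟨s, θ, hs, hsr, h1, h2, hq⟩ := exists_cone_angle hqx hq1 α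
  rcases h1.eq_or_lt with rfl | h1
  · rw [hq, add_sub_cancel_left, hn, dot_mul_exp, sub_self, Real.sin_zero, mul_zero] at hdot
    exact hdot rfl
  · refine Set.disjoint_left.1 hdisj ?_ hq2
    change p + t * n ∈ Ω
    rw [hq]
    refine h _ (mem_sector.2 ⟨s, θ, hs, h1, h2, rfl⟩) ?_
    rwa [norm_mul, Complex.norm_exp_ofReal_mul_I, mul_one, Complex.norm_real,
      Real.norm_of_nonneg hs.le]

/-! ### Faces outside the hexagons and strips -/

namespace StripData

variable {Γ : PSLG} (S : StripData Γ) {a b v x z J : ℂ}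

/-- The union of the hexagons and strips. -/
def filled : Set ℂ := (⋃ v ∈ Γ.verts, S.chex v) ∪
  ⋃ p ∈ S.darts, S.strip p.1 p.2 (Complex.I * udir p.1 p.2)

theorem chex_subset_filled (hv : v ∈ Γ.verts) : S.chex v ⊆ S.filled :=
  fun _ h => Or.inl (Set.mem_iUnion₂.2 ⟨v, hv, h⟩)

theorem strip_subset_filled (hab : Γ.Adj a b) (hJ : IsSide (udir a b) J) :
    S.strip a b J ⊆ S.filled := by
  intro z hz
  rcases hJ with rfl | rfl
  · exact Or.inr (Set.mem_iUnion₂.2 ⟨(a, b), S.mem_darts.2 hab, hz⟩)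
  · rw [S.strip_symm hab.ne (Or.inr rfl)] at hz
    refine Or.inr (Set.mem_iUnion₂.2 ⟨(b, a), S.mem_darts.2 hab.symm, ?_⟩)
    change z ∈ S.strip b a (Complex.I * udir b a)
    rwa [udir_symm a b, mul_neg]

theorem skeleton_subset_filled : S.skeleton ⊆ S.filled := by
  intro z hz
  rcases S.mem_skeleton.1 hz with h | ⟨i, hi, h⟩
  · rcases Γ.mem_carrier.1 h with h | ⟨e, he, h⟩
    · exact S.chex_subset_filled h (S.hex_subset_chex z (S.center_mem_hex z))
    · induction e with | _ a b =>
      have hab : Γ.Adj a b := he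
      have hJ : IsSide (udir a b) (Complex.I * udir a b) := Or.inl rfl
      rcases S.mem_chex_or_mem_strip hab hJ (openEdge_subset_closedEdge _ h) with h | h | h
      · exact S.chex_subset_filled hab.left h
      · exact S.chex_subset_filled hab.right h
      · exact S.strip_subset_filled hab hJ h
  · cases i with
    | spoke v =>
      rw [spoke_mem_pieces] at hi
      exact S.chex_subset_filled (S.spokes_subset hi) (S.spokeSeg_subset_chex hi h)
    | side v n =>
      rw [side_mem_pieces] at hi
      exact S.chex_subset_filled hi.1 ((S.mem_side hi.2).1 h).2
    | top a b =>
      rw [top_mem_pieces] at hi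
      exact S.strip_subset_filled hi (Or.inl rfl) ((S.mem_top hi).1 h).1

theorem lt_dot_of_mem_chex (hab : Γ.Adj a b) (hJ : IsSide (udir a b) J) (hx : x ∈ S.strip a b J)
    (hxa : x ∈ S.chex a) : S.R < dot (x - b) (port (udir b a) J) := by
  refine hx.2.2.2.lt_of_ne fun h => hab.ne ?_
  have hx' : x ∈ S.strip b a J := S.strip_symm hab.ne hJ ▸ hx
  exact S.eq_of_mem_chex hab.left hab.right hxa (S.mem_chex_of_dot_le hab.symm (isSide_swap hJ)
    ((S.le_dot_of_mem_strip hab.symm (isSide_swap hJ) hx').trans' (by have := S.R_pos; positivity))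
    hx'.1 hx'.2.1 h.ge)

/-- Near a point of the port side only the port inequality can change its truth: the end at `b` is
far and the point is well ahead of `a`. -/
theorem eventually_mem_strip (hab : Γ.Adj a b) (hJ : IsSide (udir a b) J)
    (hx : x ∈ S.strip a b J) (hxa : x ∈ S.chex a) : ∀ᶠ z in 𝓝 x, 0 ≤ dot (z - a) J →
      dot (z - a) J ≤ S.δ → (S.R ≤ dot (z - a) (port (udir a b) J) → z ∈ S.strip a b J) ∧
        (dot (z - a) (port (udir a b) J) ≤ S.R → z ∈ S.chex a) := by
  have h1 : 0 < dot (x - a) (udir a b) :=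
    (S.le_dot_of_mem_strip hab hJ hx).trans_lt' (by have := S.R_pos; positivity)
  have h2 := S.lt_dot_of_mem_chex hab hJ hx hxa
  have c1 : Continuous fun z => dot (z - a) (udir a b) := by fun_prop
  have c2 : Continuous fun z => dot (z - b) (port (udir b a) J) := by fun_prop
  filter_upwards [(c1.tendsto x).eventually_const_lt h1, (c2.tendsto x).eventually_const_lt h2]
    with z h1 h2 h3 h4
  exact ⟨fun h => ⟨h3, h4, h, h2.le⟩, fun h => S.mem_chex_of_dot_le hab hJ h1.le h3 h4 h⟩

theorem eventually_mem_filled (hab : Γ.Adj a b) (hJ : IsSide (udir a b) J)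
    (hx : x ∈ S.strip a b J) (hxa : x ∈ S.chex a) : ∀ᶠ z in 𝓝 x, 0 ≤ dot (z - a) J →
      dot (z - a) J ≤ S.δ → z ∈ S.filled := by
  filter_upwards [S.eventually_mem_strip hab hJ hx hxa] with z hz h1 h2
  rcases le_total S.R (dot (z - a) (port (udir a b) J)) with h | h
  · exact S.strip_subset_filled hab hJ ((hz h1 h2).1 h)
  · exact S.chex_subset_filled hab.left ((hz h1 h2).2 h)

/-- The ports of the two sides may differ when the edge leaves through a corner, but both attain
`hexNorm` on the direction of the edge, so at height 0 they impose the same condition. -/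
theorem mem_strip_neg (hab : Γ.Adj a b) (hJ : IsSide (udir a b) J) (hx : x ∈ S.strip a b J)
    (h0 : dot (x - a) J = 0) : x ∈ S.strip a b (-J) := by
  have key : ∀ a b, Γ.Adj a b → IsSide (udir a b) J → dot (x - a) J = 0 →
      dot (x - a) (port (udir a b) (-J)) = dot (x - a) (port (udir a b) J) := by
    intro a b hab hJ h0
    rw [hJ.dot_eq hab.norm, h0, hJ.dot_eq hab.norm _ (port (udir a b) J), h0,
      (port_spec hab.norm hJ).2.1, (port_spec hab.norm hJ.neg_right).2.1]
    ring
  refine ⟨?_, ?_, ?_, ?_⟩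
  · rw [dot_neg_right, h0, neg_zero]
  · rw [dot_neg_right, h0, neg_zero]
    exact S.δ_pos.le
  · rw [key a b hab hJ h0]
    exact hx.2.2.1
  · rw [key b a hab.symm (isSide_swap hJ) (by rw [← dot_sub_side hab.ne hJ, h0])]
    exact hx.2.2.2

/-- Below the top, hexagon and strip cover a neighborhood; on the edge itself the strip of the other
side supplies the other half. -/
theorem filled_mem_nhds (hab : Γ.Adj a b) (hJ : IsSide (udir a b) J) (hx : x ∈ S.strip a b J)
    (hxa : x ∈ S.chex a) (hlt : dot (x - a) J < S.δ) : S.filled ∈ 𝓝 x := by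
  have c1 : Continuous fun z => dot (z - a) J := by fun_prop
  have e1 := S.eventually_mem_filled hab hJ hx hxa
  have e2 := (c1.tendsto x).eventually_lt_const hlt
  rcases hx.1.eq_or_lt with h0 | h0
  · have e3 := S.eventually_mem_filled hab hJ.neg_right (S.mem_strip_neg hab hJ hx h0.symm) hxa
    have e4 := (c1.tendsto x).eventually_const_lt
      (show -S.δ < dot (x - a) J by rw [← h0]; linarith [S.δ_pos])
    filter_upwards [e1, e2, e3, e4] with z h1 h2 h3 h4
    rcases le_total 0 (dot (z - a) J) with h | h
    · exact h1 h h2.le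
    · rw [dot_neg_right] at h3
      exact h3 (by linarith) (by linarith)
  · filter_upwards [e1, e2, (c1.tendsto x).eventually_const_lt h0] with z h1 h2 h3
    exact h1 h3.le h2.le

/-- At a top end the complement is locally the intersection of two half-planes, beyond the top and
beyond the port side, hence convex. By `port_lt` no other side of the hexagon is active there. -/
theorem isPreconnected_diff_filled_of_topEnd (hab : Γ.Adj a b) (hJ : IsSide (udir a b) J)
    (hx : x ∈ S.strip a b J) (hxa : x ∈ S.chex a) (hδ : dot (x - a) J = S.δ) {ρ : ℝ} (hρ : 0 < ρ) :
    ∃ N ∈ 𝓝 x, N ⊆ Metric.ball x ρ ∧ IsPreconnected (N \ S.filled) := by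
  classical
  have hn := port_spec hab.norm hJ
  have hxn : dot (x - a) (port (udir a b) J) = S.R :=
    le_antisymm (hexNorm_le_iff.1 hxa _ hn.1) hx.2.2.1
  have e1 := S.eventually_mem_strip hab hJ hx hxa
  have c1 : Continuous fun z => dot (z - a) J := by fun_prop
  have e2 := (c1.tendsto x).eventually_const_lt (hδ.symm ▸ S.δ_pos)
  have e3 : ∀ᶠ z in 𝓝 x, ∀ m ∈ hexNormals, m ≠ port (udir a b) J → dot (z - a) m < S.R := by
    rw [Filter.eventually_all_finset]
    intro m hm
    by_cases hmn : m = port (udir a b) J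
    · exact Eventually.of_forall fun _ h => absurd hmn h
    have c : Continuous fun z => dot (z - a) m := by fun_prop
    refine ((c.tendsto x).eventually_lt_const ?_).mono fun _ h _ => h
    rw [hJ.dot_eq hab.norm]
    refine S.port_lt a b J hab hJ m hm hmn _ _ (hδ.symm ▸ S.δ_pos) hδ.le ?_
    rw [← hJ.dot_eq hab.norm, hxn]
  -- All other hexagons and strips. The strip itself may be listed from either end, so strips are
  -- discarded by equality of sets.
  set F : Set ℂ := (⋃ v ∈ Γ.verts.erase a, S.chex v) ∪
    ⋃ p ∈ S.darts.filter fun p => S.strip p.1 p.2 (Complex.I * udir p.1 p.2) ≠ S.strip a b J,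
      S.strip p.1 p.2 (Complex.I * udir p.1 p.2) with hF
  have hFc : IsClosed F := (isClosed_biUnion_finset fun v _ => S.isClosed_chex v).union
    (isClosed_biUnion_finset fun p _ => S.isClosed_strip _ _ _)
  have hxF : x ∉ F := by
    rintro (h | h)
    · obtain ⟨v, hv, h⟩ := Set.mem_iUnion₂.1 h
      rw [Finset.mem_erase] at hv
      exact hv.1 (S.eq_of_mem_chex hv.2 hab.left h hxa)
    · obtain ⟨p, hp, h⟩ := Set.mem_iUnion₂.1 h
      rw [Finset.mem_filter, mem_darts] at hp
      rcases S.eq_of_mem_strip_of_mem_strip hab hJ hp.1 (Or.inl rfl) hx h with ⟨h1, h2⟩ | h1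
      · apply hp.2
        rw [← h2]
        rcases Sym2.eq_iff.1 h1 with ⟨h3, h4⟩ | ⟨h3, h4⟩
        · rw [← h3, ← h4]
        · rw [← h3, ← h4, S.strip_symm hab.ne hJ]
      · exact S.δ_pos.ne' (hδ.symm.trans h1)
  have e4 := hFc.isOpen_compl.mem_nhds hxF
  obtain ⟨r, hr, hball⟩ := Metric.eventually_nhds_iff_ball.1
    (e1.and (e2.and (e3.and (show ∀ᶠ z in 𝓝 x, z ∈ Fᶜ from e4))))
  refine ⟨Metric.ball x (min r ρ), Metric.ball_mem_nhds x (lt_min hr hρ),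
    Metric.ball_subset_ball (min_le_right _ _), ?_⟩
  have heq : Metric.ball x (min r ρ) \ S.filled = Metric.ball x (min r ρ) ∩
      ({z | S.δ < dot (z - a) J} ∩ {z | S.R < dot (z - a) (port (udir a b) J)}) := by
    ext z
    constructor
    · rintro ⟨hz, hzf⟩
      obtain ⟨h1, h2, h3, -⟩ := hball z (Metric.ball_subset_ball (min_le_left _ _) hz)
      have hp : S.R < dot (z - a) (port (udir a b) J) := by
        by_contra! hle
        refine hzf (S.chex_subset_filled hab.left (hexNorm_le_iff.2 fun m hm => ?_))
        by_cases hmn : m = port (udir a b) J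
        · rwa [hmn]
        · exact (h3 m hm hmn).le
      refine ⟨hz, ?_, hp⟩
      rw [Set.mem_ofPred_eq]
      by_contra! hle
      exact hzf (S.strip_subset_filled hab hJ ((h1 h2.le hle).1 hp.le))
    · rintro ⟨hz, hzδ, hzp⟩
      have hzδ : S.δ < dot (z - a) J := hzδ
      have hzp : S.R < dot (z - a) (port (udir a b) J) := hzp
      obtain ⟨-, -, -, h4⟩ := hball z (Metric.ball_subset_ball (min_le_left _ _) hz)
      refine ⟨hz, ?_⟩
      rintro (h | h)
      · obtain ⟨v, hv, h⟩ := Set.mem_iUnion₂.1 h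
        by_cases hva : v = a
        · subst hva
          have := hexNorm_le_iff.1 h _ hn.1
          linarith
        · exact h4 (Or.inl (Set.mem_iUnion₂.2 ⟨v, Finset.mem_erase.2 ⟨hva, hv⟩, h⟩))
      · obtain ⟨p, hp, h⟩ := Set.mem_iUnion₂.1 h
        by_cases hpT : S.strip p.1 p.2 (Complex.I * udir p.1 p.2) = S.strip a b J
        · rw [hpT] at h
          linarith [h.2.1]
        · exact h4 (Or.inr (Set.mem_iUnion₂.2 ⟨p, Finset.mem_filter.2 ⟨hp, hpT⟩, h⟩))
  rw [heq]
  exact ((convex_ball _ _).inter ((convex_lt_dot a J S.δ).inter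
    (convex_lt_dot a _ S.R))).isPreconnected

/-- Away from the strips the complement is locally a union of the half-planes beyond the sides
through `x`, and all of these contain the points slightly beyond `x` on the ray from `v`. -/
theorem isPreconnected_diff_filled_of_notMem_strip (hv : v ∈ Γ.verts)
    (hxv : hexNorm (x - v) = S.R)
    (hx : ∀ p ∈ S.darts, x ∉ S.strip p.1 p.2 (Complex.I * udir p.1 p.2)) {ρ : ℝ} (hρ : 0 < ρ) :
    ∃ N ∈ 𝓝 x, N ⊆ Metric.ball x ρ ∧ IsPreconnected (N \ S.filled) := by
  classical
  have hxc : x ∈ S.chex v := hxv.le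
  set F : Set ℂ := (⋃ v' ∈ Γ.verts.erase v, S.chex v') ∪
    ⋃ p ∈ S.darts, S.strip p.1 p.2 (Complex.I * udir p.1 p.2) with hF
  have hFc : IsClosed F := (isClosed_biUnion_finset fun v _ => S.isClosed_chex v).union
    (isClosed_biUnion_finset fun p _ => S.isClosed_strip _ _ _)
  have hxF : x ∉ F := by
    rintro (h | h)
    · obtain ⟨v', hv', h⟩ := Set.mem_iUnion₂.1 h
      rw [Finset.mem_erase] at hv'
      exact hv'.1 (S.eq_of_mem_chex hv'.2 hv h hxc)
    · obtain ⟨p, hp, h⟩ := Set.mem_iUnion₂.1 h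
      exact hx p hp h
  have hfilled : S.filled ⊆ S.chex v ∪ F := by
    rintro z (h | h)
    · obtain ⟨v', hv', h⟩ := Set.mem_iUnion₂.1 h
      by_cases hvv : v' = v
      · exact Or.inl (hvv ▸ h)
      · exact Or.inr (Or.inl (Set.mem_iUnion₂.2 ⟨v', Finset.mem_erase.2 ⟨hvv, hv'⟩, h⟩))
    · exact Or.inr (Or.inr h)
  have e1 : ∀ᶠ z in 𝓝 x, ∀ n ∈ hexNormals, dot (x - v) n < S.R → dot (z - v) n < S.R := by
    rw [Filter.eventually_all_finset]
    intro n _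
    by_cases h : dot (x - v) n < S.R
    · have c : Continuous fun z => dot (z - v) n := by fun_prop
      exact ((c.tendsto x).eventually_lt_const h).mono fun _ h _ => h
    · exact Eventually.of_forall fun _ h' => absurd h' h
  obtain ⟨r, hr, hball⟩ := Metric.eventually_nhds_iff_ball.1
    (e1.and (show ∀ᶠ z in 𝓝 x, z ∈ Fᶜ from hFc.isOpen_compl.mem_nhds hxF))
  have hm := lt_min hr hρ
  refine ⟨Metric.ball x (min r ρ), Metric.ball_mem_nhds x hm,
    Metric.ball_subset_ball (min_le_right _ _), ?_⟩
  have hpos : 0 < ‖x - v‖ + 1 := by positivity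
  set s := min r ρ / (‖x - v‖ + 1) with hs
  have hs0 : 0 < s := div_pos hm hpos
  have hp : x + s * (x - v) ∈ Metric.ball x (min r ρ) := by
    rw [Metric.mem_ball, dist_eq_norm, add_sub_cancel_left, norm_mul, Complex.norm_real,
      Real.norm_of_nonneg hs0.le]
    calc s * ‖x - v‖ < s * (‖x - v‖ + 1) := by nlinarith
      _ = min r ρ := by rw [hs]; field_simp
  refine isPreconnected_of_forall (x + s * (x - v)) fun y hy => ?_
  have hyv : ∃ n ∈ hexNormals, S.R < dot (y - v) n := by
    by_contra! hle
    exact hy.2 (S.chex_subset_filled hv (hexNorm_le_iff.2 hle))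
  obtain ⟨n, hn, hyn⟩ := hyv
  have hxn : dot (x - v) n = S.R := by
    refine (hexNorm_le_iff.1 hxv.le n hn).eq_or_lt.resolve_right fun hlt => ?_
    have := (hball y (Metric.ball_subset_ball (min_le_left _ _) hy.1)).1 n hn hlt
    linarith
  refine ⟨Metric.ball x (min r ρ) ∩ {z | S.R < dot (z - v) n}, ?_, ⟨hp, ?_⟩, ⟨hy.1, hyn⟩,
    ((convex_ball _ _).inter (convex_lt_dot v n S.R)).isPreconnected⟩
  · rintro z ⟨hz, hzn⟩
    have hzn : S.R < dot (z - v) n := hzn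
    refine ⟨hz, fun h => ?_⟩
    rcases hfilled h with h | h
    · have := hexNorm_le_iff.1 h n hn
      linarith
    · exact (hball z (Metric.ball_subset_ball (min_le_left _ _) hz)).2 h
  · have e : x + s * (x - v) - v = (x - v) + s * (x - v) := by ring
    rw [Set.mem_ofPred_eq, e, dot_add_left, dot_smul_left, hxn]
    have := mul_pos hs0 S.R_pos
    linarith

theorem exists_isPreconnected_diff_filled (hv : v ∈ Γ.verts) (hx : x ∈ S.chex v) {ρ : ℝ}
    (hρ : 0 < ρ) : ∃ N ∈ 𝓝 x, N ⊆ Metric.ball x ρ ∧ IsPreconnected (N \ S.filled) := by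
  have hnhds : S.filled ∈ 𝓝 x →
      ∃ N ∈ 𝓝 x, N ⊆ Metric.ball x ρ ∧ IsPreconnected (N \ S.filled) := fun h => by
    refine ⟨Metric.ball x ρ ∩ S.filled, inter_mem (Metric.ball_mem_nhds x hρ) h,
      Set.inter_subset_left, ?_⟩
    have : (Metric.ball x ρ ∩ S.filled) \ S.filled = ∅ := by
      ext z
      simp
    rw [this]
    exact isPreconnected_empty
  have hxR : hexNorm (x - v) ≤ S.R := hx
  rcases hxR.eq_or_lt with h | h
  · by_cases hstrip : ∀ p ∈ S.darts, x ∉ S.strip p.1 p.2 (Complex.I * udir p.1 p.2)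
    · exact S.isPreconnected_diff_filled_of_notMem_strip hv h hstrip hρ
    push Not at hstrip
    obtain ⟨⟨a, b⟩, hp, hxp⟩ := hstrip
    have hab : Γ.Adj a b := S.mem_darts.1 hp
    have hJ : IsSide (udir a b) (Complex.I * udir a b) := Or.inl rfl
    have hxp : x ∈ S.strip a b (Complex.I * udir a b) := hxp
    have key : ∀ b J, Γ.Adj v b → IsSide (udir v b) J → x ∈ S.strip v b J →
        ∃ N ∈ 𝓝 x, N ⊆ Metric.ball x ρ ∧ IsPreconnected (N \ S.filled) := by
      intro b J hvb hJ hxs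
      rcases hxs.2.1.eq_or_lt with h | h
      · exact S.isPreconnected_diff_filled_of_topEnd hvb hJ hxs hx h hρ
      · exact hnhds (S.filled_mem_nhds hvb hJ hxs hx h)
    rcases S.eq_of_mem_strip_of_mem_chex hab hJ hxp hv hx with ⟨rfl, -⟩ | ⟨rfl, -⟩
    · exact key b _ hab hJ hxp
    · exact key a _ hab.symm (isSide_swap hJ) (S.strip_symm hab.ne hJ ▸ hxp)
  · exact hnhds (mem_of_superset ((S.isOpen_hex v).mem_nhds h)
      ((S.hex_subset_chex v).trans (S.chex_subset_filled hv)))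

theorem exists_mem_chex_of_mem_nodes (hx : x ∈ S.nodes) : ∃ v ∈ Γ.verts, x ∈ S.chex v := by
  rcases S.mem_nodes.1 hx with h | ⟨v, hv, rfl⟩ | ⟨v, hv, n, hn, h⟩ | ⟨a, b, hab, h⟩
  · exact ⟨x, h, S.hex_subset_chex x (S.center_mem_hex x)⟩
  · exact ⟨v, S.spokes_subset hv, (S.hexNorm_hexExit (S.norm_spokeDir v hv)).le⟩
  · refine ⟨v, hv, ((S.mem_side hn).1 ?_).2⟩
    rcases h with rfl | rfl
    · exact left_mem_segment ℝ _ _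
    · exact right_mem_segment ℝ _ _
  · have hJ : IsSide (udir a b) (Complex.I * udir a b) := Or.inl rfl
    rcases h with rfl | rfl | rfl
    · exact ⟨a, hab.left, S.topEnd_mem_chex hab hJ⟩
    · exact ⟨b, hab.right, S.topEnd_mem_chex hab.symm (isSide_swap hJ)⟩
    · exact ⟨a, hab.left, (S.hexNorm_hexExit hab.norm).le⟩

theorem mem_closure_hex (hx : x ∈ S.chex v) : x ∈ closure (S.hex v) := by
  have hR := S.R_pos
  have hx : hexNorm (x - v) ≤ S.R := hx
  refine Metric.mem_closure_iff.2 fun ε hε => ?_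
  have hpos : 0 < ‖x - v‖ + 1 := by positivity
  set s := min 1 (ε / (‖x - v‖ + 1)) with hs
  have hs0 : 0 < s := lt_min one_pos (by positivity)
  have hs1 : s ≤ 1 := min_le_left _ _
  refine ⟨v + (1 - s : ℝ) * (x - v), ?_, ?_⟩
  · change hexNorm (v + (1 - s : ℝ) * (x - v) - v) < S.R
    rw [add_sub_cancel_left, hexNorm_smul (by linarith)]
    nlinarith
  · have e : x - (v + (1 - s : ℝ) * (x - v)) = s * (x - v) := by push_cast; ring
    rw [dist_eq_norm, e, norm_mul, Complex.norm_real, Real.norm_of_nonneg hs0.le]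
    calc s * ‖x - v‖ < s * (‖x - v‖ + 1) := by nlinarith
      _ ≤ ε / (‖x - v‖ + 1) * (‖x - v‖ + 1) :=
        mul_le_mul_of_nonneg_right (min_le_right _ _) hpos.le
      _ = ε := by field_simp

/-- A face that meets an open hexagon or an open strip equals one of the convex pieces. Any other
face avoids `filled`, and since every node lies in a closed hexagon, it is locally connected there
and not slit, for the open hexagon is disjoint from it. -/
theorem isSimplePolygonalDomain_of_isFace
    (hedge : ∀ v ∈ Γ.verts, ∃ b, Γ.Adj v b) {Γ' : PSLG} (hgood : Γ'.IsGoodRefinement Γ)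
    (hconn : IsPreconnected Γ'.carrier) (hcarrier : Γ'.carrier = S.skeleton ∩ polyHull Γ.carrier)
    (hverts : Γ'.verts ⊆ S.nodes) {Ω : Set ℂ} (hΩ : Γ'.IsFace Ω) : IsSimplePolygonalDomain Ω := by
  have hΩhull : Ω ⊆ polyHull Γ.carrier :=
    IsFace.subset_polyHull hgood.carrier_subset hgood.subset_hull hΩ
  have hΩs : Disjoint Ω S.skeleton := by
    refine Set.disjoint_left.2 fun z hz hzs => IsFace.subset_compl hΩ hz ?_
    rw [hcarrier]
    exact ⟨hzs, hΩhull hz⟩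
  have hsub : Γ'.carrier ⊆ S.skeleton := by
    rw [hcarrier]
    exact Set.inter_subset_left
  -- A convex piece bounded by the skeleton swallows every face it meets, and is contained in it in
  -- turn.
  have hpiece : ∀ Q : Set ℂ, IsOpen Q → Convex ℝ Q → Disjoint Q S.skeleton →
      frontier Q ⊆ S.skeleton → (Ω ∩ Q).Nonempty → IsSimplePolygonalDomain Ω := by
    intro Q hQ hQc hQs hfr hne
    have h1 : Ω ⊆ Q :=
      IsPreconnected.subset_of_frontier_subset hQ hfr (IsFace.isPreconnected hΩ) hΩs hne
    obtain ⟨z, hz, hzQ⟩ := hne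
    have h2 : Q ⊆ Ω := IsFace.subset_of_meets hΩ hQc.isPreconnected
      (fun y hy hy' => Set.disjoint_left.1 hQs hy (hsub hy')) hzQ hz
    exact isSimplePolygonalDomain_of_convex Γ' hΩ hconn (h1.antisymm h2 ▸ hQc)
  by_cases hhex : ∃ v ∈ Γ.verts, (Ω ∩ S.hex v).Nonempty
  · obtain ⟨v, hv, z, hz, hzv⟩ := hhex
    obtain ⟨Q, h1, h2, h3, h4, h5⟩ :=
      S.exists_convex_of_mem_hex hedge hv hzv (Set.disjoint_left.1 hΩs hz)
    exact hpiece Q h1 h2 h4 h5 ⟨z, hz, h3⟩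
  by_cases hstrip : ∃ a b, Γ.Adj a b ∧ (Ω ∩ S.ostrip a b (Complex.I * udir a b)).Nonempty
  · obtain ⟨a, b, hab, hne⟩ := hstrip
    exact hpiece _ (S.isOpen_ostrip _ _ _) (S.convex_ostrip _ _ _) (S.disjoint_ostrip_skeleton hab)
      (S.frontier_ostrip_subset hab) hne
  push Not at hhex hstrip
  have hΩf : Disjoint Ω S.filled := by
    refine Set.disjoint_left.2 fun z hz hzf => ?_
    have hzs := Set.disjoint_left.1 hΩs hz
    rcases hzf with h | h
    · obtain ⟨v, hv, h⟩ := Set.mem_iUnion₂.1 h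
      have h : hexNorm (z - v) ≤ S.R := h
      rcases h.eq_or_lt with h | h
      · exact hzs (S.mem_skeleton_of_hexNorm_eq hv h)
      · exact (hhex v hv).le (show z ∈ Ω ∩ S.hex v from ⟨hz, h⟩)
    · obtain ⟨p, hp, h⟩ := Set.mem_iUnion₂.1 h
      rw [mem_darts] at hp
      refine hzs (S.mem_skeleton_of_mem_strip hp h fun h' => ?_)
      exact (hstrip _ _ hp).le (show z ∈ Ω ∩ S.ostrip _ _ _ from ⟨hz, h'⟩)
  refine Γ'.isSimplePolygonalDomain hΩ hconn (fun x hx ρ hρ => ?_) fun x hx α r hr => ?_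
  · obtain ⟨v, hv, hxv⟩ := S.exists_mem_chex_of_mem_nodes (hverts hx)
    obtain ⟨N, hN, hNρ, hNpre⟩ := S.exists_isPreconnected_diff_filled hv hxv hρ
    refine ⟨N, hN, hNρ, ?_⟩
    rcases Set.eq_empty_or_nonempty (N ∩ Ω) with hemp | ⟨z, hzN, hzΩ⟩
    · rw [hemp]
      exact isPreconnected_empty
    · have hsubΩ : N \ S.filled ⊆ Ω := IsFace.subset_of_meets hΩ hNpre
        (fun y hy hy' => hy.2 (S.skeleton_subset_filled (hsub hy')))
        (show z ∈ N \ S.filled from ⟨hzN, Set.disjoint_left.1 hΩf hzΩ⟩) hzΩ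
      -- The connected set `N \ S.filled` avoids the graph, so it lies in `Ω` as soon as it meets
      -- it.
      have heq : N ∩ Ω = N \ S.filled := by
        ext y
        exact ⟨fun hy => ⟨hy.1, Set.disjoint_left.1 hΩf hy.2⟩, fun hy => ⟨hy.1, hsubΩ hy⟩⟩
      rwa [heq]
  · obtain ⟨v, hv, hxv⟩ := S.exists_mem_chex_of_mem_nodes (hverts hx)
    refine not_forall_mem_sector (S.isOpen_hex v) (S.mem_closure_hex hxv) ?_ α r hr
    rw [Set.disjoint_iff_inter_eq_empty]
    exact hhex v hv

end StripData

/-! ### The two stages combined -/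

/-- A connected graph has a good refinement all of whose faces are interiors of simple polygons. -/
theorem PSLG.exists_simple_faces (Γ : PSLG) (hΓ : IsPreconnected Γ.carrier) :
    ∃ Γ' : PSLG, Γ'.IsGoodRefinement Γ ∧ IsPreconnected Γ'.carrier ∧
      Γ'.verts.card ≤ 32 * Γ.verts.card ∧ ∀ Ω, Γ'.IsFace Ω → IsSimplePolygonalDomain Ω := by
  by_cases hface : ∃ Ω, Γ.IsFace Ω
  · obtain ⟨Ω₀, hΩ₀⟩ := hface
    have hedge : ∀ v ∈ Γ.verts, ∃ b, Γ.Adj v b := fun v hv => Γ.exists_adj_of_isFace hΩ₀ hΓ hv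
    obtain ⟨S⟩ := exists_stripData Γ hedge
    obtain ⟨Γ', hgood, hcarrier, hverts⟩ := S.exists_isGoodRefinement
    obtain ⟨Γ₁, -, hΓ₁⟩ := S.exists_pslg_skeleton
    have hconn : IsPreconnected Γ'.carrier := by
      rw [hcarrier]
      refine isPreconnected_frontier_inter Γ.isClosed_carrier (hΓ₁ ▸ Γ₁.isClosed_carrier) hΓ
        (S.isPreconnected_skeleton hΓ hedge) (fun z hz => Or.inl hz)
        (isClosed_polyHull Γ.isClosed_carrier) (isOpen_polyHull_diff Γ.isClosed_carrier)
        (subset_polyHull _)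
    exact ⟨Γ', hgood, hconn, (Finset.card_le_card hverts).trans S.card_nodes_le,
      fun Ω hΩ => S.isSimplePolygonalDomain_of_isFace hedge hgood hconn hcarrier hverts hΩ⟩
  -- Without faces nothing has to be done; this also disposes of a graph consisting of one isolated
  -- vertex.
  · push Not at hface
    exact ⟨Γ, PSLG.IsGoodRefinement.refl Γ, hΓ, by omega, fun Ω hΩ => absurd hΩ (hface Ω)⟩

theorem mainTheorem8 :
    ∃ C : ℕ, ∀ Γ : PSLG, IsConnected Γ.polynomialHull →
      ∃ Γ' : PSLG, Γ'.IsRefinement Γ ∧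
        IsConnected Γ'.carrier ∧
        (Γ'.verts \ Γ.verts).card + (Γ'.edges \ Γ.edges).card ≤ C * Γ.verts.card ∧
        (∀ Ω : Set ℂ, Γ'.IsFace Ω → IsSimplePolygonalDomain Ω) ∧
        ∀ (Ω' : Set ℂ) (v : ℂ) (α β : ℝ), Γ'.IsAngleOf Ω' v α β → β - α < Real.pi / 3 →
          ∃ Ω : Set ℂ, Γ.IsAngleOf Ω v α β := by
  -- Connecting gives at most `3n` vertices, fattening multiplies by 32, and there are at most three
  -- edges per vertex: `96 + 3 * 96 = 384`.
  refine ⟨384, fun Γ hΓ => ?_⟩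
  rw [Γ.polynomialHull_eq] at hΓ
  obtain ⟨Γ₁, hgood₁, hconn₁, hcard₁⟩ := Γ.exists_connected hΓ.isPreconnected
  obtain ⟨Γ', hgood', hconn', hcard', hfaces⟩ := Γ₁.exists_simple_faces hconn₁
  have hgood := hgood'.trans hgood₁
  refine ⟨Γ', ⟨hgood.verts_subset, hgood.carrier_subset⟩, ⟨?_, hconn'⟩, ?_, hfaces,
    fun Ω' v α β hA hlt => hgood.exists_isAngleOf hA hlt⟩
  · obtain ⟨z, hz⟩ := hΓ.nonempty
    rcases Set.eq_empty_or_nonempty Γ.carrier with hemp | hne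
    -- An empty graph has the whole plane as its only complementary component, so its hull would be
    -- empty.
    · exfalso
      rcases hz with h | h
      · rw [hemp] at h
        exact h
      · rw [hemp, Set.compl_empty, connectedComponentIn_univ,
          PreconnectedSpace.connectedComponent_eq_univ] at h
        exact NormedSpace.unbounded_univ ℝ ℂ h
    · exact hne.mono hgood.carrier_subset
  · have h1 : (Γ'.verts \ Γ.verts).card ≤ Γ'.verts.card := Finset.card_le_card Finset.sdiff_subset
    have h2 : (Γ'.edges \ Γ.edges).card ≤ Γ'.edges.card := Finset.card_le_card Finset.sdiff_subset
    have h3 := Γ'.card_edges_le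
    omega
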